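/- Setting. Let $\mathcal X_0,\dots,\mathcal X_N$ and $\mathcal Y_0,\dots,\mathcal Y_N$ be finite dimensional real inner product spaces, $\mathbf X=\prod_i\mathcal X_i$, $\mathbf Y=\prod_i\mathcal Y_i$. For $i=0,\dots,N$ let $\theta_i:\mathcal X_i\to(-\infty,\infty]$ be proper closed convex, $\mathcal Q_i:\mathcal X_i\to\mathcal X_i$ self-adjoint positive semidefinite, $\mathcal A_i:\mathcal X_i\to\mathcal Y_0$ and $\mathcal D_i:\mathcal X_i\to\mathcal Y_i$ linear (with the convention $\mathcal D_0=0$), $c_i\in\mathcal X_i$, $b_i\in\mathcal Y_i$, and $\mathcal K_i\subset\mathcal X_i$ nonempty, closed and convex. Put $\theta(x)=\sum_i\theta_i(x_i)$, $\mathbf K=\prod_i\mathcal K_i$, $\mathbf Qx=(\mathcal Q_ix_i)_i$, $\mathbf W=\mathrm{Range}(\mathbf Q)$, and let $\mathbf B:\mathbf X\to\mathbf Y$, $(\mathbf Bx)_0=\sum_{i=0}^N\mathcal A_ix_i$, $(\mathbf Bx)_i=\mathcal D_ix_i$ for $i\ge1$, be surjective. The primal problem is $$(P)\quad \min\{\theta(x)+\tfrac12\langle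 x,\mathbf Qx\rangle+\langle c,x\rangle \mid \mathbf Bx=b,\ x\in\mathbf K\},$$ and the dual problem (in minimization form) is $$(D)\quad \min\{\theta^*(-s)+\tfrac12\langle w,\mathbf Qw\rangle-\langle b,y\rangle+\delta_{\mathbf K}^*(-z)\mid -\mathbf Qw+\mathbf B^*y+s+z=c,\ w\in\mathbf W\}.$$ KKT mapping. On $\mathcal U=\mathbf Y\times\mathbf W\times\mathbf X\times\mathbf X\times\mathbf X$, with $u=(y,w,s,z,x)$, let $$\mathcal R(u)=\big(\mathbf Bx-b,\ -\mathbf Qw+\mathbf B^*y+s+z-c,\ \mathbf Qw-\mathbf Qx,\ x-\mathrm{Prox}_\theta(x-s),\ x-\Pi_{\mathbf K}(x-z)\big),$$ and let $\bar\Omega=\{u\in\mathcal U:\mathcal R(u)=0\}$ be the set of KKT points. $\mathcal R$ is metrically subregular at $(\bar u,0)$, $\bar u\in\bar\Omega$, if there are $\eta,\rho>0$ with $\mathrm{dist}(u,\bar\Omega)\le\eta\|\mathcal R(u)\|$ for all $u\in\mathcal U$ with $\|u-\bar u\|\le\rho$. Algorithm (sGS-ADMM). Let $\sigma>0$ and $\tau\in(0,(1+\sqrt5)/2)$.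 From an arbitrary $u^0\in\mathcal U$, iterate as follows, all minimizations being exact. With $g^k=(\mathcal A_i^*y_0^k)_i+z^k-c+\sigma^{-1}x^k$: 1a. for $i\ge1$, $\bar y_i^k\in\arg\min_{y_i}\{-\langle b_i,y_i\rangle+\frac\sigma2\|-\mathcal Q_iw_i^k+\mathcal D_i^*y_i+s_i^k+g_i^k\|^2\}$; 1b. for $i\ge0$, $\bar w_i^k\in\arg\min\{\frac12\langle w_i,\mathcal Q_iw_i\rangle+\frac\sigma2\|-\mathcal Q_iw_i+\mathcal D_i^*\bar y_i^k+s_i^k+g_i^k\|^2\mid w_i\in\mathrm{Range}(\mathcal Q_i)\}$; 1c. for $i\ge0$, $s_i^{k+1}\in\arg\min_{s_i}\{\theta_i^*(-s_i)+\frac\sigma2\|-\mathcal Q_i\bar w_i^k+\mathcal D_i^*\bar y_i^k+s_i+g_i^k\|^2\}$; 1d. $w_i^{k+1}$ is computed as in 1b with $s_i^{k+1}$ in place of $s_i^k$; 1e. for $i\ge1$, $y_i^{k+1}$ is computed as in 1a with $w_i^{k+1},s_i^{k+1}$ in place of $w_i^k,s_i^k$. With $h_i^k=-\mathcal Q_iw_i^{k+1}+\mathcal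 D_i^*y_i^{k+1}+s_i^{k+1}-c_i+\sigma^{-1}x_i^k$: 2a. $\bar y_0^k\in\arg\min_{y_0}\{-\langle b_0,y_0\rangle+\sum_{i=0}^N\frac\sigma2\|\mathcal A_i^*y_0+z_i^k+h_i^k\|^2\}$; 2b. for $i\ge0$, $z_i^{k+1}\in\arg\min_{z_i}\{\delta_{\mathcal K_i}^*(-z_i)+\frac\sigma2\|\mathcal A_i^*\bar y_0^k+z_i+h_i^k\|^2\}$; 2c. $y_0^{k+1}$ is computed as in 2a with $z^{k+1}$ in place of $z^k$. 3. $x^{k+1}=x^k+\tau\sigma(-\mathbf Qw^{k+1}+\mathbf B^*y^{k+1}+s^{k+1}+z^{k+1}-c)$. Theorem. Let $u^k=(y^k,w^k,s^k,z^k,x^k)$, $k\ge0$, be a sequence generated by sGS-ADMM. (a) Assume that the generalized Slater conditions hold for both problems, that is, there is $x$ with $\mathbf Bx=b$, $x\in\mathrm{ri}(\mathrm{dom}\,\theta)\cap\mathrm{ri}(\mathbf K)$, and there is a feasible point $(y,w,s,z)$ of (D) with $-s\in\mathrm{ri}(\mathrm{dom}\,\theta^*)$ and $-z\in\mathrm{ri}(\mathrm{dom}\,\delta_{\mathbf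 K}^*)$; or assume only that a KKT point exists. Then $\{u^k\}$ converges; $(y^k,w^k,s^k,z^k)$ converges to an optimal solution of (D), and $x^k$ converges to an optimal solution of (P). (b) Suppose that $\{u^k\}$ converges to a KKT point $\bar u$ and that $\mathcal R$ is metrically subregular at $(\bar u,0)$. Then $\{u^k\}$ converges linearly to $\bar u$: there are $C>0$ and $\mu\in(0,1)$ such that $\|u^{k+m}-\bar u\|\le C\mu^m\|u^k-\bar u\|$ for all $k,m\ge0$. -/

import Mathlib

namespace BlockAngular

noncomputable section

section ConvexAnalysis

variable {E : Type*} [NormedAddCommGroup E] [InnerProductSpace ℝ E]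

/-- Effective domain of an extended real valued function. -/
def effDom (f : E → EReal) : Set E := {x | f x ≠ ⊤}

/-- `f : E → (-∞, ∞]` is a proper closed convex function: it never takes the value `-∞`, is not
identically `∞`, is lower semicontinuous, and has a convex epigraph. -/
structure IsProperClosedConvex (f : E → EReal) : Prop where
  ne_bot : ∀ x, f x ≠ ⊥
  exists_ne_top : ∃ x, f x ≠ ⊤
  lowerSemicontinuous : LowerSemicontinuous f
  convex_epigraph : Convex ℝ {p : E × ℝ | f p.1 ≤ (p.2 : EReal)}

/-- The Fenchel conjugate `f*(v) = sup_x (⟨v, x⟩ - f x)`. -/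
def conj (f : E → EReal) (v : E) : EReal := ⨆ x : E, ((inner ℝ v x : ℝ) : EReal) - f x

open scoped Classical in
/-- The convex indicator function `δ_K` of a set: `0` on `K`, `∞` outside. -/
def ind (K : Set E) (x : E) : EReal := if x ∈ K then 0 else ⊤

/-- `p` minimizes `x ↦ f x + ½‖x - v‖²`. -/
def IsProx (f : E → EReal) (v p : E) : Prop :=
  ∀ x : E, f p + ((1 / 2 * ‖p - v‖ ^ 2 : ℝ) : EReal) ≤ f x + ((1 / 2 * ‖x - v‖ ^ 2 : ℝ) : EReal)

open scoped Classical in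
/-- The Moreau-Yosida proximal mapping `Prox_f(v) = argmin_x {f x + ½‖x - v‖²}`. The minimizer
exists and is unique when `f` is proper closed convex and `E` is finite dimensional. -/
def prox (f : E → EReal) (v : E) : E := if h : ∃ p, IsProx f v p then h.choose else 0

/-- `p` is a nearest point of `K` to `v`. -/
def IsNearest (K : Set E) (v p : E) : Prop := p ∈ K ∧ ∀ q ∈ K, ‖v - p‖ ≤ ‖v - q‖

open scoped Classical in
/-- The metric projection onto `K`. The nearest point exists and is unique when `K` is a nonempty
closed convex set and `E` is finite dimensional. -/
def proj (K : Set E) (v : E) : E := if h : ∃ p, IsNearest K v p then h.choose else 0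

end ConvexAnalysis

/-- Data of a primal block angular convex composite quadratic conic problem
`min ∑ i, θ i (x i) + ½⟨x i, Q i (x i)⟩ + ⟨c i, x i⟩` subject to
`∑ i, A i (x i) = b 0`, `D i (x i) = b i` for `i ≠ 0`, and `x i ∈ K i`.
There are `N + 1` blocks. The map `D 0` does not occur in the problem; by convention it is `0`. -/
structure Problem (N : ℕ) (X Y : Fin (N + 1) → Type*)
    [∀ i, NormedAddCommGroup (X i)] [∀ i, InnerProductSpace ℝ (X i)]
    [∀ i, FiniteDimensional ℝ (X i)]
    [∀ i, NormedAddCommGroup (Y i)] [∀ i, InnerProductSpace ℝ (Y i)]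
    [∀ i, FiniteDimensional ℝ (Y i)] where
  θ : ∀ i, X i → EReal
  θ_pcc : ∀ i, IsProperClosedConvex (θ i)
  Q : ∀ i, X i →ₗ[ℝ] X i
  Q_pos : ∀ i, (Q i).IsPositive
  A : ∀ i, X i →ₗ[ℝ] Y 0
  D : ∀ i, X i →ₗ[ℝ] Y i
  D_zero : D 0 = 0
  c : PiLp 2 X
  b : PiLp 2 Y
  K : ∀ i, Set (X i)
  K_nonempty : ∀ i, (K i).Nonempty
  K_closed : ∀ i, IsClosed (K i)
  K_convex : ∀ i, Convex ℝ (K i)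

namespace Problem

variable {N : ℕ} {X Y : Fin (N + 1) → Type*}
  [∀ i, NormedAddCommGroup (X i)] [∀ i, InnerProductSpace ℝ (X i)]
  [∀ i, FiniteDimensional ℝ (X i)]
  [∀ i, NormedAddCommGroup (Y i)] [∀ i, InnerProductSpace ℝ (Y i)]
  [∀ i, FiniteDimensional ℝ (Y i)]
  (P : Problem N X Y)

/-- The separable function `θ(x) = ∑ i, θ i (x i)` on the product space. -/
def bθ (x : PiLp 2 X) : EReal := ∑ i, P.θ i (x i)

/-- The product set `K 0 × ⋯ × K N`. -/
def bK : Set (PiLp 2 X) := {x | ∀ i, x i ∈ P.K i}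

/-- The block diagonal operator `x ↦ (Q 0 (x 0); …; Q N (x N))`. -/
def bQ : PiLp 2 X →ₗ[ℝ] PiLp 2 X where
  toFun x := WithLp.toLp 2 fun i => P.Q i (x i)
  map_add' x x' := by ext i; simp
  map_smul' r x := by ext i; simp

/-- The constraint operator: `(B x) 0 = ∑ j, A j (x j)` and `(B x) i = D i (x i)` for `i ≠ 0`. -/
def B : PiLp 2 X →ₗ[ℝ] PiLp 2 Y where
  toFun x := WithLp.toLp 2 fun i => P.D i (x i) + (Pi.single 0 (∑ j, P.A j (x j)) : ∀ i, Y i) i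
  map_add' x x' := by
    ext i
    simp only [PiLp.add_apply, map_add, Finset.sum_add_distrib, Pi.single_add, Pi.add_apply]
    abel
  map_smul' r x := by
    ext i
    simp only [PiLp.smul_apply, map_smul, ← Finset.smul_sum, Pi.single_smul, Pi.smul_apply,
      smul_add, RingHom.id_apply]

/-- The adjoint of the constraint operator. -/
def Badj : PiLp 2 Y →ₗ[ℝ] PiLp 2 X := LinearMap.adjoint P.B

/-- The subspace `W = Range(Q)`. -/
abbrev W : Submodule ℝ (PiLp 2 X) := LinearMap.range P.bQ

/-- The space of `u = (y, w, s, z, x)`, the product `Y × W × X × X × X` with its Euclidean norm. -/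
abbrev State : Type _ :=
  WithLp 2 (PiLp 2 Y × WithLp 2 (P.W × WithLp 2 (PiLp 2 X × WithLp 2 (PiLp 2 X × PiLp 2 X))))

namespace State

variable {P}

def y (u : P.State) : PiLp 2 Y := u.fst
def w (u : P.State) : P.W := u.snd.fst
def s (u : P.State) : PiLp 2 X := u.snd.snd.fst
def z (u : P.State) : PiLp 2 X := u.snd.snd.snd.fst
def x (u : P.State) : PiLp 2 X := u.snd.snd.snd.snd

end State

/-- Assemble `(y, w, s, z, x)`. -/
def mkState (y : PiLp 2 Y) (w : P.W) (s z x : PiLp 2 X) : P.State :=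
  WithLp.toLp 2 (y, WithLp.toLp 2 (w, WithLp.toLp 2 (s, WithLp.toLp 2 (z, x))))

/-! ### The primal and the dual problem -/

/-- Objective of the primal problem (without the constraints). -/
def primalObj (x : PiLp 2 X) : EReal :=
  P.bθ x + ((1 / 2 * inner ℝ x (P.bQ x) + inner ℝ P.c x : ℝ) : EReal)

/-- `x` is an optimal solution of
`min {θ(x) + ½⟨x, Q x⟩ + ⟨c, x⟩ | B x = b, x ∈ K}`, with finite objective value. -/
def IsPrimalOptimal (x : PiLp 2 X) : Prop :=
  P.B x = P.b ∧ x ∈ P.bK ∧ P.primalObj x ≠ ⊤ ∧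
    ∀ x' : PiLp 2 X, P.B x' = P.b → x' ∈ P.bK → P.primalObj x ≤ P.primalObj x'

/-- Objective of the dual problem in minimization form. -/
def dualObj (y : PiLp 2 Y) (w : P.W) (s z : PiLp 2 X) : EReal :=
  conj P.bθ (-s) + conj (ind P.bK) (-z) +
    ((1 / 2 * inner ℝ (w : PiLp 2 X) (P.bQ w) - inner ℝ P.b y : ℝ) : EReal)

/-- The dual equality constraint `-Q w + B* y + s + z = c`. -/
def DualFeasible (y : PiLp 2 Y) (w : P.W) (s z : PiLp 2 X) : Prop :=
  -P.bQ w + P.Badj y + s + z = P.c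

/-- `(y, w, s, z)` is an optimal solution of
`min {θ*(-s) + ½⟨w, Q w⟩ - ⟨b, y⟩ + δ_K*(-z) | -Q w + B* y + s + z = c, w ∈ W}`,
with finite objective value. -/
def IsDualOptimal (y : PiLp 2 Y) (w : P.W) (s z : PiLp 2 X) : Prop :=
  P.DualFeasible y w s z ∧ P.dualObj y w s z ≠ ⊤ ∧
    ∀ (y' : PiLp 2 Y) (w' : P.W) (s' z' : PiLp 2 X),
      P.DualFeasible y' w' s' z' → P.dualObj y w s z ≤ P.dualObj y' w' s' z'

/-- The generalized Slater condition for the primal problem: there is a feasible point in the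
relative interiors of `dom θ` and of `K`. -/
def PrimalSlater : Prop :=
  ∃ x : PiLp 2 X, P.B x = P.b ∧ x ∈ intrinsicInterior ℝ (effDom P.bθ) ∧
    x ∈ intrinsicInterior ℝ P.bK

/-- The generalized Slater condition for the dual problem: there is a feasible point with `-s` in
the relative interior of `dom θ*` and `-z` in the relative interior of `dom δ_K*`. -/
def DualSlater : Prop :=
  ∃ (y : PiLp 2 Y) (w : P.W) (s z : PiLp 2 X), P.DualFeasible y w s z ∧
    -s ∈ intrinsicInterior ℝ (effDom (conj P.bθ)) ∧
    -z ∈ intrinsicInterior ℝ (effDom (conj (ind P.bK)))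

/-! ### The KKT mapping -/

/-- The KKT residual mapping, with components `B x - b`, `Q w - Q x`, `-Q w + B* y + s + z - c`,
`x - Prox_θ(x - s)` and `x - Π_K(x - z)` (listed so that they fall into `Y`, `W`, `X`, `X`, `X`). -/
def residual (u : P.State) : P.State :=
  P.mkState (P.B u.x - P.b) (P.bQ.rangeRestrict (u.w - u.x))
    (-P.bQ u.w + P.Badj u.y + u.s + u.z - P.c)
    (u.x - prox P.bθ (u.x - u.s))
    (u.x - proj P.bK (u.x - u.z))

/-- The set of KKT points. -/
def kktSet : Set P.State := {u | P.residual u = 0}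

/-- Metric subregularity of the KKT mapping at `(ū, 0)`, `ū` a KKT point, with some modulus. -/
def ResidualSubregularAt (ubar : P.State) : Prop :=
  ∃ η > (0 : ℝ), ∃ ρ > (0 : ℝ), ∀ u : P.State, ‖u - ubar‖ ≤ ρ →
    Metric.infDist u P.kktSet ≤ η * ‖P.residual u‖

/-! ### The algorithm -/

/-- The adjoint of `D i`. -/
def Dadj (i : Fin (N + 1)) : Y i →ₗ[ℝ] X i := LinearMap.adjoint (P.D i)

/-- The adjoint of `A i`. -/
def Aadj (i : Fin (N + 1)) : Y 0 →ₗ[ℝ] X i := LinearMap.adjoint (P.A i)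

/-- Block `i` of `g = A* y₀ + z - c + σ⁻¹ x`. -/
def gvec (σ : ℝ) (y₀ : Y 0) (z x : PiLp 2 X) (i : Fin (N + 1)) : X i :=
  P.Aadj i y₀ + z i - P.c i + σ⁻¹ • x i

/-- Block `i` of `h = -Q w + D* y + s - c + σ⁻¹ x`. -/
def hvec (σ : ℝ) (y : PiLp 2 Y) (w s x : PiLp 2 X) (i : Fin (N + 1)) : X i :=
  -P.Q i (w i) + P.Dadj i (y i) + s i - P.c i + σ⁻¹ • x i

/-- Subproblem for the block `y i`, `i ≠ 0`: minimize `-⟨b i, y⟩ + σ/2 ‖-Q i w + D i* y + s + g‖²`. -/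
def IsYStep (σ : ℝ) (i : Fin (N + 1)) (w s g : X i) (y : Y i) : Prop :=
  IsMinOn (fun η : Y i => -inner ℝ (P.b i) η + σ / 2 * ‖-P.Q i w + P.Dadj i η + s + g‖ ^ 2)
    Set.univ y

/-- Subproblem for the block `w i`: minimize `½⟨w, Q i w⟩ + σ/2 ‖-Q i w + D i* y + s + g‖²` over
`Range (Q i)`. -/
def IsWStep (σ : ℝ) (i : Fin (N + 1)) (y : Y i) (s g : X i) (w : X i) : Prop :=
  w ∈ LinearMap.range (P.Q i) ∧
  IsMinOn (fun ω : X i => 1 / 2 * inner ℝ ω (P.Q i ω) +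
      σ / 2 * ‖-P.Q i ω + P.Dadj i y + s + g‖ ^ 2)
    (LinearMap.range (P.Q i) : Set (X i)) w

/-- Subproblem for the block `s i`: minimize `θ i*(-s) + σ/2 ‖-Q i w + D i* y + s + g‖²`. -/
def IsSStep (σ : ℝ) (i : Fin (N + 1)) (y : Y i) (w g : X i) (s : X i) : Prop :=
  IsMinOn (fun ς : X i => conj (P.θ i) (-ς) +
      ((σ / 2 * ‖-P.Q i w + P.Dadj i y + ς + g‖ ^ 2 : ℝ) : EReal))
    Set.univ s

/-- Subproblem for the block `y 0`: minimize `-⟨b 0, y⟩ + ∑ i, σ/2 ‖A i* y + z i + h i‖²`. -/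
def IsY0Step (σ : ℝ) (z : PiLp 2 X) (h : ∀ i, X i) (y₀ : Y 0) : Prop :=
  IsMinOn (fun η : Y 0 => -inner ℝ (P.b 0) η + ∑ i, σ / 2 * ‖P.Aadj i η + z i + h i‖ ^ 2)
    Set.univ y₀

/-- Subproblem for the block `z i`: minimize `δ_{K i}*(-z) + σ/2 ‖A i* y₀ + z + h‖²`. -/
def IsZStep (σ : ℝ) (i : Fin (N + 1)) (y₀ : Y 0) (h : X i) (z : X i) : Prop :=
  IsMinOn (fun ζ : X i => conj (ind (P.K i)) (-ζ) +
      ((σ / 2 * ‖P.Aadj i y₀ + ζ + h‖ ^ 2 : ℝ) : EReal))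
    Set.univ z

/-- One iteration of sGS-ADMM with penalty parameter `σ` and steplength `τ`, from `u` to `v`.
The auxiliary vector `ybar` collects the intermediate `ȳ i`, `i ≠ 0`, and `ȳ 0`. -/
def IsStep (σ τ : ℝ) (u v : P.State) : Prop :=
  ∃ (ybar : PiLp 2 Y) (wbar : PiLp 2 X),
    -- first block, backward sweep `ȳ`, `w̄`, then `s`, then forward sweep `w`, `y`
    (∀ i, i ≠ 0 → P.IsYStep σ i ((u.w : PiLp 2 X) i) (u.s i)
      (P.gvec σ (u.y 0) u.z u.x i) (ybar i)) ∧
    (∀ i, P.IsWStep σ i (ybar i) (u.s i) (P.gvec σ (u.y 0) u.z u.x i) (wbar i)) ∧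
    (∀ i, P.IsSStep σ i (ybar i) (wbar i) (P.gvec σ (u.y 0) u.z u.x i) (v.s i)) ∧
    (∀ i, P.IsWStep σ i (ybar i) (v.s i) (P.gvec σ (u.y 0) u.z u.x i) ((v.w : PiLp 2 X) i)) ∧
    (∀ i, i ≠ 0 → P.IsYStep σ i ((v.w : PiLp 2 X) i) (v.s i)
      (P.gvec σ (u.y 0) u.z u.x i) (v.y i)) ∧
    -- second block, `ȳ 0`, then `z`, then `y 0`
    P.IsY0Step σ u.z (P.hvec σ v.y v.w v.s u.x) (ybar 0) ∧
    (∀ i, P.IsZStep σ i (ybar 0) (P.hvec σ v.y v.w v.s u.x i) (v.z i)) ∧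
    P.IsY0Step σ v.z (P.hvec σ v.y v.w v.s u.x) (v.y 0) ∧
    -- multiplier update
    v.x = u.x + (τ * σ) • (-P.bQ v.w + P.Badj v.y + v.s + v.z - P.c)

/-- `u` is a sequence generated by sGS-ADMM, from an arbitrary starting point. -/
def IsSGSADMM (σ τ : ℝ) (u : ℕ → P.State) : Prop := ∀ k, P.IsStep σ τ (u k) (u (k + 1))

/-- Linear convergence of a sequence to `ū`, uniformly along the sequence: from every iterate on,
the error decays geometrically relative to the error at that iterate. -/
def LinearlyConvergesTo (u : ℕ → P.State) (ubar : P.State) : Prop :=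
  ∃ C > (0 : ℝ), ∃ μ : ℝ, 0 < μ ∧ μ < 1 ∧
    ∀ k m : ℕ, ‖u (k + m) - ubar‖ ≤ C * μ ^ m * ‖u k - ubar‖

end Problem

end

end BlockAngular

/-! The symmetric Gauss-Seidel sweeps are a two-block semi-proximal ADMM in disguise. Subtracting
the optimality conditions of the backward and forward solves eliminates `ȳ`, `w̄` and `ȳ 0`. What
remains, in `IsStep.isOptimalStep`, are the conditions of exact minimization over (`y i` with `i ≠
0`, `w`, `s`) and over (`y 0`, `z`), up to corrections that are linear and positive semidefinite in
the increments: `resolv` of Δs, `projD` of Δs - QΔw, and `projA` of Δz.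

Monotonicity of the subdifferentials of θ and δ_K, with Q ⪰ 0, is tested against a KKT point p and
between consecutive second blocks. The three inequalities add up to the decrease of `energy (u - p)
+ σ‖projA Δz‖²` (`IsOptimalStep.energy_le`). The only term without a sign is (1 - τ)⟨Δlink, old dual
residual⟩. Young's inequality absorbs it when (1 - τ)² < 2 - τ, which is the golden ratio bound on
τ. Surjectivity of B and w ∈ W make `energy` positive definite (`energy_pos`). The decrease
dominates the squared KKT residual at the new iterate (`exists_residual_bound`), because that
iterate satisfies the KKT conditions up to perturbations by the very increments that are lost.

Hence the iterates are Fejér monotone, in a corrected quadratic form, with respect to all KKT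
points, and their residuals tend to zero. They converge to a KKT point, which is optimal for both
problems by the subgradient and Fenchel-Young inequalities. Under subregularity the decrease is also
proportional to the energy at a nearest KKT point, so each step contracts
(`IsFejer.exists_linear_rate`). The uniform rate from every k ≥ 0 also needs that a single step
expands the distance to a KKT point by at most a constant factor (`exists_energy_step_bound`).

Under the Slater conditions a KKT point exists: minimize the primal objective plus (ε_n/2)‖x‖². The
primal condition gives multipliers at the minimizers x_n, by separation. The dual condition bounds
the pairings of x_n with enough dual directions that the multiplier equation places every x_n in
their span, so (x_n) is bounded by Banach-Steinhaus. A limit point solves the primal problem, and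
its multipliers complete the KKT point. -/

namespace BlockAngular

/-! ### Subgradients, proximal mappings and conjugates -/

section Subgradients

variable {E F : Type*} [NormedAddCommGroup E] [InnerProductSpace ℝ E]
  [NormedAddCommGroup F] [InnerProductSpace ℝ F]

/-- `g` is a subgradient of `f` at the point `x` of the domain of `f`. -/
def IsSubgrad (f : E → EReal) (x g : E) : Prop :=
  ∃ a : ℝ, f x = a ∧ ∀ y, ((a + inner ℝ g (y - x) : ℝ) : EReal) ≤ f y

theorem IsSubgrad.monotone {f : E → EReal} {x x' g g' : E} (h : IsSubgrad f x g)
    (h' : IsSubgrad f x' g') : 0 ≤ inner ℝ (g - g') (x - x') := by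
  obtain ⟨a, ha, hg⟩ := h
  obtain ⟨a', ha', hg'⟩ := h'
  have h1 := hg x'
  have h2 := hg' x
  rw [ha', EReal.coe_le_coe_iff] at h1
  rw [ha, EReal.coe_le_coe_iff] at h2
  simp only [inner_sub_left, inner_sub_right] at *
  linarith

/-- Divide by t and let t tend to 0. All first-order conditions below are extracted this way, by
comparison along a segment, so that no differentiability is involved. The explicit t makes t|m| at
most |l|/2. -/
theorem nonneg_of_quadratic_nonneg {l m : ℝ} (h : ∀ t : ℝ, 0 < t → t ≤ 1 → 0 ≤ t * l + t ^ 2 * m) :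
    0 ≤ l := by
  by_contra hl
  push Not at hl
  have hm : 0 < |m| + |l| := by have := abs_pos.2 hl.ne; positivity
  set t := |l| / (2 * (|m| + |l|)) with ht
  have ht0 : 0 < t := by have := abs_pos.2 hl.ne; positivity
  have ht1 : t ≤ 1 := by
    rw [ht, div_le_one (by positivity)]
    have := abs_nonneg m; have := abs_nonneg l; linarith
  have h1 := h t ht0 ht1
  have h2 : t * |m| ≤ |l| / 2 := by
    rw [ht, div_mul_eq_mul_div, div_le_iff₀ (by positivity)]
    nlinarith [abs_nonneg m, abs_nonneg l]
  have h3 : t ^ 2 * m ≤ t * (|l| / 2) := by nlinarith [le_abs_self m]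
  have h4 : |l| = -l := abs_of_neg hl
  nlinarith

theorem eq_zero_of_quadratic_nonneg {l m : ℝ} (h : ∀ t : ℝ, 0 ≤ t * l + t ^ 2 * m) : l = 0 := by
  apply le_antisymm
  · have := nonneg_of_quadratic_nonneg (l := -l) (m := m) fun t _ _ => by
      have := h (-t); nlinarith
    linarith
  · exact nonneg_of_quadratic_nonneg fun t _ _ => h t

namespace IsProperClosedConvex

variable {f : E → EReal} (hf : IsProperClosedConvex f)
include hf

theorem exists_coe {x : E} (hx : f x ≠ ⊤) : ∃ a : ℝ, f x = a :=
  ⟨(f x).toReal, (EReal.coe_toReal hx (hf.ne_bot x)).symm⟩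

theorem exists_coe_eq : ∃ (x : E) (a : ℝ), f x = a :=
  let ⟨x, hx⟩ := hf.exists_ne_top
  ⟨x, hf.exists_coe hx⟩

theorem segment_le {x y : E} {a b t : ℝ} (hx : f x ≤ a) (hy : f y ≤ b) (h0 : 0 ≤ t) (h1 : t ≤ 1) :
    f (x + t • (y - x)) ≤ ((1 - t) * a + t * b : ℝ) := by
  have := hf.convex_epigraph (x := (x, a)) hx (y := (y, b)) hy (a := 1 - t) (b := t)
    (by linarith) h0 (by ring)
  simp only [Set.mem_ofPred_eq, Prod.fst_add, Prod.smul_fst, Prod.snd_add, Prod.smul_snd,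
    smul_eq_mul] at this
  convert this using 2
  module

theorem isSubgrad_of_isMin {p v : E} {ε : ℝ}
    (h : ∀ x, f p + ((ε / 2 * ‖p - v‖ ^ 2 : ℝ) : EReal) ≤
      f x + ((ε / 2 * ‖x - v‖ ^ 2 : ℝ) : EReal)) : IsSubgrad f p (ε • (v - p)) := by
  obtain ⟨x₀, a₀, hx₀⟩ := hf.exists_coe_eq
  have hp : f p ≠ ⊤ := by
    intro hp
    have := h x₀
    rw [hp, hx₀, EReal.top_add_coe, ← EReal.coe_add] at this
    exact EReal.coe_ne_top _ (top_le_iff.1 this)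
  obtain ⟨a, ha⟩ := hf.exists_coe hp
  refine ⟨a, ha, fun y => ?_⟩
  by_cases hy : f y = ⊤
  · simp [hy]
  obtain ⟨b, hb⟩ := hf.exists_coe hy
  rw [hb, EReal.coe_le_coe_iff]
  -- Compare p with p + t(y - p): convexity bounds the change of f linearly in t, and the quadratic
  -- term contributes its derivative plus O(t²).
  have key : 0 ≤ (b - a) + ε * inner ℝ (p - v) (y - p) := by
    apply nonneg_of_quadratic_nonneg (m := ε / 2 * ‖y - p‖ ^ 2)
    intro t ht0 ht1
    have h1 := (h (p + t • (y - p))).trans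
      (add_le_add_left (hf.segment_le ha.le hb.le ht0.le ht1) _)
    rw [ha, ← EReal.coe_add, ← EReal.coe_add, EReal.coe_le_coe_iff] at h1
    have h2 : ‖p + t • (y - p) - v‖ ^ 2 =
        ‖p - v‖ ^ 2 + 2 * (t * inner ℝ (p - v) (y - p)) + t ^ 2 * ‖y - p‖ ^ 2 := by
      rw [show p + t • (y - p) - v = (p - v) + t • (y - p) by abel, norm_add_sq_real,
        inner_smul_right, norm_smul, mul_pow, Real.norm_eq_abs, sq_abs]
    rw [h2] at h1
    nlinarith
  rw [inner_smul_left, ← neg_sub p v, inner_neg_left]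
  simp only [conj_trivial]
  linarith

/-- Lower semicontinuity gives a minimum on the unit ball around x₀; a faster than linear descent
outside would, by convexity on the segment back to x₀, undercut it inside. This growth bound is all
that coercivity of the proximal objective needs, so no affine minorant has to be constructed. -/
theorem exists_lower_bound [FiniteDimensional ℝ E] :
    ∃ (x₀ : E) (a m : ℝ), f x₀ = a ∧ 0 ≤ m ∧ ∀ x, ((a - m - m * ‖x - x₀‖ : ℝ) : EReal) ≤ f x := by
  obtain ⟨x₀, a, hx₀⟩ := hf.exists_coe_eq
  obtain ⟨y, hy, hmin⟩ := LowerSemicontinuousOn.exists_isMinOn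
    (s := Metric.closedBall x₀ 1) ⟨x₀, by simp⟩ (isCompact_closedBall x₀ 1)
    (hf.lowerSemicontinuous.lowerSemicontinuousOn _)
  have hya : f y ≤ a := hx₀ ▸ hmin (Metric.mem_closedBall_self zero_le_one)
  obtain ⟨c, hc⟩ := hf.exists_coe (ne_top_of_le_ne_top (EReal.coe_ne_top a) hya)
  have hca : c ≤ a := by rwa [hc, EReal.coe_le_coe_iff] at hya
  refine ⟨x₀, a, a - c, hx₀, by linarith, fun x => ?_⟩
  by_cases hx : f x = ⊤
  · simp [hx]
  obtain ⟨b, hb⟩ := hf.exists_coe hx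
  rw [hb, EReal.coe_le_coe_iff]
  rcases le_or_gt ‖x - x₀‖ 1 with h1 | h1
  · have := hmin (show x ∈ Metric.closedBall x₀ 1 by simpa [dist_eq_norm] using h1)
    simp only [Set.mem_ofPred_eq] at this
    rw [hc, hb, EReal.coe_le_coe_iff] at this
    nlinarith [norm_nonneg (x - x₀)]
  · set t := ‖x - x₀‖⁻¹ with ht
    have ht0 : 0 < t := by positivity
    have hmem : x₀ + t • (x - x₀) ∈ Metric.closedBall x₀ 1 := by
      simp [norm_smul, ht, inv_mul_cancel₀ (by linarith : ‖x - x₀‖ ≠ 0)]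
    have h2 := (hmin hmem).trans
      (hf.segment_le hx₀.le hb.le ht0.le (inv_le_one_of_one_le₀ h1.le))
    rw [hc, EReal.coe_le_coe_iff] at h2
    have h3 : t * ‖x - x₀‖ = 1 := inv_mul_cancel₀ (by linarith)
    have h4 : c * ‖x - x₀‖ ≤ ((1 - t) * a + t * b) * ‖x - x₀‖ :=
      mul_le_mul_of_nonneg_right h2 (norm_nonneg _)
    have h5 : ((1 - t) * a + t * b) * ‖x - x₀‖ = a * ‖x - x₀‖ - a + b := by
      linear_combination (b - a) * h3
    nlinarith

theorem exists_isMin [FiniteDimensional ℝ E] {ε : ℝ} (hε : 0 < ε) (v : E) :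
    ∃ p, ∀ x, f p + ((ε / 2 * ‖p - v‖ ^ 2 : ℝ) : EReal) ≤
      f x + ((ε / 2 * ‖x - v‖ ^ 2 : ℝ) : EReal) := by
  obtain ⟨x₀, a, m, hx₀, hm, hlow⟩ := hf.exists_lower_bound
  set d := ‖x₀ - v‖ with hd
  set k : ℝ := 2 * m + m * d + ε / 2 * d ^ 2 with hk
  -- Outside this ball q = ‖x - x₀‖ - d exceeds 1 + 2k/ε, so (ε/2)q² ≥ kq, which beats the linear
  -- lower bound on f and the value at x₀.
  set r : ℝ := d + 1 + 2 / ε * k with hr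
  have hd0 : 0 ≤ d := norm_nonneg _
  have hk0 : 0 ≤ k := by positivity
  have hr0 : 0 ≤ r := by positivity
  have hcont : LowerSemicontinuous fun x => f x + ((ε / 2 * ‖x - v‖ ^ 2 : ℝ) : EReal) := by
    refine hf.lowerSemicontinuous.add' ?_ fun x =>
      EReal.continuousAt_add (Or.inr (EReal.coe_ne_bot _)) (Or.inr (EReal.coe_ne_top _))
    exact (continuous_coe_real_ereal.comp (by fun_prop)).lowerSemicontinuous
  obtain ⟨p, -, hp⟩ := LowerSemicontinuousOn.exists_isMinOn
    (s := Metric.closedBall x₀ r) ⟨x₀, by simpa using hr0⟩ (isCompact_closedBall x₀ r)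
    (hcont.lowerSemicontinuousOn _)
  refine ⟨p, fun x => ?_⟩
  by_cases hx : x ∈ Metric.closedBall x₀ r
  · exact hp hx
  refine (hp (Metric.mem_closedBall_self hr0)).trans ?_
  simp only
  by_cases hxt : f x = ⊤
  · rw [hxt, EReal.top_add_coe]; exact le_top
  obtain ⟨b, hb⟩ := hf.exists_coe hxt
  have h1 := hlow x
  rw [hb, EReal.coe_le_coe_iff] at h1
  rw [hx₀, hb, ← EReal.coe_add, ← EReal.coe_add, EReal.coe_le_coe_iff, ← hd]
  simp only [Metric.mem_closedBall, dist_eq_norm, not_le] at hx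
  set s := ‖x - x₀‖ with hs
  have h2 : s - d ≤ ‖x - v‖ := by
    have := norm_sub_le (x - v) (x₀ - v)
    rw [show x - v - (x₀ - v) = x - x₀ by abel] at this
    linarith
  set q := s - d with hq
  have hqr : r - d < q := by linarith
  have h3 : q ^ 2 ≤ ‖x - v‖ ^ 2 := by
    have : 0 ≤ 2 / ε * k := by positivity
    exact pow_le_pow_left₀ (by linarith) h2 2
  have hq1 : 1 ≤ q := by
    have : 0 ≤ 2 / ε * k := by positivity
    linarith
  have h4 : k ≤ ε / 2 * q := by
    have : ε / 2 * (2 / ε * k) = k := by field_simp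
    nlinarith
  have h5 : k * q ≤ ε / 2 * q * q := mul_le_mul_of_nonneg_right h4 (by linarith)
  have h6 : 0 ≤ (m + m * d + ε / 2 * d ^ 2) * (q - 1) := by
    have : 0 ≤ q - 1 := by linarith
    positivity
  have h7 : ε / 2 * q ^ 2 ≤ ε / 2 * ‖x - v‖ ^ 2 := by gcongr
  have h8 : s = q + d := by rw [hq]; ring
  rw [h8] at h1
  rw [hk] at h5
  nlinarith

theorem exists_isSubgrad [FiniteDimensional ℝ E] {ε : ℝ} (hε : 0 < ε) (v : E) :
    ∃ p, IsSubgrad f p (ε • (v - p)) :=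
  let ⟨p, hp⟩ := hf.exists_isMin hε v
  ⟨p, hf.isSubgrad_of_isMin hp⟩

theorem isSubgrad_prox [FiniteDimensional ℝ E] (v : E) :
    IsSubgrad f (prox f v) (v - prox f v) := by
  have h : ∃ p, IsProx f v p := hf.exists_isMin one_pos v
  have h1 : IsProx f v (prox f v) := by
    rw [prox, dif_pos h]
    exact h.choose_spec
  simpa using hf.isSubgrad_of_isMin (ε := 1) h1

/-- Uniqueness comes from monotonicity: two solutions p, p' of v - p ∈ ∂f(p) give -‖p - p'‖² ≥ 0. -/
theorem prox_eq_iff [FiniteDimensional ℝ E] {v p : E} : prox f v = p ↔ IsSubgrad f p (v - p) := by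
  constructor
  · rintro rfl
    exact hf.isSubgrad_prox v
  · intro h
    have := (hf.isSubgrad_prox v).monotone h
    rw [show v - prox f v - (v - p) = -(prox f v - p) by abel, inner_neg_left,
      real_inner_self_eq_norm_sq] at this
    have h0 : ‖prox f v - p‖ = 0 := by nlinarith [norm_nonneg (prox f v - p)]
    exact sub_eq_zero.1 (norm_eq_zero.1 h0)

theorem isSubgrad_iff_prox_eq [FiniteDimensional ℝ E] {x g : E} :
    IsSubgrad f x g ↔ prox f (x + g) = x := by
  rw [hf.prox_eq_iff, add_sub_cancel_left]

theorem norm_prox_sub_prox_le [FiniteDimensional ℝ E] (v v' : E) :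
    ‖prox f v - prox f v'‖ ≤ ‖v - v'‖ := by
  have h := (hf.isSubgrad_prox v).monotone (hf.isSubgrad_prox v')
  rw [show v - prox f v - (v' - prox f v') = (v - v') - (prox f v - prox f v') by abel,
    inner_sub_left, real_inner_self_eq_norm_sq] at h
  have h1 := real_inner_le_norm (v - v') (prox f v - prox f v')
  by_contra hlt
  push Not at hlt
  nlinarith [norm_nonneg (v - v'), norm_nonneg (prox f v - prox f v')]

theorem continuous_prox [FiniteDimensional ℝ E] : Continuous (prox f) :=
  (LipschitzWith.of_dist_le_mul (K := 1) fun v v' => by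
    simpa [dist_eq_norm] using hf.norm_prox_sub_prox_le v v').continuous

theorem add {g : E → EReal} (hg : IsProperClosedConvex g) (h : ∃ x, f x ≠ ⊤ ∧ g x ≠ ⊤) :
    IsProperClosedConvex (fun x => f x + g x) where
  ne_bot x := by simp [EReal.add_eq_bot_iff, hf.ne_bot, hg.ne_bot]
  exists_ne_top := by
    obtain ⟨x, h1, h2⟩ := h
    exact ⟨x, EReal.add_ne_top h1 h2⟩
  lowerSemicontinuous := hf.lowerSemicontinuous.add' hg.lowerSemicontinuous fun x =>
    EReal.continuousAt_add (Or.inr (hg.ne_bot x)) (Or.inl (hf.ne_bot x))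
  convex_epigraph := by
    have key : ∀ {x : E} {r : ℝ}, f x + g x ≤ r → ∃ a b : ℝ, f x = a ∧ g x = b ∧ a + b ≤ r := by
      intro x r hx
      have h1 : f x ≠ ⊤ := by
        intro h0
        rw [h0, EReal.top_add_of_ne_bot (hg.ne_bot x)] at hx
        exact EReal.coe_ne_top _ (top_le_iff.1 hx)
      have h2 : g x ≠ ⊤ := by
        intro h0
        rw [h0, EReal.add_top_of_ne_bot (hf.ne_bot x)] at hx
        exact EReal.coe_ne_top _ (top_le_iff.1 hx)
      obtain ⟨a, ha⟩ := hf.exists_coe h1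
      obtain ⟨b, hb⟩ := hg.exists_coe h2
      rw [ha, hb, ← EReal.coe_add, EReal.coe_le_coe_iff] at hx
      exact ⟨a, b, ha, hb, hx⟩
    rintro ⟨x, r⟩ hx ⟨y, s⟩ hy a b ha hb hab
    obtain ⟨a₁, b₁, e1, e2, h1⟩ := key hx
    obtain ⟨a₂, b₂, e3, e4, h2⟩ := key hy
    have hf' := hf.convex_epigraph (x := (x, a₁)) e1.le (y := (y, a₂)) e3.le ha hb hab
    have hg' := hg.convex_epigraph (x := (x, b₁)) e2.le (y := (y, b₂)) e4.le ha hb hab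
    change f (a • x + b • y) + g (a • x + b • y) ≤ _
    refine (add_le_add (a := f _) (c := g _) hf' hg').trans ?_
    simp only [Prod.snd_add, Prod.smul_snd, smul_eq_mul]
    rw [← EReal.coe_add, EReal.coe_le_coe_iff]
    nlinarith

theorem comp {L : F →L[ℝ] E} (h : ∃ x, f (L x) ≠ ⊤) : IsProperClosedConvex fun x => f (L x) where
  ne_bot x := hf.ne_bot _
  exists_ne_top := h
  lowerSemicontinuous := hf.lowerSemicontinuous.comp L.continuous
  convex_epigraph := by
    rintro ⟨x, r⟩ hx ⟨y, s⟩ hy a b ha hb hab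
    simpa using hf.convex_epigraph (x := (L x, r)) hx (y := (L y, s)) hy ha hb hab

end IsProperClosedConvex
theorem isProperClosedConvex_coe {f : E → ℝ} (hf : ConvexOn ℝ Set.univ f) (hc : Continuous f) :
    IsProperClosedConvex fun x => (f x : EReal) where
  ne_bot x := EReal.coe_ne_bot _
  exists_ne_top := ⟨0, EReal.coe_ne_top _⟩
  lowerSemicontinuous := (continuous_coe_real_ereal.comp hc).lowerSemicontinuous
  convex_epigraph := by simpa using hf.convex_epigraph

theorem isProperClosedConvex_sum {ι : Type*} (s : Finset ι) {f : ι → E → EReal}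
    (hf : ∀ i, IsProperClosedConvex (f i)) {x₀ : E} (hx₀ : ∀ i, f i x₀ ≠ ⊤) :
    IsProperClosedConvex (fun x => ∑ i ∈ s, f i x) ∧ ∑ i ∈ s, f i x₀ ≠ ⊤ := by
  classical
  induction s using Finset.induction_on with
  | empty =>
    simp only [Finset.sum_empty]
    exact ⟨isProperClosedConvex_coe (convexOn_const 0 convex_univ) continuous_const,
      EReal.zero_ne_top⟩
  | insert i s hi ih =>
    simp only [Finset.sum_insert hi]
    exact ⟨(hf i).add ih.1 ⟨x₀, hx₀ i, ih.2⟩, EReal.add_ne_top (hx₀ i) ih.2⟩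

omit [NormedAddCommGroup E] [InnerProductSpace ℝ E] in
theorem ind_of_mem {K : Set E} {x : E} (hx : x ∈ K) : ind K x = 0 := if_pos hx

omit [NormedAddCommGroup E] [InnerProductSpace ℝ E] in
theorem ind_of_notMem {K : Set E} {x : E} (hx : x ∉ K) : ind K x = ⊤ := if_neg hx

theorem isProperClosedConvex_ind {K : Set E} (hne : K.Nonempty) (hc : IsClosed K)
    (hK : Convex ℝ K) : IsProperClosedConvex (ind K) where
  ne_bot x := by
    by_cases hx : x ∈ K
    · simp [ind_of_mem hx]
    · simp [ind_of_notMem hx]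
  exists_ne_top := hne.imp fun x hx => by simp [ind_of_mem hx]
  lowerSemicontinuous := by
    rw [lowerSemicontinuous_iff_isClosed_preimage]
    intro y
    by_cases hy : y = ⊤
    · simp [hy]
    by_cases h0 : 0 ≤ y
    · convert hc
      ext x
      by_cases hx : x ∈ K
      · simp [ind_of_mem hx, hx, h0]
      · simp [ind_of_notMem hx, hx, hy]
    · convert isClosed_empty
      ext x
      by_cases hx : x ∈ K
      · simpa [ind_of_mem hx] using h0
      · simp [ind_of_notMem hx, hy]
  convex_epigraph := by
    have key : ∀ {x : E} {r : ℝ}, ind K x ≤ r → x ∈ K ∧ 0 ≤ r := by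
      intro x r h
      by_cases hx : x ∈ K
      · rw [ind_of_mem hx] at h
        exact ⟨hx, by exact_mod_cast h⟩
      · simp [ind_of_notMem hx] at h
    rintro ⟨x, r⟩ hx ⟨y, s⟩ hy a b ha hb hab
    obtain ⟨h1, h2⟩ := key hx
    obtain ⟨h3, h4⟩ := key hy
    change ind K (a • x + b • y) ≤ ((a * r + b * s : ℝ) : EReal)
    rw [ind_of_mem (hK h1 h3 ha hb hab)]
    have : 0 ≤ a * r + b * s := by positivity
    exact_mod_cast this

theorem isSubgrad_ind_iff {K : Set E} {x g : E} :
    IsSubgrad (ind K) x g ↔ x ∈ K ∧ ∀ y ∈ K, inner ℝ g (y - x) ≤ 0 := by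
  constructor
  · rintro ⟨a, ha, h⟩
    by_cases hx : x ∈ K
    · refine ⟨hx, fun y hy => ?_⟩
      rw [ind_of_mem hx] at ha
      have ha0 : a = 0 := by exact_mod_cast ha.symm
      have h1 := h y
      rw [ind_of_mem hy, ha0, zero_add] at h1
      exact_mod_cast h1
    · rw [ind_of_notMem hx] at ha
      exact absurd ha.symm (EReal.coe_ne_top a)
  · rintro ⟨hx, h⟩
    refine ⟨0, by simp [ind_of_mem hx], fun y => ?_⟩
    by_cases hy : y ∈ K
    · rw [ind_of_mem hy, zero_add]
      exact_mod_cast h y hy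
    · simp [ind_of_notMem hy]

theorem proj_eq_prox_ind [FiniteDimensional ℝ E] {K : Set E} (hne : K.Nonempty) (hc : IsClosed K)
    (hK : Convex ℝ K) (v : E) : proj K v = prox (ind K) v := by
  have hp := isProperClosedConvex_ind hne hc hK
  have h : ∃ p, IsNearest K v p := by
    obtain ⟨p, hpK, hd⟩ := hc.exists_infDist_eq_dist hne v
    refine ⟨p, hpK, fun q hq => ?_⟩
    rw [← dist_eq_norm, ← dist_eq_norm, ← hd]
    exact Metric.infDist_le_dist_of_mem hq
  have h1 : IsNearest K v (proj K v) := by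
    rw [proj, dif_pos h]
    exact h.choose_spec
  symm
  rw [hp.prox_eq_iff]
  have h2 := hp.isSubgrad_of_isMin (p := proj K v) (v := v) (ε := 1) fun x => by
    by_cases hx : x ∈ K
    · rw [ind_of_mem hx, ind_of_mem h1.1, zero_add, zero_add, EReal.coe_le_coe_iff]
      have := h1.2 x hx
      rw [norm_sub_rev v, norm_sub_rev v] at this
      gcongr
    · rw [ind_of_notMem hx, EReal.top_add_coe]
      exact le_top
  simpa using h2

theorem le_conj (f : E → EReal) (v x : E) {a : ℝ} (hx : f x ≤ a) :
    ((inner ℝ v x - a : ℝ) : EReal) ≤ conj f v := by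
  refine le_trans ?_ (le_iSup (fun x => ((inner ℝ v x : ℝ) : EReal) - f x) x)
  rw [EReal.coe_sub]
  exact EReal.sub_le_sub le_rfl hx

theorem IsSubgrad.conj_eq {f : E → EReal} {x g : E} (h : IsSubgrad f x g) {a : ℝ}
    (ha : f x = a) : conj f g = ((inner ℝ g x - a : ℝ) : EReal) := by
  apply le_antisymm _ (le_conj f g x ha.le)
  obtain ⟨a', ha', hg⟩ := h
  rw [ha, EReal.coe_eq_coe_iff] at ha'
  subst ha'
  refine iSup_le fun y => ?_
  have h1 := hg y
  induction hy : f y with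
  | bot => rw [hy] at h1; exact absurd (le_bot_iff.1 h1) (EReal.coe_ne_bot _)
  | top => simp
  | coe b =>
    rw [hy, EReal.coe_le_coe_iff, inner_sub_right] at h1
    rw [← EReal.coe_sub, EReal.coe_le_coe_iff]
    linarith

theorem conj_segment_le {f : E → EReal} {v w : E} {a b t : ℝ} (hv : conj f v ≤ a)
    (hw : conj f w ≤ b) (h0 : 0 ≤ t) (h1 : t ≤ 1) (hbot : ∀ x, f x ≠ ⊥) :
    conj f (v + t • (w - v)) ≤ ((1 - t) * a + t * b : ℝ) := by
  refine iSup_le fun x => ?_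
  induction hx : f x with
  | bot => exact absurd hx (hbot x)
  | top => simp
  | coe c =>
    have h2 := (le_conj f v x hx.le).trans hv
    have h3 := (le_conj f w x hx.le).trans hw
    rw [EReal.coe_le_coe_iff] at h2 h3
    rw [← EReal.coe_sub, EReal.coe_le_coe_iff, inner_add_left, inner_smul_left, inner_sub_left]
    simp only [conj_trivial]
    nlinarith

/-- The optimality condition of the proximal subproblem for a conjugate function. -/
theorem IsProperClosedConvex.isSubgrad_of_isMinOn_conj [FiniteDimensional ℝ E] {f : E → EReal}
    (hf : IsProperClosedConvex f) {σ : ℝ} {s d : E}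
    (hs : IsMinOn (fun ς : E => conj f (-ς) + ((σ / 2 * ‖ς + d‖ ^ 2 : ℝ) : EReal)) Set.univ s) :
    IsSubgrad f (σ • (s + d)) (-s) := by
  set x := σ • (s + d) with hx
  -- Moreau decomposition: g = x - s - p is a subgradient at p, so the conjugate is finite and known
  -- at g. Comparing -s with g along a segment, and using Fenchel-Young at (-s, p), forces x = p and
  -- g = -s. No biconjugation is needed.
  set p := prox f (x - s) with hp
  have hg : IsSubgrad f p (x - s - p) := hf.isSubgrad_prox _
  obtain ⟨a, ha, -⟩ := id hg
  set g := x - s - p with hgdef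
  have hconj := hg.conj_eq ha
  have hmin : ∀ ς, conj f (-s) + ((σ / 2 * ‖s + d‖ ^ 2 : ℝ) : EReal) ≤
      conj f (-ς) + ((σ / 2 * ‖ς + d‖ ^ 2 : ℝ) : EReal) := fun ς => hs (Set.mem_univ ς)
  have hlow := le_conj f (-s) p ha.le
  have hfin : ∃ c : ℝ, conj f (-s) = c := by
    induction hc : conj f (-s) with
    | bot => rw [hc] at hlow; exact absurd (le_bot_iff.1 hlow) (EReal.coe_ne_bot _)
    | coe c => exact ⟨c, rfl⟩
    | top =>
      have := hmin (-g)
      rw [hc, neg_neg, hconj, EReal.top_add_coe, ← EReal.coe_add] at this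
      exact absurd (top_le_iff.1 this) (EReal.coe_ne_top _)
  obtain ⟨c, hc⟩ := hfin
  set e := inner ℝ g p - a with he
  have key : 0 ≤ (e - c) + inner ℝ x (-(s + g)) := by
    apply nonneg_of_quadratic_nonneg (m := σ / 2 * ‖s + g‖ ^ 2)
    intro t ht0 ht1
    have h3 := conj_segment_le hc.le hconj.le ht0.le ht1 hf.ne_bot
    rw [show -s + t • (g - -s) = -(s + t • (-(s + g))) by module] at h3
    have h1 := (hmin (s + t • (-(s + g)))).trans (add_le_add_left h3 _)
    rw [hc, ← EReal.coe_add, ← EReal.coe_add, EReal.coe_le_coe_iff] at h1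
    have h2 : ‖s + t • (-(s + g)) + d‖ ^ 2 =
        ‖s + d‖ ^ 2 + 2 * (t * inner ℝ (s + d) (-(s + g))) + t ^ 2 * ‖s + g‖ ^ 2 := by
      rw [show s + t • (-(s + g)) + d = (s + d) + t • (-(s + g)) by abel, norm_add_sq_real,
        inner_smul_right, norm_smul, mul_pow, Real.norm_eq_abs, sq_abs, norm_neg]
    rw [h2] at h1
    rw [hx, inner_smul_left]
    simp only [conj_trivial]
    nlinarith
  rw [hc, EReal.coe_le_coe_iff] at hlow
  have hsg : s + g = x - p := by rw [hgdef]; abel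
  have h0 : ‖x - p‖ ^ 2 ≤ 0 := by
    have e1 : inner ℝ (-s) p = inner ℝ g p - inner ℝ (x - p) p := by
      rw [← hsg, ← inner_sub_left]; congr 1; abel
    rw [hsg, inner_neg_right] at key
    rw [← real_inner_self_eq_norm_sq]
    nth_rewrite 1 [inner_sub_left]
    rw [real_inner_comm (x - p) p]
    linarith
  have hxp : x = p := by
    rw [← sub_eq_zero, ← norm_eq_zero]
    nlinarith [norm_nonneg (x - p)]
  have : g = -s := by rw [hgdef, ← hxp]; abel
  rw [hxp, ← this]
  exact hg

end Subgradients
end BlockAngular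

namespace BlockAngular

/-! ### Proper separation of convex sets -/

section Separation

/-- The cone generated by C misses -c₀ and, as C spans, has nonempty interior; Hahn-Banach separates
-c₀ from that interior, and homogeneity pushes the lower bound up to 0. Strict separation keeps the
functional from vanishing on C. -/
theorem exists_nonneg_functional_of_span_eq_top {V : Type*} [NormedAddCommGroup V]
    [NormedSpace ℝ V] [FiniteDimensional ℝ V] {C : Set V} (hC : Convex ℝ C)
    (hspan : Submodule.span ℝ C = ⊤) {c₀ : V} (hc₀ : c₀ ∈ C)
    (h : ∀ ε : ℝ, 0 < ε → -(ε • c₀) ∉ C) :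
    ∃ ℓ : V →ₗ[ℝ] ℝ, (∀ c ∈ C, 0 ≤ ℓ c) ∧ ∃ c ∈ C, ℓ c ≠ 0 := by
  set T : Set V := ((ConvexCone.hull ℝ C : ConvexCone ℝ V) : Set V) with hT
  have hTconv : Convex ℝ T := (ConvexCone.hull ℝ C).convex
  have hmem : ∀ c ∈ C, ∀ r : ℝ, 0 < r → r • c ∈ T := fun c hc r hr =>
    (ConvexCone.mem_hull_of_convex hC).2 ⟨r, hr, Set.smul_mem_smul_set hc⟩
  have hne : T.Nonempty := ⟨_, hmem c₀ hc₀ 1 one_pos⟩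
  have haff : affineSpan ℝ T = ⊤ := by
    rw [AffineSubspace.affineSpan_eq_top_iff_vectorSpan_eq_top_of_nonempty ℝ V V hne, eq_top_iff,
      ← hspan, Submodule.span_le]
    intro c hc
    have := vsub_mem_vectorSpan ℝ (hmem c hc 2 two_pos) (hmem c hc 1 one_pos)
    -- The cone contains 2c and c, so its direction space contains c.
    rwa [vsub_eq_sub, ← sub_smul, show (2 : ℝ) - 1 = 1 by norm_num, one_smul] at this
  have hint : (interior T).Nonempty := hTconv.interior_nonempty_iff_affineSpan_eq_top.2 haff
  have hnot : -c₀ ∉ interior T := by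
    intro hc
    obtain ⟨r, hr, c, hcC, hrc⟩ := (ConvexCone.mem_hull_of_convex hC).1 (interior_subset hc)
    refine h r⁻¹ (inv_pos.2 hr) ?_
    rwa [← smul_neg, ← hrc, smul_smul, inv_mul_cancel₀ hr.ne', one_smul]
  obtain ⟨ℓ, hℓ⟩ := geometric_hahn_banach_point_open hTconv.interior isOpen_interior hnot
  have hcl : ∀ c ∈ T, ℓ (-c₀) ≤ ℓ c := by
    intro c hc
    have h1 : c ∈ closure (interior T) := by
      rw [hTconv.closure_interior_eq_closure_of_nonempty_interior hint]
      exact subset_closure hc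
    have h2 : IsClosed {x | ℓ (-c₀) ≤ ℓ x} := isClosed_le continuous_const ℓ.continuous
    exact closure_minimal (fun x hx => (hℓ x hx).le) h2 h1
  refine ⟨ℓ, fun c hc => ?_, ?_⟩
  · by_contra hneg
    change ¬ 0 ≤ ℓ c at hneg
    push Not at hneg
    -- Scaling c by this factor gives a point of the cone where ℓ lies below its bound ℓ (-c₀).
    have hr : 0 < (|ℓ (-c₀)| + 1) / -ℓ c := by
      have := abs_nonneg (ℓ (-c₀)); apply div_pos <;> linarith
    have h1 := hcl _ (hmem c hc _ hr)
    rw [map_smul, smul_eq_mul] at h1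
    have h2 : (|ℓ (-c₀)| + 1) / -ℓ c * ℓ c = -(|ℓ (-c₀)| + 1) := by
      have := hneg.ne
      field_simp
    have := neg_abs_le (ℓ (-c₀))
    linarith
  · by_contra hall
    push Not at hall
    have h0 : (ℓ : V →ₗ[ℝ] ℝ) = 0 := LinearMap.ext_on hspan fun c hc => hall c hc
    obtain ⟨x, hx⟩ := hint
    have h1 := hℓ x hx
    have h2 : ∀ v, ℓ v = 0 := fun v => LinearMap.congr_fun h0 v
    rw [h2, h2] at h1
    exact lt_irrefl _ h1

/-- Proper separation of the origin from a convex set. -/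
theorem exists_nonneg_functional {V : Type*} [NormedAddCommGroup V]
    [NormedSpace ℝ V] [FiniteDimensional ℝ V] {C : Set V} (hC : Convex ℝ C) {c₀ : V}
    (hc₀ : c₀ ∈ C) (h : ∀ ε : ℝ, 0 < ε → -(ε • c₀) ∉ C) :
    ∃ ℓ : V →ₗ[ℝ] ℝ, (∀ c ∈ C, 0 ≤ ℓ c) ∧ ∃ c ∈ C, ℓ c ≠ 0 := by
  obtain ⟨ℓ, h1, c, hc, h2⟩ := exists_nonneg_functional_of_span_eq_top
    (V := Submodule.span ℝ C) (C := ((↑) : Submodule.span ℝ C → V) ⁻¹' C)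
    (hC.linear_preimage (Submodule.span ℝ C).subtype) (Submodule.span_span_coe_preimage)
    (c₀ := ⟨c₀, Submodule.subset_span hc₀⟩) hc₀ (fun ε hε => h ε hε)
  obtain ⟨g, hg⟩ := ℓ.exists_extend
  have hgl : ∀ x : Submodule.span ℝ C, g x = ℓ x := fun x => LinearMap.congr_fun hg x
  exact ⟨g, fun c hc => by
    have := h1 ⟨c, Submodule.subset_span hc⟩ hc
    rwa [← hgl] at this, c, hc, by rwa [hgl]⟩

/-- The line through v and x stays in the affine span, where x is an interior point, so it can be
prolonged a little beyond x. This is the only form in which relative interiors enter the argument.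
-/
theorem exists_sub_smul_mem_of_mem_intrinsicInterior {E : Type*} [NormedAddCommGroup E]
    [NormedSpace ℝ E] {C : Set E} {x v : E} (hx : x ∈ intrinsicInterior ℝ C) (hv : v ∈ C) :
    ∃ ε : ℝ, 0 < ε ∧ x - ε • (v - x) ∈ C := by
  obtain ⟨y, hy, rfl⟩ := mem_intrinsicInterior.1 hx
  set φ : ℝ → affineSpan ℝ C := fun t =>
    ⟨AffineMap.lineMap (y : E) v (-t), AffineMap.lineMap_mem _ y.2 (subset_affineSpan ℝ C hv)⟩
  have hφ : Continuous φ := by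
    refine Continuous.subtype_mk ?_ _
    exact AffineMap.lineMap_continuous.comp continuous_neg
  have h0 : φ 0 = y := by ext; simp [φ]
  have hev : ∀ᶠ t in nhds (0 : ℝ), φ t ∈ interior (((↑) : affineSpan ℝ C → E) ⁻¹' C) :=
    hφ.continuousAt.eventually_mem (isOpen_interior.mem_nhds (by rwa [h0]))
  obtain ⟨δ, hδ, hball⟩ := Metric.eventually_nhds_iff.1 hev
  refine ⟨δ / 2, by positivity, ?_⟩
  have h1 : φ (δ / 2) ∈ interior (((↑) : affineSpan ℝ C → E) ⁻¹' C) := hball (by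
    rw [dist_zero_right, Real.norm_eq_abs, abs_of_pos (by positivity)]; linarith)
  have h2 : ((φ (δ / 2) : affineSpan ℝ C) : E) ∈ C :=
    (interior_subset h1 : φ (δ / 2) ∈ ((↑) : affineSpan ℝ C → E) ⁻¹' C)
  convert h2 using 1
  simp only [φ, AffineMap.lineMap_apply, vsub_eq_sub, vadd_eq_add]
  module

end Separation

/-! ### Lagrange multipliers under a Slater condition -/

section Multipliers

variable {E F : Type*} [NormedAddCommGroup E] [InnerProductSpace ℝ E] [FiniteDimensional ℝ E]
  [NormedAddCommGroup F] [InnerProductSpace ℝ F] [FiniteDimensional ℝ F]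

/-- Lagrange multipliers for the minimization of `f + ⟨l, ·⟩` over `{x ∈ K | B x = b}`. -/
theorem exists_multipliers {f : E → EReal} (hf : IsProperClosedConvex f) {K : Set E}
    (hK : Convex ℝ K) (B : E →ₗ[ℝ] F) {x₀ : E} (hfx₀ : f x₀ ≠ ⊤) (hKx₀ : x₀ ∈ K)
    (hfri : ∀ v, f v ≠ ⊤ → ∃ ε : ℝ, 0 < ε ∧ f (x₀ - ε • (v - x₀)) ≠ ⊤)
    (hKri : ∀ v ∈ K, ∃ ε : ℝ, 0 < ε ∧ x₀ - ε • (v - x₀) ∈ K)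
    {xs l : E} (hKxs : xs ∈ K) (hBxs : B xs = B x₀) {a : ℝ} (ha : f xs = a)
    (hmin : ∀ x ∈ K, B x = B x₀ → ((a + inner ℝ l (xs - x) : ℝ) : EReal) ≤ f x) :
    ∃ (s z : E) (y : F), IsSubgrad f xs (-s) ∧ IsSubgrad (ind K) xs (-z) ∧
      s + z = l + LinearMap.adjoint B y := by
  obtain ⟨a₀, ha₀⟩ := hf.exists_coe hfx₀
  -- Separate copies of the variable are used for f, for K and for the affine constraint. The first
  -- two coordinates measure their disagreement, the third bounds above the excess of f + ⟨l, ·⟩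
  -- over its optimal value.
  set C : Set (E × E × ℝ) := {p | ∃ x₁ x₂ x : E, x₂ ∈ K ∧ B x = B x₀ ∧ p.1 = x₁ - x ∧
    p.2.1 = x₂ - x ∧ f x₁ ≤ ((p.2.2 + a - inner ℝ l (x₁ - xs) : ℝ) : EReal)} with hCdef
  have hC : Convex ℝ C := by
    rintro ⟨p, q, t⟩ ⟨x₁, x₂, x, h1, h2, h3, h4, h5⟩ ⟨p', q', t'⟩
      ⟨x₁', x₂', x', h1', h2', h3', h4', h5'⟩ α β hα hβ hαβ
    have hβ' : α = 1 - β := by linarith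
    subst hβ'
    dsimp only at h3 h4 h5 h3' h4' h5'
    refine ⟨x₁ + β • (x₁' - x₁), (1 - β) • x₂ + β • x₂', (1 - β) • x + β • x',
      hK h1 h1' hα hβ hαβ, ?_, ?_, ?_, ?_⟩
    · rw [map_add, map_smul, map_smul, h2, h2', ← add_smul]; simp
    · simp only [Prod.fst_add, Prod.smul_fst, h3, h3']; module
    · simp only [Prod.snd_add, Prod.smul_snd, Prod.fst_add, Prod.smul_fst, h4, h4']; module
    · refine (hf.segment_le h5 h5' hβ (by linarith)).trans (EReal.coe_le_coe_iff.2 (le_of_eq ?_))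
      simp only [Prod.snd_add, Prod.smul_snd, smul_eq_mul, inner_sub_right, inner_add_right,
        inner_smul_right]
      ring
  set τ₀ : ℝ := max 0 (a₀ - a + inner ℝ l (x₀ - xs)) + 1 with hτ₀
  have hτpos : 0 < τ₀ := by have := le_max_left 0 (a₀ - a + inner ℝ l (x₀ - xs)); linarith
  have hmem : ∀ t : ℝ, a₀ - a + inner ℝ l (x₀ - xs) ≤ t → ((0, 0, t) : E × E × ℝ) ∈ C := by
    intro t ht
    refine ⟨x₀, x₀, x₀, hKx₀, rfl, by simp, by simp, ?_⟩
    rw [ha₀, EReal.coe_le_coe_iff]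
    dsimp only
    linarith
  have hc₀ : ((0, 0, τ₀) : E × E × ℝ) ∈ C := hmem _ (by
    have := le_max_right 0 (a₀ - a + inner ℝ l (x₀ - xs)); linarith)
  -- A point (0, 0, -ετ₀) of C would be a single feasible x with objective below the optimum.
  obtain ⟨ℓ, hnn, c, hcC, hcne⟩ := exists_nonneg_functional hC hc₀ fun ε hε hmem => by
    obtain ⟨x₁, x₂, x, h1, h2, h3, h4, h5⟩ := hmem
    simp only [Prod.smul_mk, smul_zero, Prod.neg_mk, neg_zero] at h3 h4 h5
    have e1 : x₁ = x := (sub_eq_zero.1 h3.symm)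
    have e2 : x₂ = x := (sub_eq_zero.1 h4.symm)
    subst e1 e2
    have h6 := (hmin _ h1 h2).trans h5
    rw [EReal.coe_le_coe_iff, smul_eq_mul, ← neg_sub x₂ xs, inner_neg_right] at h6
    have : 0 < ε * τ₀ := by positivity
    linarith
  set l₁ : E := (InnerProductSpace.toDual ℝ E).symm
    (LinearMap.toContinuousLinearMap (ℓ ∘ₗ LinearMap.inl ℝ E (E × ℝ)))
  set l₂ : E := (InnerProductSpace.toDual ℝ E).symm
    (LinearMap.toContinuousLinearMap (ℓ ∘ₗ LinearMap.inr ℝ E (E × ℝ) ∘ₗ LinearMap.inl ℝ E ℝ))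
  set μ : ℝ := ℓ (0, 0, 1)
  have hℓ : ∀ p q t, ℓ (p, q, t) = inner ℝ l₁ p + inner ℝ l₂ q + t * μ := by
    intro p q t
    have e : ((p, q, t) : E × E × ℝ) = (p, 0, 0) + (0, q, 0) + t • (0, 0, 1) := by simp
    rw [e, map_add, map_add, map_smul, smul_eq_mul]
    simp only [l₁, l₂, μ, InnerProductSpace.toDual_symm_apply]
    rfl
  have hin : ∀ {x₁ x₂ x : E} {r : ℝ}, f x₁ ≤ r → x₂ ∈ K → B x = B x₀ →
      0 ≤ inner ℝ l₁ (x₁ - x) + inner ℝ l₂ (x₂ - x) + (r - a + inner ℝ l (x₁ - xs)) * μ := by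
    intro x₁ x₂ x r h1 h2 h3
    rw [← hℓ]
    exact hnn _ ⟨x₁, x₂, x, h2, h3, rfl, rfl, by convert h1 using 2; dsimp only; ring⟩
  have hμ0 : 0 ≤ μ := by
    have := hnn _ hc₀
    rw [hℓ] at this
    simp only [inner_zero_right, zero_add] at this
    exact nonneg_of_mul_nonneg_right this hτpos
  -- If μ = 0, prolong beyond x₀ the segments from x₁, x and x₂. The resulting members of C reverse
  -- the inequality at c, so ℓ vanishes at c, against properness of the separation.
  have hμ : 0 < μ := by
    refine lt_of_le_of_ne hμ0 fun hμ => hcne ?_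
    obtain ⟨p, q, t⟩ := c
    obtain ⟨x₁, x₂, x, h1, h2, h3, h4, h5⟩ := id hcC
    dsimp only at h3 h4 h5
    have hx₁ : f x₁ ≠ ⊤ := ne_top_of_le_ne_top (EReal.coe_ne_top _) h5
    obtain ⟨ε₁, hε₁, h6⟩ := hfri x₁ hx₁
    obtain ⟨ε₂, hε₂, h7⟩ := hKri x₂ h1
    obtain ⟨r, hr⟩ := hf.exists_coe h6
    have h8 : 0 ≤ inner ℝ l₁ (x₀ - ε₁ • (x₁ - x₀) - (x₀ - ε₁ • (x - x₀))) +
        inner ℝ l₂ (x₀ - (x₀ - ε₁ • (x - x₀))) := by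
      have := hin (x := x₀ - ε₁ • (x - x₀)) hr.le hKx₀ (by simp [h2])
      rwa [← hμ, mul_zero, add_zero] at this
    have h9 : 0 ≤ inner ℝ l₁ (x₀ - x₀) + inner ℝ l₂ (x₀ - ε₂ • (x₂ - x₀) - x₀) := by
      have := hin (x := x₀) ha₀.le h7 rfl
      rwa [← hμ, mul_zero, add_zero] at this
    have h10 := hnn _ hcC
    rw [hℓ, ← hμ, h3, h4] at h10 ⊢
    simp only [inner_sub_right, inner_smul_right, inner_zero_right, mul_zero, add_zero, sub_self,
      zero_add] at *
    have h11 : 0 ≤ -(ε₁ * (inner ℝ l₁ x₁ - inner ℝ l₁ x) + ε₁ * (inner ℝ l₂ x₀ - inner ℝ l₂ x)) := by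
      linarith
    have h12 : 0 ≤ -(ε₂ * (inner ℝ l₂ x₂ - inner ℝ l₂ x₀)) := by linarith
    have h13 : inner ℝ l₁ x₁ - inner ℝ l₁ x + (inner ℝ l₂ x₀ - inner ℝ l₂ x) ≤ 0 := by
      by_contra hh; push Not at hh; nlinarith [mul_pos hε₁ hh]
    have h14 : inner ℝ l₂ x₂ - inner ℝ l₂ x₀ ≤ 0 := by
      by_contra hh; push Not at hh; nlinarith [mul_pos hε₂ hh]
    linarith
  refine ⟨l + μ⁻¹ • l₁, μ⁻¹ • l₂, ?_⟩
  -- Moving only the affine copy by ±v with v in the kernel of B shows that l₁ + l₂ is orthogonal to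
  -- that kernel.
  have horth : l₁ + l₂ ∈ LinearMap.range (LinearMap.adjoint B) := by
    rw [← LinearMap.orthogonal_ker, Submodule.mem_orthogonal']
    intro v hv
    have hB : ∀ r : ℝ, B (xs - r • v) = B x₀ := fun r => by
      rw [map_sub, map_smul, LinearMap.mem_ker.1 hv, hBxs]; simp
    have h1 := hin ha.le hKxs (hB 1)
    have h2 := hin ha.le hKxs (hB (-1))
    simp only [sub_self, inner_zero_right, add_zero, inner_sub_right, neg_smul, one_smul,
      sub_neg_eq_add, inner_add_right, inner_add_left] at *
    linarith
  obtain ⟨y, hy⟩ := horth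
  refine ⟨μ⁻¹ • y, ⟨a, ha, fun x => ?_⟩, isSubgrad_ind_iff.2 ⟨hKxs, fun x hx => ?_⟩, ?_⟩
  · by_cases hx : f x = ⊤
    · simp [hx]
    obtain ⟨r, hr⟩ := hf.exists_coe hx
    have h1 := hin hr.le hKxs hBxs
    rw [hr, EReal.coe_le_coe_iff, inner_neg_left, inner_add_left, inner_smul_left]
    simp only [conj_trivial]
    rw [sub_self, inner_zero_right, add_zero] at h1
    have h2 : 0 ≤ μ⁻¹ * (inner ℝ l₁ (x - xs) + (r - a + inner ℝ l (x - xs)) * μ) := by positivity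
    have h3 : μ⁻¹ * (inner ℝ l₁ (x - xs) + (r - a + inner ℝ l (x - xs)) * μ) =
        μ⁻¹ * inner ℝ l₁ (x - xs) + (r - a + inner ℝ l (x - xs)) := by field_simp
    linarith
  · have h1 := hin ha.le hx hBxs
    simp only [sub_self, inner_zero_right, zero_add, add_zero, zero_mul] at h1
    rw [inner_neg_left, inner_smul_left]
    simp only [conj_trivial]
    have : 0 ≤ μ⁻¹ * inner ℝ l₂ (x - xs) := by positivity
    linarith
  · rw [map_smul, hy]
    module

end Multipliers
end BlockAngular

namespace BlockAngular

/-! ### KKT points and optimality for the block problem -/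

namespace Problem

variable {N : ℕ} {X Y : Fin (N + 1) → Type*}
  [∀ i, NormedAddCommGroup (X i)] [∀ i, InnerProductSpace ℝ (X i)]
  [∀ i, FiniteDimensional ℝ (X i)]
  [∀ i, NormedAddCommGroup (Y i)] [∀ i, InnerProductSpace ℝ (Y i)]
  [∀ i, FiniteDimensional ℝ (Y i)]
  (P : Problem N X Y)

theorem bθ_pcc : IsProperClosedConvex P.bθ := by
  choose x₀ hx₀ using fun i => (P.θ_pcc i).exists_ne_top
  exact (isProperClosedConvex_sum Finset.univ (x₀ := (WithLp.toLp 2 x₀ : PiLp 2 X))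
    (fun i => (P.θ_pcc i).comp (L := PiLp.proj (𝕜 := ℝ) 2 X i) ⟨WithLp.toLp 2 x₀, hx₀ i⟩) hx₀).1

theorem isSubgrad_bθ {x g : PiLp 2 X} (h : ∀ i, IsSubgrad (P.θ i) (x i) (g i)) :
    IsSubgrad P.bθ x g := by
  choose a ha hg using h
  have hcoe : ∀ (s : Finset (Fin (N + 1))) (r : Fin (N + 1) → ℝ),
      ((∑ i ∈ s, r i : ℝ) : EReal) = ∑ i ∈ s, (r i : EReal) := by
    intro s r
    exact map_sum (⟨⟨Real.toEReal, rfl⟩, EReal.coe_add⟩ : ℝ →+ EReal) r s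
  refine ⟨∑ i, a i, ?_, fun y => ?_⟩
  · rw [hcoe]
    exact Finset.sum_congr rfl fun i _ => ha i
  · rw [PiLp.inner_apply, ← Finset.sum_add_distrib, hcoe]
    exact Finset.sum_le_sum fun i _ => hg i (y i)

theorem bK_nonempty : P.bK.Nonempty := by
  choose x₀ hx₀ using P.K_nonempty
  exact ⟨WithLp.toLp 2 x₀, hx₀⟩

theorem bK_closed : IsClosed P.bK := by
  have : P.bK = ⋂ i, (fun x : PiLp 2 X => x i) ⁻¹' P.K i := by
    ext x; simp [bK]
  rw [this]
  exact isClosed_iInter fun i => (P.K_closed i).preimage (PiLp.proj (𝕜 := ℝ) 2 X i).continuous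

theorem bK_convex : Convex ℝ P.bK := fun _ hx _ hy _ _ ha hb hab i =>
  P.K_convex i (hx i) (hy i) ha hb hab

theorem ind_bK_pcc : IsProperClosedConvex (ind P.bK) :=
  isProperClosedConvex_ind P.bK_nonempty P.bK_closed P.bK_convex

theorem isSubgrad_ind_bK {x g : PiLp 2 X} (h : ∀ i, IsSubgrad (ind (P.K i)) (x i) (g i)) :
    IsSubgrad (ind P.bK) x g := by
  simp only [isSubgrad_ind_iff] at h ⊢
  refine ⟨fun i => (h i).1, fun y hy => ?_⟩
  rw [PiLp.inner_apply]
  exact Finset.sum_nonpos fun i _ => (h i).2 (y i) (hy i)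

@[simp]
theorem bQ_apply (x : PiLp 2 X) (i : Fin (N + 1)) : P.bQ x i = P.Q i (x i) := rfl

theorem bQ_symmetric : P.bQ.IsSymmetric := fun x y => by
  simp only [PiLp.inner_apply, bQ_apply]
  exact Finset.sum_congr rfl fun i _ => (P.Q_pos i).1 (x i) (y i)

theorem bQ_inner (x y : PiLp 2 X) : inner ℝ (P.bQ x) y = inner ℝ x (P.bQ y) := P.bQ_symmetric x y

theorem bQ_nonneg (x : PiLp 2 X) : 0 ≤ inner ℝ x (P.bQ x) := by
  simp only [PiLp.inner_apply, bQ_apply]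
  refine Finset.sum_nonneg fun i _ => ?_
  have := (P.Q_pos i).2 (x i)
  rw [real_inner_comm]
  simpa using this

theorem Badj_inner (y : PiLp 2 Y) (x : PiLp 2 X) :
    inner ℝ (P.Badj y) x = inner ℝ y (P.B x) := LinearMap.adjoint_inner_left _ _ _

/-- The range of a symmetric operator is the orthogonal complement of its kernel, so projecting onto
W does not change Qx. -/
theorem exists_mem_W_bQ_eq (x : PiLp 2 X) : ∃ w : P.W, P.bQ w = P.bQ x := by
  refine ⟨⟨P.W.starProjection x, P.W.starProjection_apply_mem x⟩, ?_⟩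
  have h : x - P.W.starProjection x ∈ LinearMap.ker P.bQ := by
    rw [← P.bQ_symmetric.orthogonal_range]
    exact P.W.sub_starProjection_mem_orthogonal x
  rw [LinearMap.mem_ker, map_sub, sub_eq_zero] at h
  exact h.symm

theorem mem_kktSet_iff {u : P.State} : u ∈ P.kktSet ↔
    P.B u.x = P.b ∧ P.bQ u.w = P.bQ u.x ∧ P.DualFeasible u.y u.w u.s u.z ∧
      IsSubgrad P.bθ u.x (-u.s) ∧ IsSubgrad (ind P.bK) u.x (-u.z) := by
  have h0 : u ∈ P.kktSet ↔ P.residual u = 0 := Iff.rfl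
  rw [h0, P.bθ_pcc.isSubgrad_iff_prox_eq, P.ind_bK_pcc.isSubgrad_iff_prox_eq, ← sub_eq_add_neg,
    ← sub_eq_add_neg, ← proj_eq_prox_ind P.bK_nonempty P.bK_closed P.bK_convex, DualFeasible]
  constructor
  · intro h
    refine ⟨sub_eq_zero.1 (congrArg State.y h), ?_, sub_eq_zero.1 (congrArg State.s h),
      (sub_eq_zero.1 (congrArg State.z h)).symm, (sub_eq_zero.1 (congrArg State.x h)).symm⟩
    have h1 : P.bQ (u.w - u.x) = 0 := congrArg (fun v => ((State.w v : P.W) : PiLp 2 X)) h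
    rwa [map_sub, sub_eq_zero] at h1
  · rintro ⟨h1, h2, h3, h4, h5⟩
    have h6 : P.bQ.rangeRestrict (u.w - u.x) = 0 := by
      ext1
      simp [h2]
    rw [residual, h1, h3, h4, h5, h6]
    simp only [sub_self]
    rfl

/-- A KKT point gives a pair of optimal solutions. -/
theorem isPrimalOptimal_of_mem_kktSet {u : P.State} (hu : u ∈ P.kktSet) :
    P.IsPrimalOptimal u.x := by
  obtain ⟨hB, hQ, hF, ⟨a, ha, hs⟩, hz⟩ := P.mem_kktSet_iff.1 hu
  rw [isSubgrad_ind_iff] at hz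
  have hobj : P.primalObj u.x =
      ((a + (1 / 2 * inner ℝ u.x (P.bQ u.x) + inner ℝ P.c u.x) : ℝ) : EReal) := by
    rw [primalObj, ha, EReal.coe_add a]
  refine ⟨hB, hz.1, by rw [hobj]; exact EReal.coe_ne_top _, fun x' hB' hK' => ?_⟩
  rw [hobj, primalObj]
  refine le_trans ?_ (add_le_add_left (hs x') _)
  rw [← EReal.coe_add, EReal.coe_le_coe_iff]
  have h1 := hz.2 x' hK'
  have h2 := P.bQ_nonneg (x' - u.x)
  have h3 : inner ℝ (P.Badj u.y) (x' - u.x) = (0 : ℝ) := by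
    rw [Badj_inner, map_sub, hB, hB', sub_self, inner_zero_right]
  have h4 := congrArg (fun v => inner ℝ v (x' - u.x)) (show _ = _ from hF)
  simp only [hQ, inner_add_left, inner_neg_left, map_sub, inner_sub_right, inner_sub_left,
    bQ_inner] at *
  have h5 := P.bQ_inner u.x x'
  rw [real_inner_comm] at h5
  linarith

/-- Fenchel-Young at the primal part `u.x` is an equality for the KKT multipliers and an inequality
for every other dual feasible point; the quadratic terms differ by a square of the Q-seminorm. -/
theorem isDualOptimal_of_mem_kktSet {u : P.State} (hu : u ∈ P.kktSet) :
    P.IsDualOptimal u.y u.w u.s u.z := by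
  obtain ⟨hB, hQ, hF, hs, hz⟩ := P.mem_kktSet_iff.1 hu
  obtain ⟨a, ha, -⟩ := id hs
  have hK := (isSubgrad_ind_iff.1 hz).1
  have hobj : P.dualObj u.y u.w u.s u.z =
      ((inner ℝ (-u.s) u.x - a + (inner ℝ (-u.z) u.x - 0) +
        (1 / 2 * inner ℝ (u.w : PiLp 2 X) (P.bQ u.w) - inner ℝ P.b u.y) : ℝ) : EReal) := by
    rw [dualObj, hs.conj_eq ha, hz.conj_eq (a := 0) (by simp [ind_of_mem hK]), EReal.coe_add,
      EReal.coe_add]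
  refine ⟨hF, by rw [hobj]; exact EReal.coe_ne_top _, fun y' w' s' z' hF' => ?_⟩
  rw [hobj, dualObj]
  refine le_trans ?_ (add_le_add_left (add_le_add (le_conj P.bθ (-s') u.x ha.le)
    (le_conj (ind P.bK) (-z') u.x (a := 0) (by simp [ind_of_mem hK]))) _)
  rw [← EReal.coe_add, ← EReal.coe_add, EReal.coe_le_coe_iff]
  have h2 := P.bQ_nonneg ((w' : PiLp 2 X) - u.w)
  have h3 := P.Badj_inner u.y u.x
  have h3' := P.Badj_inner y' u.x
  rw [hB, real_inner_comm] at h3 h3'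
  have h4 := congrArg (fun v => inner ℝ v u.x) (show _ = _ from hF)
  have h4' := congrArg (fun v => inner ℝ v u.x) (show _ = _ from hF')
  simp only [inner_add_left, inner_neg_left, map_sub, inner_sub_right, inner_sub_left,
    bQ_inner, ← hQ] at *
  have h5 := P.bQ_inner u.w w'
  rw [real_inner_comm] at h5
  have h6 := real_inner_comm (P.Badj u.y) u.x
  have h7 := real_inner_comm (P.Badj y') u.x
  have h8 := real_inner_comm P.b u.y
  have h9 := real_inner_comm P.b y'
  linarith

end Problem
end BlockAngular

namespace BlockAngular

/-! ### Boundedness from relative interior conditions on conjugates -/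

section Boundedness

variable {E : Type*} [NormedAddCommGroup E] [InnerProductSpace ℝ E]

omit [NormedAddCommGroup E] [InnerProductSpace ℝ E] in
theorem exists_le_of_mem_effDom {f : E → EReal} {v : E} (hv : v ∈ effDom f) :
    ∃ c : ℝ, f v ≤ c := ⟨(f v).toReal, EReal.le_coe_toReal hv⟩

/-- The vectors `d` for which `n ↦ ⟨d, x n⟩` is bounded. -/
def boundedDirections (x : ℕ → E) : Submodule ℝ E where
  carrier := {d | ∃ C : ℝ, ∀ n, |(inner ℝ d (x n) : ℝ)| ≤ C}
  add_mem' := by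
    rintro d e ⟨C, hC⟩ ⟨D, hD⟩
    exact ⟨C + D, fun n => by
      rw [inner_add_left]; exact (abs_add_le _ _).trans (add_le_add (hC n) (hD n))⟩
  zero_mem' := ⟨0, fun n => by simp⟩
  smul_mem' := by
    rintro r d ⟨C, hC⟩
    exact ⟨|r| * C, fun n => by
      rw [inner_smul_left, abs_mul]
      simpa using mul_le_mul_of_nonneg_left (hC n) (abs_nonneg r)⟩

theorem mem_boundedDirections {x : ℕ → E} {d : E} :
    d ∈ boundedDirections x ↔ ∃ C : ℝ, ∀ n, |(inner ℝ d (x n) : ℝ)| ≤ C := Iff.rfl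

/-- On the subspace of bounded directions the functionals ⟨x n, ·⟩ are pointwise bounded, hence
uniformly by Banach-Steinhaus. Evaluating at x n itself, which lies in the subspace, gives ‖x n‖² ≤
C‖x n‖. -/
theorem exists_norm_le_of_mem_boundedDirections [FiniteDimensional ℝ E] {x : ℕ → E}
    (hx : ∀ n, x n ∈ boundedDirections x) : ∃ C : ℝ, ∀ n, ‖x n‖ ≤ C := by
  set G := boundedDirections x
  obtain ⟨C, hC⟩ := banach_steinhaus (g := fun n => (innerSL ℝ (x n)).comp G.subtypeL) fun d => by
    obtain ⟨C, hC⟩ := mem_boundedDirections.1 d.2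
    refine ⟨C, fun n => ?_⟩
    simpa [real_inner_comm] using hC n
  refine ⟨C, fun n => ?_⟩
  have h1 := ((innerSL ℝ (x n)).comp G.subtypeL).le_of_opNorm_le (hC n) ⟨x n, hx n⟩
  simp only [ContinuousLinearMap.comp_apply, Submodule.subtypeL_apply, innerSL_apply_apply,
    real_inner_self_eq_norm_sq, Real.norm_eq_abs, abs_pow, abs_norm, Submodule.coe_norm] at h1
  by_contra hlt
  push Not at hlt
  have hC0 : 0 ≤ C := (norm_nonneg _).trans (hC n)
  nlinarith

theorem bounded_below_of_effDom_conj {f : E → EReal} {x : ℕ → E} {r : ℕ → ℝ}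
    (hr : ∀ n, f (x n) ≤ r n) {s : E} (hs : -s ∈ effDom (conj f)) :
    ∃ C : ℝ, ∀ n, C ≤ r n + inner ℝ s (x n) := by
  obtain ⟨c, hc⟩ := exists_le_of_mem_effDom hs
  refine ⟨-c, fun n => ?_⟩
  have := (le_conj f (-s) (x n) (hr n)).trans hc
  rw [EReal.coe_le_coe_iff, inner_neg_left] at this
  linarith

/-- Fenchel-Young at v bounds ⟨v + s, x n⟩ above; at a point slightly beyond -s, seen from v, it
bounds the same pairing below. -/
theorem add_mem_boundedDirections {f : E → EReal} {x : ℕ → E} {r : ℕ → ℝ}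
    (hr : ∀ n, f (x n) ≤ r n) {s : E} (hs : -s ∈ intrinsicInterior ℝ (effDom (conj f))) {T : ℝ}
    (hT : ∀ n, r n + inner ℝ s (x n) ≤ T) {v : E} (hv : v ∈ effDom (conj f)) :
    v + s ∈ boundedDirections x := by
  obtain ⟨ε, hε, hw⟩ := exists_sub_smul_mem_of_mem_intrinsicInterior hs hv
  obtain ⟨c, hc⟩ := exists_le_of_mem_effDom hv
  obtain ⟨c', hc'⟩ := exists_le_of_mem_effDom hw
  refine ⟨max (c + T) (ε⁻¹ * (c' + T)), fun n => abs_le'.2 ⟨?_, ?_⟩⟩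
  · refine le_trans ?_ (le_max_left _ _)
    have := (le_conj f _ (x n) (hr n)).trans hc
    rw [EReal.coe_le_coe_iff] at this
    rw [inner_add_left]
    linarith [hT n]
  · refine le_trans ?_ (le_max_right _ _)
    have := (le_conj f _ (x n) (hr n)).trans hc'
    rw [EReal.coe_le_coe_iff, sub_neg_eq_add, inner_sub_left, inner_smul_left, inner_neg_left] at this
    simp only [conj_trivial] at this
    rw [le_inv_mul_iff₀ hε]
    linarith [hT n]

theorem IsSubgrad.mem_effDom_conj {f : E → EReal} {x g : E} (h : IsSubgrad f x g) :
    g ∈ effDom (conj f) := by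
  obtain ⟨a, ha, -⟩ := id h
  change conj f g ≠ ⊤
  rw [h.conj_eq ha]
  exact EReal.coe_ne_top _

/-- A limit of points with subgradients tending to `0` (in the weak sense below) is a minimizer. -/
theorem isSubgrad_zero_of_tendsto {f : E → EReal} (hf : IsProperClosedConvex f) {x g : ℕ → E}
    {x' : E} (hx : Filter.Tendsto x Filter.atTop (nhds x'))
    (hg : Filter.Tendsto g Filter.atTop (nhds 0)) (h : ∀ n, IsSubgrad f (x n) (g n)) :
    IsSubgrad f x' 0 := by
  -- Were f x' > c > b, lower semicontinuity would keep f (x n) above c, while the subgradient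
  -- inequality at y caps it by b plus a null sequence.
  have key : ∀ (y : E) (b : ℝ), f y = b → f x' ≤ b := by
    intro y b hb
    by_contra hlt
    push Not at hlt
    obtain ⟨c, hbc, hc⟩ := EReal.lt_iff_exists_real_btwn.1 hlt
    rw [EReal.coe_lt_coe_iff] at hbc
    have h1 := hx.eventually (hf.lowerSemicontinuous x' c hc)
    have h2 : Filter.Tendsto (fun n => (inner ℝ (g n) (y - x n) : ℝ)) Filter.atTop (nhds 0) := by
      simpa using hg.inner (tendsto_const_nhds.sub hx : Filter.Tendsto _ _ (nhds (y - x')))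
    have h3 := h2.eventually (lt_mem_nhds (show b - c < 0 by linarith))
    obtain ⟨n, h4, h5⟩ := (h1.and h3).exists
    obtain ⟨a, ha, h6⟩ := h n
    have h7 := h6 y
    rw [hb, EReal.coe_le_coe_iff] at h7
    replace h4 : (c : EReal) < f (x n) := h4
    rw [ha, EReal.coe_lt_coe_iff] at h4
    linarith
  obtain ⟨y₀, b₀, hb₀⟩ := hf.exists_coe_eq
  obtain ⟨a, ha⟩ := hf.exists_coe (ne_top_of_le_ne_top (EReal.coe_ne_top b₀) (key y₀ b₀ hb₀))
  refine ⟨a, ha, fun y => ?_⟩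
  by_cases hy : f y = ⊤
  · simp [hy]
  obtain ⟨b, hb⟩ := hf.exists_coe hy
  rw [inner_zero_left, add_zero, ← ha, hb]
  exact key y b hb

end Boundedness

/-! ### Existence of a KKT point under the Slater conditions -/

namespace Problem

variable {N : ℕ} {X Y : Fin (N + 1) → Type*}
  [∀ i, NormedAddCommGroup (X i)] [∀ i, InnerProductSpace ℝ (X i)]
  [∀ i, FiniteDimensional ℝ (X i)]
  [∀ i, NormedAddCommGroup (Y i)] [∀ i, InnerProductSpace ℝ (Y i)]
  [∀ i, FiniteDimensional ℝ (Y i)]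
  (P : Problem N X Y)

/-- The quadratic part of the primal objective. -/
noncomputable def quad (x : PiLp 2 X) : ℝ := 1 / 2 * inner ℝ x (P.bQ x) + inner ℝ P.c x

theorem quad_add (x d : PiLp 2 X) :
    P.quad (x + d) = P.quad x + inner ℝ (P.bQ x + P.c) d + 1 / 2 * inner ℝ d (P.bQ d) := by
  have h := P.bQ_inner x d
  have h' := real_inner_comm (P.bQ x) d
  simp only [quad, map_add, inner_add_left, inner_add_right]
  linarith

theorem continuous_quad : Continuous P.quad := by
  have := P.bQ.continuous_of_finiteDimensional
  unfold quad
  fun_prop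

theorem convexOn_quad : ConvexOn ℝ Set.univ P.quad := by
  refine ⟨convex_univ, fun x _ y _ a b ha hb hab => ?_⟩
  have e1 : a • x + b • y = x + b • (y - x) := by
    rw [show a = 1 - b by linarith]; module
  have e2 : P.quad y = P.quad (x + (y - x)) := by rw [add_sub_cancel]
  rw [e1, e2, quad_add, quad_add]
  have h := P.bQ_nonneg (y - x)
  simp only [map_smul, inner_smul_left, inner_smul_right, conj_trivial, smul_eq_mul]
  have h1 : 0 ≤ a * b * inner ℝ (y - x) (P.bQ (y - x)) := by positivity
  rw [show a = 1 - b by linarith] at h1 ⊢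
  linarith

/-- The primal objective together with the constraints. -/
noncomputable def primalFun (x : PiLp 2 X) : EReal :=
  P.bθ x + (P.quad x : EReal) + ind (P.bK ∩ {x | P.B x = P.b}) x

theorem primalFun_of_mem {x : PiLp 2 X} (hK : x ∈ P.bK) (hB : P.B x = P.b) :
    P.primalFun x = P.bθ x + (P.quad x : EReal) := by
  have h : x ∈ P.bK ∩ {x | P.B x = P.b} := ⟨hK, hB⟩
  rw [primalFun, ind_of_mem h, add_zero]

theorem primalFun_pcc {x₀ : PiLp 2 X} (hθ : P.bθ x₀ ≠ ⊤) (hK : x₀ ∈ P.bK) (hB : P.B x₀ = P.b) :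
    IsProperClosedConvex P.primalFun := by
  refine (P.bθ_pcc.add (isProperClosedConvex_coe P.convexOn_quad P.continuous_quad)
    ⟨x₀, hθ, EReal.coe_ne_top _⟩).add (isProperClosedConvex_ind ⟨x₀, hK, hB⟩ ?_ ?_)
    ⟨x₀, EReal.add_ne_top hθ (EReal.coe_ne_top _), by simp [ind_of_mem, hK, hB]⟩
  · exact P.bK_closed.inter
      (isClosed_eq P.B.continuous_of_finiteDimensional continuous_const)
  · refine P.bK_convex.inter fun x hx y hy a b _ _ hab => ?_
    change P.B (a • x + b • y) = P.b
    rw [map_add, map_smul, map_smul, show P.B x = P.b from hx, show P.B y = P.b from hy,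
      ← add_smul, hab, one_smul]

theorem feasible_of_isSubgrad {x g : PiLp 2 X} (h : IsSubgrad P.primalFun x g) :
    ∃ a : ℝ, P.bθ x = a ∧ x ∈ P.bK ∧ P.B x = P.b := by
  obtain ⟨a, ha, -⟩ := h
  have hmem : x ∈ P.bK ∩ {x | P.B x = P.b} := by
    by_contra hx
    rw [primalFun, ind_of_notMem hx, EReal.add_top_of_ne_bot] at ha
    · exact EReal.coe_ne_top a ha.symm
    · simp [EReal.add_eq_bot_iff, P.bθ_pcc.ne_bot]
  obtain ⟨a', ha'⟩ := P.bθ_pcc.exists_coe (x := x) fun h0 => by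
    rw [P.primalFun_of_mem hmem.1 hmem.2, h0, EReal.top_add_coe] at ha
    exact EReal.coe_ne_top a ha.symm
  exact ⟨a', ha', hmem.1, hmem.2⟩

theorem quad_le_of_isSubgrad {x g : PiLp 2 X} (h : IsSubgrad P.primalFun x g) {y : PiLp 2 X}
    {a b : ℝ} (ha : P.bθ x = a) (hb : P.bθ y ≤ b) (hK : y ∈ P.bK) (hB : P.B y = P.b) :
    a + P.quad x + inner ℝ g (y - x) ≤ b + P.quad y := by
  obtain ⟨-, -, hKx, hBx⟩ := P.feasible_of_isSubgrad h
  obtain ⟨c, hc, hg⟩ := h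
  rw [P.primalFun_of_mem hKx hBx, ha, ← EReal.coe_add, EReal.coe_eq_coe_iff] at hc
  have h1 := hg y
  rw [P.primalFun_of_mem hK hB] at h1
  have h2 := h1.trans (add_le_add_left hb _)
  rw [← EReal.coe_add, EReal.coe_le_coe_iff, ← hc] at h2
  exact h2

/-- At a minimizer of the objective minus ⟨g, ·⟩ the quadratic may be replaced by its linearization,
so the multiplier theorem applies with l = Qx + c - g. -/
theorem exists_multipliers_of_isSubgrad (hP : P.PrimalSlater) {x g : PiLp 2 X}
    (h : IsSubgrad P.primalFun x g) : ∃ (s z : PiLp 2 X) (y : PiLp 2 Y),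
      IsSubgrad P.bθ x (-s) ∧ IsSubgrad (ind P.bK) x (-z) ∧
      s + z = P.bQ x + P.c - g + P.Badj y := by
  obtain ⟨x₀, hB₀, hθ₀, hK₀⟩ := hP
  obtain ⟨a, ha, hK, hB⟩ := P.feasible_of_isSubgrad h
  refine exists_multipliers P.bθ_pcc P.bK_convex P.B (intrinsicInterior_subset hθ₀)
    (intrinsicInterior_subset hK₀)
    (fun v hv => exists_sub_smul_mem_of_mem_intrinsicInterior hθ₀ hv)
    (fun v hv => exists_sub_smul_mem_of_mem_intrinsicInterior hK₀ hv) hK (hB.trans hB₀.symm) ha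
    fun y hKy hBy => ?_
  by_cases hy : P.bθ y = ⊤
  · simp [hy]
  obtain ⟨b, hb⟩ := P.bθ_pcc.exists_coe hy
  rw [hb, EReal.coe_le_coe_iff]
  have key : 0 ≤ b - a + inner ℝ (P.bQ x + P.c - g) (y - x) := by
    refine nonneg_of_quadratic_nonneg (m := 1 / 2 * inner ℝ (y - x) (P.bQ (y - x)))
      fun t ht0 ht1 => ?_
    have h1 := P.quad_le_of_isSubgrad h ha (P.bθ_pcc.segment_le ha.le hb.le ht0.le ht1)
      (P.bK_convex.add_smul_sub_mem hK hKy ⟨ht0.le, ht1⟩)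
      (by rw [map_add, map_smul, map_sub, hBy, hB, hB₀]; simp)
    rw [quad_add, add_sub_cancel_left] at h1
    rw [inner_sub_left]
    simp only [map_smul, inner_smul_left, inner_smul_right, conj_trivial] at h1
    linarith
  rw [← neg_sub y x, inner_neg_right]
  linarith

theorem kktSet_nonempty_of_isSubgrad (hP : P.PrimalSlater) {x : PiLp 2 X}
    (h : IsSubgrad P.primalFun x 0) : P.kktSet.Nonempty := by
  obtain ⟨s, z, y, hs, hz, he⟩ := P.exists_multipliers_of_isSubgrad hP h
  obtain ⟨a, ha, hK, hB⟩ := P.feasible_of_isSubgrad h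
  obtain ⟨w, hw⟩ := P.exists_mem_W_bQ_eq x
  refine ⟨P.mkState (-y) w s z x, P.mem_kktSet_iff.2 ⟨hB, hw, ?_, hs, hz⟩⟩
  change -P.bQ w + P.Badj (-y) + s + z = P.c
  rw [add_assoc, he, hw, map_neg]
  abel

theorem kktSet_nonempty_of_slater (hP : P.PrimalSlater) (hD : P.DualSlater) :
    P.kktSet.Nonempty := by
  obtain ⟨x₀, hB₀, hθ₀, hK₀⟩ := id hP
  replace hK₀ := intrinsicInterior_subset hK₀
  obtain ⟨a₀, ha₀⟩ := P.bθ_pcc.exists_coe (intrinsicInterior_subset hθ₀)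
  obtain ⟨yd, wd, sd, zd, hF, hsd, hzd⟩ := hD
  have hpcc := P.primalFun_pcc (intrinsicInterior_subset hθ₀) hK₀ hB₀
  set ε : ℕ → ℝ := fun n => 1 / ((n : ℝ) + 1) with hε
  have hε0 : ∀ n, 0 < ε n := fun n => Nat.one_div_pos_of_nat
  have hε1 : ∀ n, ε n ≤ 1 := fun n => by
    rw [hε]; simp only; rw [div_le_one (by positivity)]; linarith [(Nat.cast_nonneg n : (0:ℝ) ≤ n)]
  -- Tikhonov regularization: x n satisfies the optimality condition for the constrained objective
  -- plus (ε n / 2)‖x‖².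
  choose x hx using fun n => hpcc.exists_isSubgrad (hε0 n) 0
  choose a ha hK hB using fun n => P.feasible_of_isSubgrad (hx n)
  choose s z y hs hz he using fun n => P.exists_multipliers_of_isSubgrad hP (hx n)
  have hup : ∀ n, a n + P.quad (x n) ≤ a₀ + P.quad x₀ + ‖x₀‖ ^ 2 := by
    intro n
    have h1 := P.quad_le_of_isSubgrad (hx n) (ha n) ha₀.le hK₀ hB₀
    rw [zero_sub, inner_smul_left, inner_neg_left, inner_sub_right,
      real_inner_self_eq_norm_sq] at h1
    simp only [conj_trivial] at h1
    have h2 := real_inner_le_norm (x n) x₀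
    have h3 : inner ℝ (x n) x₀ - ‖x n‖ ^ 2 ≤ ‖x₀‖ ^ 2 := by
      nlinarith [sq_nonneg (‖x n‖ - ‖x₀‖), sq_nonneg (‖x n‖), sq_nonneg ‖x₀‖]
    have h4 : ε n * (inner ℝ (x n) x₀ - ‖x n‖ ^ 2) ≤ ‖x₀‖ ^ 2 := by
      rcases le_or_gt (inner ℝ (x n) x₀ - ‖x n‖ ^ 2) 0 with h | h
      · nlinarith [hε0 n, sq_nonneg ‖x₀‖]
      · nlinarith [hε1 n]
    linarith
  have hZr : ∀ n, ind P.bK (x n) ≤ ((0 : ℝ) : EReal) := fun n => by simp [ind_of_mem (hK n)]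
  obtain ⟨CT, hCT⟩ := bounded_below_of_effDom_conj (fun n => (ha n).le)
    (intrinsicInterior_subset hsd)
  obtain ⟨CZ, hCZ⟩ := bounded_below_of_effDom_conj hZr (intrinsicInterior_subset hzd)
  -- Substituting the dual Slater point for c splits the objective into three pieces that are each
  -- bounded below, plus constants. The upper bound on the sum then bounds each piece above.
  have hsplit : ∀ n, a n + P.quad (x n) = (a n + inner ℝ sd (x n)) + (0 + inner ℝ zd (x n)) +
      1 / 2 * inner ℝ (x n - wd) (P.bQ (x n - wd)) - 1 / 2 * inner ℝ (wd : PiLp 2 X) (P.bQ wd) +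
      inner ℝ yd P.b := by
    intro n
    have h1 := congrArg (fun v => inner ℝ v (x n)) (show _ = _ from hF)
    have h2 := P.Badj_inner yd (x n)
    rw [hB n] at h2
    have h3 := P.bQ_inner wd (x n)
    have h4 := real_inner_comm (P.bQ wd) (x n)
    simp only [quad, inner_add_left, inner_neg_left, map_sub, inner_sub_left,
      inner_sub_right] at *
    linarith
  set U : ℝ := a₀ + P.quad x₀ + ‖x₀‖ ^ 2 + 1 / 2 * inner ℝ (wd : PiLp 2 X) (P.bQ wd) -
    inner ℝ yd P.b with hU
  have hQn : ∀ n, 0 ≤ inner ℝ (x n - wd) (P.bQ (x n - wd)) := fun n => P.bQ_nonneg _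
  have hT : ∀ n, a n + inner ℝ sd (x n) ≤ U - CZ := fun n => by
    have := hup n; rw [hsplit] at this; linarith [hCZ n, hQn n]
  have hZ : ∀ n, 0 + inner ℝ zd (x n) ≤ U - CT := fun n => by
    have := hup n; rw [hsplit] at this; linarith [hCT n, hQn n]
  have hQ : ∀ n, inner ℝ (x n - wd) (P.bQ (x n - wd)) ≤ 2 * (U - CT - CZ) := fun n => by
    have := hup n; rw [hsplit] at this; linarith [hCT n, hCZ n]
  have hGQ : ∀ v, P.bQ v ∈ boundedDirections x := by
    intro v
    refine ⟨(inner ℝ v (P.bQ v) + 2 * (U - CT - CZ)) / 2 + |inner ℝ v (P.bQ wd)|, fun n => ?_⟩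
    have h1 := P.bQ_nonneg (v + (x n - wd))
    have h2 := P.bQ_nonneg (v - (x n - wd))
    have h3 := P.bQ_inner v (x n - wd)
    have h3' := P.bQ_inner (x n - wd) v
    have h3'' := real_inner_comm (P.bQ (x n - wd)) v
    have h4 := P.bQ_inner v wd
    have h5 := hQ n
    have h6 : inner ℝ (P.bQ v) (x n) = inner ℝ (P.bQ v) (x n - wd) + inner ℝ v (P.bQ wd) := by
      rw [inner_sub_right, h4]; ring
    rw [h6]
    refine (abs_add_le _ _).trans (add_le_add_left ?_ _)
    rw [map_add, inner_add_left, inner_add_right, inner_add_right] at h1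
    rw [map_sub, inner_sub_left, inner_sub_right, inner_sub_right] at h2
    rw [abs_le']
    constructor <;> linarith
  have hGB : ∀ v, P.Badj v ∈ boundedDirections x := fun v =>
    ⟨|inner ℝ v P.b|, fun n => by rw [Badj_inner, hB n]⟩
  have hGx : ∀ n, x n ∈ boundedDirections x := by
    intro n
    have h1 := add_mem_boundedDirections (fun n => (ha n).le) hsd hT (hs n).mem_effDom_conj
    have h2 := add_mem_boundedDirections hZr hzd hZ (hz n).mem_effDom_conj
    -- This is the multiplier equation minus the dual Slater equation. Every summand is a bounded
    -- direction. The multipliers need not be bounded in n, since only membership in the subspace is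
    -- used.
    have h3 : ε n • x n = -(-s n + sd) + -(-z n + zd) + P.bQ (wd - x n) + P.Badj (-y n - yd) := by
      have h4 := he n
      have h5 : -P.bQ wd + P.Badj yd + sd + zd = P.c := hF
      rw [← h5] at h4
      have h6 : s n = P.bQ (x n) + (-P.bQ wd + P.Badj yd + sd + zd) - ε n • (0 - x n) +
        P.Badj (y n) - z n := by rw [← h4]; abel
      rw [h6, map_sub, map_sub, map_neg, zero_sub, smul_neg]
      abel
    have h4 : ε n • x n ∈ boundedDirections x := by
      rw [h3]
      exact add_mem (add_mem (add_mem (neg_mem h1) (neg_mem h2)) (hGQ _)) (hGB _)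
    rwa [Submodule.smul_mem_iff _ (hε0 n).ne'] at h4
  obtain ⟨C, hC⟩ := exists_norm_le_of_mem_boundedDirections hGx
  obtain ⟨x', -, φ, hφ, hlim⟩ := tendsto_subseq_of_bounded
    (Metric.isBounded_closedBall (x := (0 : PiLp 2 X)) (r := C)) (x := x) fun n => by
      simpa using hC n
  refine P.kktSet_nonempty_of_isSubgrad hP
    (isSubgrad_zero_of_tendsto hpcc hlim ?_ fun n => hx (φ n))
  have h1 : Filter.Tendsto (fun n => ε (φ n)) Filter.atTop (nhds 0) :=
    tendsto_one_div_add_atTop_nhds_zero_nat.comp hφ.tendsto_atTop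
  simpa using h1.smul ((tendsto_const_nhds (x := (0 : PiLp 2 X))).sub hlim)

end Problem
end BlockAngular

namespace BlockAngular

/-! ### Optimality conditions of the quadratic subproblems -/

section LeastSquares

variable {E F : Type*} [NormedAddCommGroup E] [InnerProductSpace ℝ E]
  [NormedAddCommGroup F] [InnerProductSpace ℝ F]

theorem norm_add_smul_sq (v d : E) (t : ℝ) :
    ‖v + t • d‖ ^ 2 = ‖v‖ ^ 2 + t * (2 * inner ℝ v d) + t ^ 2 * ‖d‖ ^ 2 := by
  rw [norm_add_sq_real, inner_smul_right, norm_smul, mul_pow, Real.norm_eq_abs, sq_abs]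
  ring

theorem inner_eq_of_isMinOn_leastSquares {b y : E} {σ : ℝ} {L : E →ₗ[ℝ] F} {a : F}
    (h : IsMinOn (fun η : E => -inner ℝ b η + σ / 2 * ‖L η + a‖ ^ 2) Set.univ y) (d : E) :
    inner ℝ (σ • (L y + a)) (L d) = inner ℝ b d := by
  have h0 : -inner ℝ b d + σ * inner ℝ (L y + a) (L d) = 0 := by
    apply eq_zero_of_quadratic_nonneg (m := σ / 2 * ‖L d‖ ^ 2)
    intro t
    have h1 := h (Set.mem_univ (y + t • d))
    simp only [Set.mem_ofPred_eq] at h1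
    rw [map_add, map_smul, show L y + t • L d + a = (L y + a) + t • L d by abel,
      norm_add_smul_sq, inner_add_right, inner_smul_right] at h1
    linarith
  rw [inner_smul_left]
  simp only [conj_trivial]
  linarith

/-- The first-order condition holds only along the range of Q. The gradient difference Qw - Q(σ(-Qw
+ a)) itself lies in that range, so testing with it gives equality. -/
theorem eq_of_isMinOn_range {Q : E →ₗ[ℝ] E} (hQ : Q.IsSymmetric) {σ : ℝ} {a w : E}
    (hw : w ∈ LinearMap.range Q)
    (h : IsMinOn (fun ω : E => 1 / 2 * inner ℝ ω (Q ω) + σ / 2 * ‖-Q ω + a‖ ^ 2)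
      (LinearMap.range Q : Set E) w) : Q w = Q (σ • (-Q w + a)) := by
  have h0 : ∀ d ∈ LinearMap.range Q, inner ℝ (Q w - Q (σ • (-Q w + a))) d = 0 := by
    intro d hd
    have : inner ℝ (Q w) d - σ * inner ℝ (-Q w + a) (Q d) = 0 := by
      apply eq_zero_of_quadratic_nonneg (m := 1 / 2 * inner ℝ d (Q d) + σ / 2 * ‖Q d‖ ^ 2)
      intro t
      have h1 := h (show w + t • d ∈ (LinearMap.range Q : Set E) from
        add_mem hw (Submodule.smul_mem _ t hd))
      simp only [Set.mem_ofPred_eq] at h1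
      rw [map_add, map_smul, show -(Q w + t • Q d) + a = (-Q w + a) + (-t) • Q d by module,
        norm_add_smul_sq, inner_add_left, inner_add_right, inner_add_right] at h1
      simp only [inner_smul_left, inner_smul_right, conj_trivial] at h1
      have h2 : inner ℝ w (Q d) = inner ℝ (Q w) d := (hQ w d).symm
      rw [real_inner_comm (Q w) d] at h1
      rw [h2] at h1
      linarith
    rw [inner_sub_left, hQ (σ • (-Q w + a)) d, inner_smul_left]
    simpa using this
  have h1 := h0 _ (sub_mem (LinearMap.mem_range_self Q w)
    (LinearMap.mem_range_self Q (σ • (-Q w + a))))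
  exact sub_eq_zero.1 (inner_self_eq_zero.1 h1)

end LeastSquares

/-! ### One iteration as a two-block semi-proximal step -/

namespace Problem

variable {N : ℕ} {X Y : Fin (N + 1) → Type*}
  [∀ i, NormedAddCommGroup (X i)] [∀ i, InnerProductSpace ℝ (X i)]
  [∀ i, FiniteDimensional ℝ (X i)]
  [∀ i, NormedAddCommGroup (Y i)] [∀ i, InnerProductSpace ℝ (Y i)]
  [∀ i, FiniteDimensional ℝ (Y i)]
  (P : Problem N X Y)

/-- The block diagonal part of the adjoint constraint operator. -/
noncomputable def DT : PiLp 2 Y →ₗ[ℝ] PiLp 2 X where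
  toFun y := WithLp.toLp 2 fun i => P.Dadj i (y i)
  map_add' x x' := by ext i; simp
  map_smul' r x := by ext i; simp

/-- The linking part of the adjoint constraint operator. -/
noncomputable def AT : Y 0 →ₗ[ℝ] PiLp 2 X where
  toFun y := WithLp.toLp 2 fun i => P.Aadj i y
  map_add' x x' := by ext i; simp
  map_smul' r x := by ext i; simp

/-- The linking constraint operator. -/
noncomputable def bA : PiLp 2 X →ₗ[ℝ] Y 0 where
  toFun x := ∑ i, P.A i (x i)
  map_add' x x' := by simp [Finset.sum_add_distrib]
  map_smul' r x := by simp [Finset.smul_sum]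

@[simp]
theorem DT_apply (y : PiLp 2 Y) (i : Fin (N + 1)) : P.DT y i = P.Dadj i (y i) := rfl

@[simp]
theorem AT_apply (y : Y 0) (i : Fin (N + 1)) : P.AT y i = P.Aadj i y := rfl

theorem bA_apply (x : PiLp 2 X) : P.bA x = ∑ i, P.A i (x i) := rfl

theorem B_apply_zero (x : PiLp 2 X) : P.B x 0 = P.bA x := by
  simp [B, bA_apply, P.D_zero]

theorem B_apply_of_ne (x : PiLp 2 X) {i : Fin (N + 1)} (hi : i ≠ 0) : P.B x i = P.D i (x i) := by
  simp [B, hi]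

theorem DT_inner (y : PiLp 2 Y) (x : PiLp 2 X) :
    inner ℝ (P.DT y) x = ∑ i, inner ℝ (y i) (P.D i (x i)) := by
  rw [PiLp.inner_apply]
  exact Finset.sum_congr rfl fun i _ => LinearMap.adjoint_inner_left _ _ _

theorem AT_inner (y : Y 0) (x : PiLp 2 X) : inner ℝ (P.AT y) x = inner ℝ y (P.bA x) := by
  rw [PiLp.inner_apply, bA_apply, inner_sum]
  exact Finset.sum_congr rfl fun i _ => LinearMap.adjoint_inner_left _ _ _

theorem DT_inner_eq_zero {x : PiLp 2 X} (h : ∀ i, i ≠ 0 → P.D i (x i) = 0) (y : PiLp 2 Y) :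
    inner ℝ (P.DT y) x = 0 := by
  rw [DT_inner]
  refine Finset.sum_eq_zero fun i _ => ?_
  by_cases hi : i = 0
  · subst hi; simp [P.D_zero]
  · rw [h i hi, inner_zero_right]

theorem Badj_eq (y : PiLp 2 Y) : P.Badj y = P.DT y + P.AT (y 0) := by
  refine ext_inner_right ℝ fun x => ?_
  rw [Badj_inner, inner_add_left, DT_inner, AT_inner, PiLp.inner_apply]
  have h : ∀ i, inner ℝ (y i) (P.B x i) = (inner ℝ (y i) (P.D i (x i)) : ℝ) +
      if i = 0 then inner ℝ (y 0) (P.bA x) else 0 := by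
    intro i
    by_cases hi : i = 0
    · subst hi; simp [B_apply_zero, P.D_zero]
    · simp [B_apply_of_ne P x hi, hi]
  simp [h, Finset.sum_add_distrib]

/-- The orthogonal projection onto the range of `DT`. -/
noncomputable def projD : PiLp 2 X →L[ℝ] PiLp 2 X := (LinearMap.range P.DT).starProjection

/-- The orthogonal projection onto the range of `AT`. -/
noncomputable def projA : PiLp 2 X →L[ℝ] PiLp 2 X := (LinearMap.range P.AT).starProjection

theorem projD_eq {x : PiLp 2 X} {y : PiLp 2 Y} (h : ∀ i, i ≠ 0 → P.D i ((x - P.DT y) i) = 0) :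
    P.projD x = P.DT y := by
  refine Submodule.eq_starProjection_of_mem_orthogonal (LinearMap.mem_range_self _ _) ?_
  rw [Submodule.mem_orthogonal]
  rintro _ ⟨y', rfl⟩
  exact P.DT_inner_eq_zero h y'

theorem projA_eq {x : PiLp 2 X} {y : Y 0} (h : P.bA (x - P.AT y) = 0) : P.projA x = P.AT y := by
  refine Submodule.eq_starProjection_of_mem_orthogonal (LinearMap.mem_range_self _ _) ?_
  rw [Submodule.mem_orthogonal]
  rintro _ ⟨y', rfl⟩
  rw [AT_inner, h, inner_zero_right]

/-- The operator `σ Q (I + σ Q)⁻¹`. -/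
noncomputable def resolv (σ : ℝ) : PiLp 2 X →ₗ[ℝ] PiLp 2 X :=
  σ • (P.bQ * Ring.inverse (1 + σ • P.bQ))

section Resolvent

variable {σ : ℝ} (hσ : 0 < σ)
include hσ

theorem eq_of_add_smul_bQ_eq {a b : PiLp 2 X} (h : a + σ • P.bQ a = b + σ • P.bQ b) : a = b := by
  have h1 : (a - b) + σ • P.bQ (a - b) = 0 := by
    rw [map_sub, smul_sub, ← sub_eq_zero.2 h]; abel
  have h2 := congrArg (fun v => inner ℝ (a - b) v) h1
  simp only [inner_add_right, inner_smul_right, inner_zero_right,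
    real_inner_self_eq_norm_sq] at h2
  have h3 := mul_nonneg hσ.le (P.bQ_nonneg (a - b))
  have h4 : ‖a - b‖ = 0 := by nlinarith [norm_nonneg (a - b)]
  exact sub_eq_zero.1 (norm_eq_zero.1 h4)

theorem exists_resolv_eq (s : PiLp 2 X) :
    ∃ t, s = t + σ • P.bQ t ∧ P.resolv σ s = σ • P.bQ t := by
  have hu : IsUnit (1 + σ • P.bQ : Module.End ℝ (PiLp 2 X)) := by
    rw [LinearMap.isUnit_iff_ker_eq_bot, LinearMap.ker_eq_bot]
    intro a b hab
    exact P.eq_of_add_smul_bQ_eq hσ hab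
  refine ⟨Ring.inverse (1 + σ • P.bQ : Module.End ℝ (PiLp 2 X)) s, ?_, rfl⟩
  exact (LinearMap.congr_fun (Ring.mul_inverse_cancel _ hu) s).symm

theorem resolv_add (s : PiLp 2 X) :
    P.resolv σ s + σ • P.bQ (P.resolv σ s) = σ • P.bQ s := by
  obtain ⟨t, ht, hr⟩ := P.exists_resolv_eq hσ s
  rw [hr]
  nth_rewrite 1 [ht]
  rw [map_add, smul_add]

theorem resolv_inner (s s' : PiLp 2 X) :
    inner ℝ (P.resolv σ s) s' = inner ℝ s (P.resolv σ s') := by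
  obtain ⟨t, ht, hr⟩ := P.exists_resolv_eq hσ s
  obtain ⟨t', ht', hr'⟩ := P.exists_resolv_eq hσ s'
  rw [hr, hr', ht, ht']
  simp only [inner_add_left, inner_add_right, inner_smul_left, inner_smul_right, conj_trivial,
    bQ_inner]
  ring

/-- With s = t + σQt the right side is ⟨t, σQt⟩ + ‖σQt‖². So the proximal term produced by the
second `w` solve is nonnegative and controls the perturbation it causes. -/
theorem norm_resolv_sq_le (s : PiLp 2 X) : ‖P.resolv σ s‖ ^ 2 ≤ inner ℝ s (P.resolv σ s) := by
  obtain ⟨t, ht, hr⟩ := P.exists_resolv_eq hσ s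
  rw [hr, ← real_inner_self_eq_norm_sq]
  nth_rewrite 1 [ht]
  rw [inner_add_left, inner_smul_right _ (P.bQ t) σ]
  have := mul_nonneg hσ.le (P.bQ_nonneg t)
  rw [inner_smul_right]
  linarith

theorem bQ_eq_zero_of_resolv_eq_zero {s : PiLp 2 X} (h : P.resolv σ s = 0) : P.bQ s = 0 := by
  have := P.resolv_add hσ s
  rw [h, map_zero, smul_zero, add_zero] at this
  exact (smul_eq_zero.1 this.symm).resolve_left hσ.ne'

end Resolvent

/-- The residual of the dual equality constraint. -/
noncomputable def dualRes (u : P.State) : PiLp 2 X := -P.bQ u.w + P.Badj u.y + u.s + u.z - P.c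

/-- The contribution of the second block to the dual constraint. -/
noncomputable def link (u : P.State) : PiLp 2 X := P.AT (u.y 0) + u.z

/-- The optimality conditions of one iteration of sGS-ADMM. -/
structure IsOptimalStep (σ τ : ℝ) (u v : P.State) : Prop where
  y_eq : ∀ i, i ≠ 0 → P.D i ((u.x + σ • (P.dualRes v - (P.link v - P.link u))) i) = P.b i
  w_eq : P.bQ v.w = P.bQ (u.x + σ • (P.dualRes v - (P.link v - P.link u)) +
    σ • P.projD ((v.s - u.s) - P.bQ (v.w - u.w)))
  s_subgrad : IsSubgrad P.bθ (u.x + σ • (P.dualRes v - (P.link v - P.link u)) +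
    σ • (P.resolv σ (v.s - u.s) + P.projD ((v.s - u.s) - P.bQ (v.w - u.w)))) (-v.s)
  y₀_eq : P.bA (u.x + σ • P.dualRes v) = P.b 0
  z_subgrad : IsSubgrad (ind P.bK) (u.x + σ • P.dualRes v + σ • P.projA (v.z - u.z)) (-v.z)
  x_eq : v.x = u.x + (τ * σ) • P.dualRes v

variable {P}

theorem IsYStep.D_eq {σ : ℝ} {i : Fin (N + 1)} {w s g : X i} {y : Y i}
    (h : P.IsYStep σ i w s g y) : P.D i (σ • (-P.Q i w + P.Dadj i y + s + g)) = P.b i := by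
  have e : ∀ η, -P.Q i w + P.Dadj i η + s + g = P.Dadj i η + (-P.Q i w + s + g) := fun η => by abel
  simp only [IsYStep, e] at h ⊢
  refine ext_inner_right ℝ fun d => ?_
  rw [← inner_eq_of_isMinOn_leastSquares h d]
  exact (LinearMap.adjoint_inner_right _ _ _).symm

theorem IsWStep.Q_eq {σ : ℝ} {i : Fin (N + 1)} {y : Y i} {s g w : X i}
    (h : P.IsWStep σ i y s g w) : P.Q i w = P.Q i (σ • (-P.Q i w + P.Dadj i y + s + g)) := by
  have e : ∀ ω, -P.Q i ω + P.Dadj i y + s + g = -P.Q i ω + (P.Dadj i y + s + g) :=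
    fun ω => by abel
  simp only [IsWStep, e] at h ⊢
  exact eq_of_isMinOn_range (P.Q_pos i).1 h.1 h.2

theorem IsSStep.isSubgrad {σ : ℝ} {i : Fin (N + 1)} {y : Y i} {w g s : X i}
    (h : P.IsSStep σ i y w g s) :
    IsSubgrad (P.θ i) (σ • (-P.Q i w + P.Dadj i y + s + g)) (-s) := by
  have e : ∀ ς, -P.Q i w + P.Dadj i y + ς + g = ς + (-P.Q i w + P.Dadj i y + g) :=
    fun ς => by abel
  simp only [IsSStep, e] at h ⊢
  exact (P.θ_pcc i).isSubgrad_of_isMinOn_conj h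

theorem IsZStep.isSubgrad {σ : ℝ} {i : Fin (N + 1)} {y : Y 0} {h z : X i}
    (hz : P.IsZStep σ i y h z) :
    IsSubgrad (ind (P.K i)) (σ • (P.Aadj i y + z + h)) (-z) := by
  have e : ∀ ζ, P.Aadj i y + ζ + h = ζ + (P.Aadj i y + h) := fun ζ => by abel
  simp only [IsZStep, e] at hz ⊢
  exact (isProperClosedConvex_ind (P.K_nonempty i) (P.K_closed i)
    (P.K_convex i)).isSubgrad_of_isMinOn_conj hz

theorem IsY0Step.bA_eq {σ : ℝ} {z h : PiLp 2 X} {y : Y 0} (hy : P.IsY0Step σ z h y) :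
    P.bA (σ • (P.AT y + z + h)) = P.b 0 := by
  have e : ∀ η, ∑ i, σ / 2 * ‖P.Aadj i η + z i + h i‖ ^ 2 = σ / 2 * ‖P.AT η + (z + h)‖ ^ 2 := by
    intro η
    rw [PiLp.norm_sq_eq_of_L2, Finset.mul_sum]
    simp [add_assoc]
  simp only [IsY0Step, e] at hy
  refine ext_inner_right ℝ fun d => ?_
  rw [← inner_eq_of_isMinOn_leastSquares hy d, real_inner_comm, ← AT_inner, real_inner_comm,
    add_assoc]

/-- Each variable solved twice has two linear optimality conditions, whose difference expresses the
gap between the intermediate and the final value through the increments of the other variables. The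
intermediate values thus drop out of the subgradient conditions for `s` and `z`. -/
theorem IsStep.isOptimalStep {σ τ : ℝ} (hσ : 0 < σ) {u v : P.State} (h : P.IsStep σ τ u v) :
    P.IsOptimalStep σ τ u v := by
  obtain ⟨ybar, wbar, h1, h2, h3, h4, h5, h6, h7, h8, h9⟩ := h
  set g : PiLp 2 X := WithLp.toLp 2 (P.gvec σ (u.y 0) u.z u.x) with hg
  set h : PiLp 2 X := WithLp.toLp 2 (P.hvec σ v.y v.w v.s u.x) with hh
  have hσg : σ • g = σ • (P.link u - P.c) + u.x := by
    ext i
    simp only [hg, gvec, link, PiLp.smul_apply, PiLp.add_apply, PiLp.sub_apply, AT_apply,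
      smul_add, smul_smul, mul_inv_cancel₀ hσ.ne', one_smul]
  have hσh : σ • h = σ • (-P.bQ v.w + P.DT v.y + v.s - P.c) + u.x := by
    ext i
    simp only [hh, hvec, PiLp.smul_apply, PiLp.add_apply, PiLp.sub_apply, PiLp.neg_apply,
      bQ_apply, DT_apply, smul_add, smul_smul, mul_inv_cancel₀ hσ.ne', one_smul]
  have hE : σ • (-P.bQ v.w + P.DT v.y + v.s + g) =
      u.x + σ • (P.dualRes v - (P.link v - P.link u)) := by
    rw [smul_add _ _ g, hσg, dualRes, Badj_eq, link, link]
    module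
  have hE2 : σ • (P.AT (v.y 0) + v.z + h) = u.x + σ • P.dualRes v := by
    rw [smul_add _ _ h, hσh, dualRes, Badj_eq]
    module
  have hD : P.projD ((v.s - u.s) - P.bQ (v.w - u.w)) = P.DT (ybar - v.y) := by
    apply P.projD_eq
    intro i hi
    have e1 := (h1 i hi).D_eq
    have e2 := (h5 i hi).D_eq
    have e3 : σ • ((v.s - u.s) - P.bQ (v.w - u.w) - P.DT (ybar - v.y)) i =
        σ • (-P.Q i ((v.w : PiLp 2 X) i) + P.Dadj i (v.y i) + v.s i +
          P.gvec σ (u.y 0) u.z u.x i) -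
        σ • (-P.Q i ((u.w : PiLp 2 X) i) + P.Dadj i (ybar i) + u.s i +
          P.gvec σ (u.y 0) u.z u.x i) := by
      simp only [PiLp.sub_apply, bQ_apply, DT_apply, map_sub]
      module
    have e4 : σ • P.D i (((v.s - u.s) - P.bQ (v.w - u.w) - P.DT (ybar - v.y)) i) = 0 := by
      rw [← map_smul, e3, map_sub, e1, e2, sub_self]
    exact (smul_eq_zero.1 e4).resolve_left hσ.ne'
  have hA : P.projA (v.z - u.z) = P.AT (ybar 0 - v.y 0) := by
    apply P.projA_eq
    have e1 := IsY0Step.bA_eq (h := h) h6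
    have e2 := IsY0Step.bA_eq (h := h) h8
    have e3 : σ • P.bA (v.z - u.z - P.AT (ybar 0 - v.y 0)) = 0 := by
      rw [← map_smul, ← sub_self (P.b 0)]
      nth_rewrite 1 [← e2]
      rw [← e1, ← map_sub, map_sub]
      congr 1
      module
    exact (smul_eq_zero.1 e3).resolve_left hσ.ne'
  have hw : ∀ (w s : PiLp 2 X), (∀ i, P.IsWStep σ i (ybar i) (s i)
      (P.gvec σ (u.y 0) u.z u.x i) (w i)) →
      P.bQ w = P.bQ (σ • (-P.bQ w + P.DT ybar + s + g)) := by
    intro w s hws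
    ext i
    exact (hws i).Q_eq
  have hw1 := hw wbar u.s h2
  have hw2 := hw v.w v.s h4
  -- The two `w` conditions subtract to d + σQd = σQ(Δs) for d = Q(w - w̄), the equation
  -- characterizing `resolv`.
  have hR : P.resolv σ (v.s - u.s) = P.bQ (v.w - wbar) := by
    apply P.eq_of_add_smul_bQ_eq hσ
    rw [P.resolv_add hσ]
    have e : P.bQ (v.w - wbar) = σ • P.bQ (v.s - u.s) - σ • P.bQ (P.bQ (v.w - wbar)) := by
      have e2 : σ • (-P.bQ v.w + P.DT ybar + v.s + g) - σ • (-P.bQ wbar + P.DT ybar + u.s + g) =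
          σ • ((v.s - u.s) - P.bQ (v.w - wbar)) := by
        simp only [map_sub]
        module
      rw [← smul_sub, ← map_sub, ← map_smul, ← e2, map_sub P.bQ (σ • _), ← hw1, ← hw2, map_sub]
    exact (eq_sub_iff_add_eq.1 e).symm
  refine ⟨fun i hi => ?_, ?_, ?_, ?_, ?_, h9⟩
  · rw [← hE]
    exact (h5 i hi).D_eq
  · rw [← hE, hD]
    refine hw2.trans (congrArg P.bQ ?_)
    rw [map_sub]
    module
  · rw [← hE, hD, hR]
    have e : σ • (-P.bQ v.w + P.DT v.y + v.s + g) + σ • (P.bQ (v.w - wbar) + P.DT (ybar - v.y)) =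
        σ • (-P.bQ wbar + P.DT ybar + v.s + g) := by
      simp only [map_sub]
      module
    rw [e]
    exact P.isSubgrad_bθ fun i => (h3 i).isSubgrad
  · rw [← hE2]
    exact IsY0Step.bA_eq (h := h) h8
  · rw [← hE2, hA]
    have e : σ • (P.AT (v.y 0) + v.z + h) + σ • P.AT (ybar 0 - v.y 0) =
        σ • (P.AT (ybar 0) + v.z + h) := by
      simp only [map_sub]
      module
    rw [e]
    exact P.isSubgrad_ind_bK fun i => (h7 i).isSubgrad

end Problem
end BlockAngular

namespace BlockAngular

/-! ### Fejér monotone sequences and linear rates -/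

section Fejer

open Filter Topology

variable {E : Type*} [NormedAddCommGroup E] [NormedSpace ℝ E] [FiniteDimensional ℝ E]

theorem exists_quadratic_upper_bound {φ : E → ℝ} (hc : Continuous φ)
    (hh : ∀ (t : ℝ) v, φ (t • v) = t ^ 2 * φ v) : ∃ C : ℝ, 0 < C ∧ ∀ v, φ v ≤ C * ‖v‖ ^ 2 := by
  obtain ⟨C, hC⟩ := (isCompact_sphere (0 : E) 1).exists_bound_of_continuousOn hc.continuousOn
  refine ⟨max C 1, by positivity, fun v => ?_⟩
  by_cases hv : v = 0
  · have := hh 0 0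
    simp_all
  have hv0 : ‖v‖ ≠ 0 := norm_ne_zero_iff.2 hv
  have h1 := hC (‖v‖⁻¹ • v) (by simp [norm_smul, hv0])
  have h2 : φ v = ‖v‖ ^ 2 * φ (‖v‖⁻¹ • v) := by
    rw [← hh, smul_smul, mul_inv_cancel₀ hv0, one_smul]
  rw [h2, mul_comm]
  gcongr
  exact (le_abs_self _).trans (h1.trans (le_max_left _ _))

theorem exists_quadratic_lower_bound {φ : E → ℝ} (hc : Continuous φ)
    (hh : ∀ (t : ℝ) v, φ (t • v) = t ^ 2 * φ v) (hpos : ∀ v, v ≠ 0 → 0 < φ v) :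
    ∃ c : ℝ, 0 < c ∧ ∀ v, c * ‖v‖ ^ 2 ≤ φ v := by
  have h0 : φ 0 = 0 := by simpa using hh 0 0
  rcases (Metric.sphere (0 : E) 1).eq_empty_or_nonempty with hem | hne
  · refine ⟨1, one_pos, fun v => ?_⟩
    by_cases hv : v = 0
    · simp [hv, h0]
    have hv0 : ‖v‖ ≠ 0 := norm_ne_zero_iff.2 hv
    have : ‖v‖⁻¹ • v ∈ Metric.sphere (0 : E) 1 := by simp [norm_smul, hv0]
    simp [hem] at this
  obtain ⟨p, hp, hmin⟩ := (isCompact_sphere (0 : E) 1).exists_isMinOn hne hc.continuousOn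
  refine ⟨φ p, hpos p fun h => by simp [h] at hp, fun v => ?_⟩
  by_cases hv : v = 0
  · simp [hv, h0]
  have hv0 : ‖v‖ ≠ 0 := norm_ne_zero_iff.2 hv
  have h1 : φ p ≤ φ (‖v‖⁻¹ • v) :=
    hmin (show ‖v‖⁻¹ • v ∈ Metric.sphere (0 : E) 1 by simp [norm_smul, hv0])
  have h2 : φ v = ‖v‖ ^ 2 * φ (‖v‖⁻¹ • v) := by
    rw [← hh, smul_smul, mul_inv_cancel₀ hv0, one_smul]
  rw [h2, mul_comm]
  gcongr

/-- A sequence `u` whose distance to every point of `Ω`, measured by `n` and corrected by `t`,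
decreases by at least a multiple of `ρ ^ 2 + t`. -/
structure IsFejer (u : ℕ → E) (Ω : Set E) (ρ : E → ℝ) (n : E → ℝ) (t : ℕ → ℝ) (c₁ c₂ κ : ℝ) :
    Prop where
  c₁_pos : 0 < c₁
  κ_pos : 0 < κ
  lower : ∀ v, c₁ * ‖v‖ ^ 2 ≤ n v
  upper : ∀ v, n v ≤ c₂ * ‖v‖ ^ 2
  t_nonneg : ∀ k, 0 ≤ t k
  decrease : ∀ k, 1 ≤ k → ∀ p ∈ Ω,
    n (u (k + 1) - p) + t (k + 1) + κ * (ρ (u (k + 1)) ^ 2 + t (k + 1)) ≤ n (u k - p) + t k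

namespace IsFejer

omit [FiniteDimensional ℝ E]

variable {u : ℕ → E} {Ω : Set E} {ρ n : E → ℝ} {t : ℕ → ℝ} {c₁ c₂ κ : ℝ}
  (h : IsFejer u Ω ρ n t c₁ c₂ κ)
include h

omit [NormedSpace ℝ E] in
theorem step_le {p : E} (hp : p ∈ Ω) {k : ℕ} (hk : 1 ≤ k) :
    n (u (k + 1) - p) + t (k + 1) ≤ n (u k - p) + t k := by
  have h1 := h.decrease k hk p hp
  have h2 : 0 ≤ κ * (ρ (u (k + 1)) ^ 2 + t (k + 1)) :=
    mul_nonneg h.κ_pos.le (add_nonneg (sq_nonneg _) (h.t_nonneg _))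
  linarith

omit [NormedSpace ℝ E] in
theorem antitone {p : E} (hp : p ∈ Ω) {k m : ℕ} (hk : 1 ≤ k) (hkm : k ≤ m) :
    n (u m - p) + t m ≤ n (u k - p) + t k := by
  induction m, hkm using Nat.le_induction with
  | base => exact le_rfl
  | succ m hm ih => exact (h.step_le hp (hk.trans hm)).trans ih

omit [NormedSpace ℝ E] in
theorem nonneg (p : E) (k : ℕ) : 0 ≤ n (u k - p) + t k :=
  add_nonneg ((mul_nonneg h.c₁_pos.le (sq_nonneg _)).trans (h.lower _)) (h.t_nonneg k)

omit [NormedSpace ℝ E] in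
theorem tendsto_zero {p : E} (hp : p ∈ Ω) :
    Tendsto (fun k => ρ (u (k + 2))) atTop (𝓝 0) ∧ Tendsto (fun k => t (k + 2)) atTop (𝓝 0) := by
  set φ : ℕ → ℝ := fun k => n (u (k + 1) - p) + t (k + 1) with hφ
  have hanti : Antitone φ := fun k m hkm => h.antitone hp (by omega) (by omega)
  have hlim := tendsto_atTop_ciInf hanti ⟨0, by rintro _ ⟨k, rfl⟩; exact h.nonneg p _⟩
  have hdiff : Tendsto (fun k => κ⁻¹ * (φ k - φ (k + 1))) atTop (𝓝 0) := by
    simpa using (hlim.sub (hlim.comp (tendsto_add_atTop_nat 1))).const_mul κ⁻¹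
  have hb : ∀ k, ρ (u (k + 2)) ^ 2 + t (k + 2) ≤ κ⁻¹ * (φ k - φ (k + 1)) := by
    intro k
    have h1 := h.decrease (k + 1) (by omega) p hp
    rw [le_inv_mul_iff₀ h.κ_pos]
    simp only [hφ]
    linarith
  constructor
  · have h2 : Tendsto (fun k => ρ (u (k + 2)) ^ 2) atTop (𝓝 0) :=
      squeeze_zero (fun k => sq_nonneg _) (fun k => by linarith [hb k, h.t_nonneg (k + 2)]) hdiff
    have h3 := h2.sqrt
    rw [Real.sqrt_zero] at h3
    refine squeeze_zero_norm (fun k => ?_) h3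
    rw [Real.sqrt_sq_eq_abs, Real.norm_eq_abs]
  · exact squeeze_zero (fun k => h.t_nonneg _)
      (fun k => by linarith [hb k, sq_nonneg (ρ (u (k + 2)))]) hdiff

/-- Monotonicity gives boundedness and summable decrease gives ρ → 0, so a cluster point lies in Ω.
Monotonicity relative to that cluster point forces the whole sequence to converge to it. -/
theorem exists_tendsto [FiniteDimensional ℝ E] (hρ : Continuous ρ) (hΩ : ∀ v, ρ v = 0 → v ∈ Ω)
    (hne : Ω.Nonempty) : ∃ p ∈ Ω, Tendsto u atTop (𝓝 p) := by
  obtain ⟨p, hp⟩ := hne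
  obtain ⟨hρ0, ht0⟩ := h.tendsto_zero hp
  have hbdd : ∀ k, u (k + 2) ∈ Metric.closedBall p (√(c₁⁻¹ * (n (u 1 - p) + t 1))) := by
    intro k
    rw [Metric.mem_closedBall, dist_eq_norm]
    apply Real.le_sqrt_of_sq_le
    rw [le_inv_mul_iff₀ h.c₁_pos]
    have h1 := h.antitone hp le_rfl (show 1 ≤ k + 2 by omega)
    linarith [h.lower (u (k + 2) - p), h.t_nonneg (k + 2)]
  obtain ⟨q, -, φ, hφ, hlim⟩ := tendsto_subseq_of_bounded Metric.isBounded_closedBall hbdd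
  have hq : q ∈ Ω := hΩ q (tendsto_nhds_unique ((hρ.tendsto q).comp hlim)
    (hρ0.comp hφ.tendsto_atTop))
  refine ⟨q, hq, ?_⟩
  have hsub : Tendsto (fun j => c₂ * ‖u (φ j + 2) - q‖ ^ 2 + t (φ j + 2)) atTop (𝓝 0) := by
    have h1 : Tendsto (fun j => ‖u (φ j + 2) - q‖) atTop (𝓝 0) :=
      tendsto_iff_norm_sub_tendsto_zero.1 hlim
    simpa using ((h1.pow 2).const_mul c₂).add (ht0.comp hφ.tendsto_atTop)
  rw [Metric.tendsto_atTop]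
  intro ε hε
  have hε' : 0 < c₁ * ε ^ 2 := mul_pos h.c₁_pos (by positivity)
  obtain ⟨j, hj⟩ := (hsub.eventually (gt_mem_nhds hε')).exists
  refine ⟨φ j + 2, fun k hk => ?_⟩
  have h1 := h.antitone hq (by omega) hk
  have h2 := h.upper (u (φ j + 2) - q)
  have h3 := h.lower (u k - q)
  have h4 : c₁ * ‖u k - q‖ ^ 2 < c₁ * ε ^ 2 := by linarith [h.t_nonneg k]
  rw [dist_eq_norm]
  exact lt_of_pow_lt_pow_left₀ 2 hε.le (lt_of_mul_lt_mul_left h4 h.c₁_pos.le)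

omit [NormedSpace ℝ E] in
-- Both u k and the limit stay in the same energy ball around q. Hence decay measured at points of Ω
-- that vary with k still controls the distance to the limit.
theorem norm_sub_limit_le {p q : E} (hlim : Tendsto u atTop (𝓝 p)) (hq : q ∈ Ω) {k : ℕ}
    (hk : 1 ≤ k) : c₁ * ‖u k - p‖ ^ 2 ≤ 4 * (n (u k - q) + t k) := by
  have h1 : c₁ * ‖u k - q‖ ^ 2 ≤ n (u k - q) + t k := by
    linarith [h.lower (u k - q), h.t_nonneg k]
  have h2 : c₁ * ‖p - q‖ ^ 2 ≤ n (u k - q) + t k := by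
    refine le_of_tendsto (((hlim.sub_const q).norm.pow 2).const_mul c₁)
      (eventually_atTop.2 ⟨k, fun m hm => ?_⟩)
    linarith [h.lower (u m - q), h.t_nonneg m, h.antitone hq hk hm]
  have h3 : ‖u k - p‖ ≤ ‖u k - q‖ + ‖p - q‖ := by
    have := norm_sub_le (u k - q) (p - q)
    rwa [sub_sub_sub_cancel_right] at this
  have h4 : ‖u k - p‖ ^ 2 ≤ 2 * (‖u k - q‖ ^ 2 + ‖p - q‖ ^ 2) := by
    nlinarith [norm_nonneg (u k - p), sq_nonneg (‖u k - q‖ - ‖p - q‖)]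
  nlinarith [mul_le_mul_of_nonneg_left h4 h.c₁_pos.le]

/-- Linear convergence under an error bound. -/
theorem exists_linear_rate [FiniteDimensional ℝ E] (hΩ : IsClosed Ω) {p : E} (hp : p ∈ Ω)
    (hlim : Tendsto u atTop (𝓝 p)) {L C η r : ℝ} (hr : 0 < r)
    (hL : ∀ k, ‖u (k + 1) - p‖ ≤ L * ‖u k - p‖) (hC : ∀ k, t (k + 1) ≤ C * ‖u k - p‖ ^ 2)
    (hη : ∀ v, ‖v - p‖ ≤ r → Metric.infDist v Ω ≤ η * ρ v) :
    ∃ C > (0 : ℝ), ∃ μ : ℝ, 0 < μ ∧ μ < 1 ∧ ∀ k m : ℕ, ‖u (k + m) - p‖ ≤ C * μ ^ m * ‖u k - p‖ := by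
  obtain ⟨K, hK⟩ : ∃ K, ∀ k, K ≤ k → ‖u k - p‖ ≤ r := by
    obtain ⟨K, hK⟩ := Metric.tendsto_atTop.1 hlim r hr
    exact ⟨K, fun k hk => by rw [← dist_eq_norm]; exact (hK k hk).le⟩
  set M : ℝ := max (c₂ * η ^ 2) 1 / κ with hM
  have hM0 : 0 < M := div_pos (lt_max_of_lt_right one_pos) h.κ_pos
  set q : ℝ := M / (1 + M) with hq
  have hq0 : 0 < q := by positivity
  have hq1 : q < 1 := by rw [hq, div_lt_one (by positivity)]; linarith
  have hqM : ∀ a b : ℝ, a ≤ M * (b - a) → a ≤ q * b := by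
    intro a b hab
    rw [hq, div_mul_eq_mul_div, le_div_iff₀ (by positivity)]
    linarith
  -- The Euclidean nearest point need not be nearest for n. Keeping whichever of it and v has the
  -- smaller new value avoids a distance to Ω in the n-metric, and a ≤ M(b - a) becomes a ≤ qb.
  have hstep : ∀ k, 1 ≤ k → K ≤ k → ∀ v ∈ Ω, ∃ v' ∈ Ω,
      n (u (k + 1) - v') + t (k + 1) ≤ q * (n (u k - v) + t k) := by
    intro k hk hKk v hv
    obtain ⟨v', hv', hd⟩ := hΩ.exists_infDist_eq_dist ⟨p, hp⟩ (u (k + 1))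
    have h1 := hη _ (hK (k + 1) (by omega))
    rw [hd, dist_eq_norm] at h1
    have h2 : ‖u (k + 1) - v'‖ ^ 2 ≤ η ^ 2 * ρ (u (k + 1)) ^ 2 := by
      rw [← mul_pow]; exact pow_le_pow_left₀ (norm_nonneg _) h1 2
    have h3 := h.decrease k hk v hv
    -- No sign of c₂ is assumed; the bounds on n force one unless the norm vanishes.
    have hc₂ : 0 ≤ c₂ ∨ ‖u (k + 1) - v'‖ ^ 2 = 0 := by
      rcases eq_or_lt_of_le (sq_nonneg ‖u (k + 1) - v'‖) with h0 | h0
      · exact Or.inr h0.symm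
      · left
        have h4 := (h.lower (u (k + 1) - v')).trans (h.upper _)
        exact h.c₁_pos.le.trans (le_of_mul_le_mul_right h4 h0)
    have hm1 := le_max_left (c₂ * η ^ 2) 1
    have hm2 := le_max_right (c₂ * η ^ 2) 1
    have h4 : n (u (k + 1) - v') ≤ max (c₂ * η ^ 2) 1 * ρ (u (k + 1)) ^ 2 := by
      refine (h.upper _).trans ?_
      rcases hc₂ with h0 | h0
      · have := mul_le_mul_of_nonneg_left h2 h0
        have := mul_le_mul_of_nonneg_right hm1 (sq_nonneg (ρ (u (k + 1))))
        linarith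
      · rw [h0, mul_zero]; positivity
    have h5 : n (u (k + 1) - v') + t (k + 1) ≤ M * (κ * (ρ (u (k + 1)) ^ 2 + t (k + 1))) := by
      have e : M * (κ * (ρ (u (k + 1)) ^ 2 + t (k + 1))) =
          max (c₂ * η ^ 2) 1 * (ρ (u (k + 1)) ^ 2 + t (k + 1)) := by
        rw [hM]; have := h.κ_pos.ne'; field_simp
      rw [e, mul_add]
      nlinarith [h.t_nonneg (k + 1)]
    have h6 : n (u (k + 1) - v') + t (k + 1) ≤
        M * ((n (u k - v) + t k) - (n (u (k + 1) - v) + t (k + 1))) :=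
      h5.trans (mul_le_mul_of_nonneg_left (by linarith) hM0.le)
    rcases le_total (n (u (k + 1) - v) + t (k + 1)) (n (u (k + 1) - v') + t (k + 1)) with h7 | h7
    · exact ⟨v, hv, hqM _ _ (h7.trans h6)⟩
    · refine ⟨v', hv', hqM _ _ (h6.trans (mul_le_mul_of_nonneg_left (by linarith) hM0.le))⟩
  have hiter : ∀ k, 1 ≤ k → K ≤ k → ∀ m, ∃ v ∈ Ω,
      n (u (k + m) - v) + t (k + m) ≤ q ^ m * (n (u k - p) + t k) := by
    intro k hk hKk m
    induction m with
    | zero => exact ⟨p, hp, by simp⟩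
    | succ m ih =>
      obtain ⟨v, hv, h1⟩ := ih
      obtain ⟨v', hv', h2⟩ := hstep (k + m) (by omega) (by omega) v hv
      refine ⟨v', hv', h2.trans ?_⟩
      rw [pow_succ' q m, mul_assoc]
      exact mul_le_mul_of_nonneg_left h1 hq0.le
  set L' : ℝ := max L 1 with hL'
  have hL1 : 1 ≤ L' := le_max_right _ _
  have hLm : ∀ k m, ‖u (k + m) - p‖ ≤ L' ^ m * ‖u k - p‖ := by
    intro k m
    induction m with
    | zero => simp
    | succ m ih =>
      refine (hL (k + m)).trans ?_
      rw [pow_succ' L' m, mul_assoc]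
      exact mul_le_mul (le_max_left _ _) ih (norm_nonneg _) (by linarith)
  set C' : ℝ := 4 / c₁ * (|c₂| * L' ^ 2 + |C|) with hC'
  have hc₁ := h.c₁_pos
  have hC'0 : 0 ≤ C' := by positivity
  -- Contraction starts at k + 1 but is compared with the error at k, since the correction t (k + 1)
  -- is controlled only by the preceding error.
  have hmain : ∀ k, K ≤ k → ∀ m, ‖u (k + 1 + m) - p‖ ^ 2 ≤ C' * q ^ m * ‖u k - p‖ ^ 2 := by
    intro k hk m
    obtain ⟨v, hv, h1⟩ := hiter (k + 1) (by omega) (by omega) m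
    have h2 := h.norm_sub_limit_le hlim hv (show 1 ≤ k + 1 + m by omega)
    have h3 : n (u (k + 1) - p) + t (k + 1) ≤ (|c₂| * L' ^ 2 + |C|) * ‖u k - p‖ ^ 2 := by
      have e1 := h.upper (u (k + 1) - p)
      have e2 : ‖u (k + 1) - p‖ ^ 2 ≤ L' ^ 2 * ‖u k - p‖ ^ 2 := by
        rw [← mul_pow]
        have := hLm k 1
        rw [pow_one] at this
        exact pow_le_pow_left₀ (norm_nonneg _) this 2
      have e3 : c₂ * ‖u (k + 1) - p‖ ^ 2 ≤ |c₂| * (L' ^ 2 * ‖u k - p‖ ^ 2) :=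
        mul_le_mul (le_abs_self _) e2 (sq_nonneg _) (abs_nonneg _)
      have e4 := hC k
      have e5 := mul_le_mul_of_nonneg_right (le_abs_self C) (sq_nonneg ‖u k - p‖)
      linarith
    have h4 : c₁ * ‖u (k + 1 + m) - p‖ ^ 2 ≤
        4 * (q ^ m * ((|c₂| * L' ^ 2 + |C|) * ‖u k - p‖ ^ 2)) := by
      refine h2.trans (mul_le_mul_of_nonneg_left (h1.trans ?_) (by norm_num))
      exact mul_le_mul_of_nonneg_left h3 (by positivity)
    have h5 : ‖u (k + 1 + m) - p‖ ^ 2 ≤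
        (4 * (q ^ m * ((|c₂| * L' ^ 2 + |C|) * ‖u k - p‖ ^ 2))) / c₁ := by
      rw [le_div_iff₀ hc₁]; linarith
    refine h5.trans (le_of_eq ?_)
    rw [hC']; ring
  set μ : ℝ := √q with hμ
  have hμ0 : 0 < μ := Real.sqrt_pos.2 hq0
  have hμq : μ ^ 2 = q := Real.sq_sqrt hq0.le
  have hμ1 : μ < 1 := by nlinarith
  -- Dividing by μ absorbs the shift by one index; the summand 1 makes D ≥ 1, which is the case m =
  -- 0.
  set D : ℝ := (1 + √C') / μ with hD
  have hD0 : 0 < D := by positivity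
  have hD1 : 1 ≤ D := by
    rw [hD, le_div_iff₀ hμ0]; linarith [Real.sqrt_nonneg C']
  have hfar : ∀ k, K ≤ k → ∀ m, ‖u (k + m) - p‖ ≤ D * μ ^ m * ‖u k - p‖ := by
    intro k hk m
    rcases m with _ | m
    · simpa using mul_le_mul_of_nonneg_right hD1 (norm_nonneg (u k - p))
    · have h1 := hmain k hk m
      have e : C' * q ^ m * ‖u k - p‖ ^ 2 = (√C' * μ ^ m * ‖u k - p‖) ^ 2 := by
        rw [mul_pow, mul_pow, Real.sq_sqrt hC'0, ← pow_mul, mul_comm m 2, pow_mul, hμq]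
      rw [e] at h1
      have h2 := le_of_sq_le_sq h1 (by positivity)
      rw [show k + (m + 1) = k + 1 + m by omega]
      refine h2.trans ?_
      have e2 : D * μ ^ (m + 1) = (1 + √C') * μ ^ m := by
        rw [hD, pow_succ]; field_simp
      rw [e2]
      gcongr
      linarith
  -- The factor L' ^ K / μ ^ K pays for up to K initial steps, during which the error may grow by L'
  -- each time.
  refine ⟨D * L' ^ K / μ ^ K, by positivity, μ, hμ0, hμ1, fun k m => ?_⟩
  rcases le_total m K with hmK | hmK
  · refine (hLm k m).trans (mul_le_mul_of_nonneg_right ?_ (norm_nonneg _))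
    rw [div_mul_eq_mul_div, le_div_iff₀ (by positivity)]
    have e1 : L' ^ m ≤ L' ^ K := pow_le_pow_right₀ hL1 hmK
    have e2 : μ ^ K ≤ μ ^ m := pow_le_pow_of_le_one hμ0.le hμ1.le hmK
    calc L' ^ m * μ ^ K ≤ L' ^ K * μ ^ m := mul_le_mul e1 e2 (by positivity) (by positivity)
      _ ≤ D * L' ^ K * μ ^ m := by
        gcongr
        exact le_mul_of_one_le_left (by positivity) hD1
  · obtain ⟨j, rfl⟩ := Nat.exists_eq_add_of_le hmK
    rw [← add_assoc]
    refine (hfar (k + K) (by omega) j).trans ?_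
    have e : D * L' ^ K / μ ^ K * μ ^ (K + j) = D * μ ^ j * L' ^ K := by
      rw [pow_add]; field_simp
    rw [e, mul_assoc _ (L' ^ K)]
    exact mul_le_mul_of_nonneg_left (hLm k K) (by positivity)

end IsFejer
end Fejer
end BlockAngular

/-! ### The energy and its decrease -/

namespace BlockAngular
namespace Problem

variable {N : ℕ} {X Y : Fin (N + 1) → Type*}
  [∀ i, NormedAddCommGroup (X i)] [∀ i, InnerProductSpace ℝ (X i)]
  [∀ i, FiniteDimensional ℝ (X i)]
  [∀ i, NormedAddCommGroup (Y i)] [∀ i, InnerProductSpace ℝ (Y i)]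
  [∀ i, FiniteDimensional ℝ (Y i)]
  (P : Problem N X Y)

section StateMaps

/-- The coordinates of a state as linear maps. -/
def yL : P.State →ₗ[ℝ] PiLp 2 Y := ⟨⟨State.y, fun _ _ => rfl⟩, fun _ _ => rfl⟩

def wL : P.State →ₗ[ℝ] PiLp 2 X := ⟨⟨fun u => u.w, fun _ _ => rfl⟩, fun _ _ => rfl⟩

def sL : P.State →ₗ[ℝ] PiLp 2 X := ⟨⟨State.s, fun _ _ => rfl⟩, fun _ _ => rfl⟩

def zL : P.State →ₗ[ℝ] PiLp 2 X := ⟨⟨State.z, fun _ _ => rfl⟩, fun _ _ => rfl⟩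

def xL : P.State →ₗ[ℝ] PiLp 2 X := ⟨⟨State.x, fun _ _ => rfl⟩, fun _ _ => rfl⟩

/-- The linear part of `dualRes`. -/
noncomputable def dualLin : P.State →ₗ[ℝ] PiLp 2 X :=
  -(P.bQ ∘ₗ P.wL) + P.Badj ∘ₗ P.yL + P.sL + P.zL

noncomputable def linkL : P.State →ₗ[ℝ] PiLp 2 X :=
  P.AT ∘ₗ LinearMap.proj 0 ∘ₗ (WithLp.linearEquiv 2 ℝ (∀ i, Y i)).toLinearMap ∘ₗ P.yL + P.zL

/-- The `w`-`s` coupling term of the first block. -/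
noncomputable def coupL : P.State →ₗ[ℝ] PiLp 2 X :=
  (P.projD : PiLp 2 X →ₗ[ℝ] PiLp 2 X) ∘ₗ (P.sL - P.bQ ∘ₗ P.wL)

noncomputable def projzL : P.State →ₗ[ℝ] PiLp 2 X := (P.projA : PiLp 2 X →ₗ[ℝ] PiLp 2 X) ∘ₗ P.zL

end StateMaps

theorem dualLin_apply (e : P.State) :
    P.dualLin e = -P.bQ e.w + P.Badj e.y + e.s + e.z := rfl

theorem linkL_apply (e : P.State) : P.linkL e = P.link e := rfl

theorem coupL_apply (e : P.State) : P.coupL e = P.projD (e.s - P.bQ e.w) := rfl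

theorem projzL_apply (e : P.State) : P.projzL e = P.projA e.z := rfl

theorem dualRes_sub (u v : P.State) : P.dualRes u - P.dualRes v = P.dualLin (u - v) := by
  rw [map_sub, dualLin_apply, dualLin_apply, dualRes, dualRes]
  abel

theorem projD_inner (x y : PiLp 2 X) :
    inner ℝ (P.projD x) (P.projD y) = inner ℝ x (P.projD y) := by
  rw [projD, Submodule.inner_starProjection_left_eq_right,
    Submodule.starProjection_eq_self_iff.2 (Submodule.starProjection_apply_mem _ _)]

theorem projA_inner (x y : PiLp 2 X) :
    inner ℝ (P.projA x) (P.projA y) = inner ℝ x (P.projA y) := by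
  rw [projA, Submodule.inner_starProjection_left_eq_right,
    Submodule.starProjection_eq_self_iff.2 (Submodule.starProjection_apply_mem _ _)]

theorem dualRes_eq_zero_of_mem {p : P.State} (hp : p ∈ P.kktSet) : P.dualRes p = 0 :=
  sub_eq_zero.2 (P.mem_kktSet_iff.1 hp).2.2.1

theorem dualRes_eq_of_mem {p : P.State} (hp : p ∈ P.kktSet) (u : P.State) :
    P.dualRes u = P.dualLin (u - p) := by
  rw [← dualRes_sub, P.dualRes_eq_zero_of_mem hp, sub_zero]

variable {P}
variable {σ τ : ℝ} {u v p : P.State}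

/-- Monotonicity between the first block of a step and a KKT point. -/
theorem IsOptimalStep.first_block (h : P.IsOptimalStep σ τ u v) (hp : p ∈ P.kktSet) :
    inner ℝ (P.dualLin (v - p) - P.linkL (v - p)) ((u - p).x +
        σ • (P.dualLin (v - p) - (P.linkL (v - p) - P.linkL (u - p)))) +
      σ * inner ℝ (v - p).s (P.resolv σ (v - u).s) +
      σ * inner ℝ (P.coupL (v - p)) (P.coupL (v - u)) ≤ 0 := by
  obtain ⟨hB, hQ, -, hs, -⟩ := P.mem_kktSet_iff.1 hp
  set E := u.x + σ • (P.dualRes v - (P.link v - P.link u)) with hE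
  have hEp : E - p.x = (u - p).x +
      σ • (P.dualLin (v - p) - (P.linkL (v - p) - P.linkL (u - p))) := by
    rw [← P.dualRes_eq_of_mem hp, ← map_sub, sub_sub_sub_cancel_right, map_sub, linkL_apply,
      linkL_apply, hE]
    change _ = u.x - p.x + _
    abel
  have h1 := h.s_subgrad.monotone hs
  have hc : P.projD ((v.s - u.s) - P.bQ (v.w - u.w)) = P.coupL (v - u) := rfl
  rw [hc] at h1
  -- For the `w` block, positivity of Q plays the role of monotonicity; the optimality condition
  -- rewrites one factor through the multiplier estimate.
  have h2 := P.bQ_nonneg (v - p).w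
  have hQw : P.bQ (v - p).w = P.bQ (E - p.x + σ • P.coupL (v - u)) := by
    change P.bQ ((v.w : PiLp 2 X) - p.w) = _
    rw [map_sub, hQ, h.w_eq, hc, ← map_sub]
    refine congrArg P.bQ ?_
    rw [hE]
    abel
  rw [hQw, ← bQ_inner] at h2
  have h3 : inner ℝ (P.DT (v - p).y) (E - p.x) = 0 := by
    refine P.DT_inner_eq_zero (fun i hi => ?_) _
    rw [PiLp.sub_apply, map_sub, h.y_eq i hi, ← P.B_apply_of_ne _ hi, hB, sub_self]
  have h4 : P.dualLin (v - p) - P.linkL (v - p) =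
      -P.bQ (v - p).w + P.DT (v - p).y + (v - p).s := by
    rw [dualLin_apply, linkL_apply, link, Badj_eq]
    abel
  have h5 : inner ℝ (P.coupL (v - p)) (P.coupL (v - u)) =
      inner ℝ ((v - p).s - P.bQ (v - p).w) (P.coupL (v - u)) := by
    rw [coupL_apply, coupL_apply, projD_inner]
  rw [← hEp, h4, h5]
  have e1 : -v.s - -p.s = -(v - p).s := by
    change _ = -(v.s - p.s); abel
  have e2 : E + σ • (P.resolv σ (v.s - u.s) + P.coupL (v - u)) - p.x =
      (E - p.x) + σ • P.resolv σ (v - u).s + σ • P.coupL (v - u) := by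
    change _ = (E - p.x) + σ • P.resolv σ (v.s - u.s) + _
    module
  rw [e1, e2] at h1
  simp only [inner_add_left, inner_add_right, inner_sub_left, inner_neg_left,
    inner_smul_right] at h1 h2 ⊢
  linarith

/-- Monotonicity between the second block of a step and a KKT point. -/
theorem IsOptimalStep.second_block (h : P.IsOptimalStep σ τ u v) (hp : p ∈ P.kktSet) :
    inner ℝ (P.linkL (v - p)) ((u - p).x + σ • P.dualLin (v - p)) +
      σ * inner ℝ (P.projzL (v - p)) (P.projzL (v - u)) ≤ 0 := by
  obtain ⟨hB, -, -, -, hz⟩ := P.mem_kktSet_iff.1 hp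
  rw [← P.dualRes_eq_of_mem hp]
  have h1 := h.z_subgrad.monotone hz
  have h2 : inner ℝ (P.AT ((v - p).y 0)) ((u - p).x + σ • P.dualRes v) = 0 := by
    rw [AT_inner]
    have e : (u - p).x + σ • P.dualRes v = (u.x + σ • P.dualRes v) - p.x := by
      change u.x - p.x + _ = _; abel
    rw [e, map_sub, h.y₀_eq, ← B_apply_zero, hB, sub_self, inner_zero_right]
  have e1 : -v.z - -p.z = -(v - p).z := by
    change _ = -(v.z - p.z); abel
  have e2 : u.x + σ • P.dualRes v + σ • P.projA (v.z - u.z) - p.x =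
      ((u - p).x + σ • P.dualRes v) + σ • P.projzL (v - u) := by
    change _ = u.x - p.x + _ + σ • P.projA (v.z - u.z); abel
  have e3 : inner ℝ (P.projzL (v - p)) (P.projzL (v - u)) =
      inner ℝ (v - p).z (P.projzL (v - u)) := by
    rw [projzL_apply, projzL_apply, projA_inner]
  have e4 : P.linkL (v - p) = P.AT ((v - p).y 0) + (v - p).z := rfl
  rw [e1, e2] at h1
  rw [e3, e4, inner_add_left, h2]
  simp only [inner_add_right, inner_neg_left, inner_smul_right] at h1 ⊢
  linarith

/-- Monotonicity between the second blocks of two consecutive steps. -/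
theorem IsOptimalStep.consecutive {u' : P.State} (h' : P.IsOptimalStep σ τ u' u)
    (h : P.IsOptimalStep σ τ u v) :
    σ * inner ℝ (P.linkL (v - u)) (P.dualRes v - (1 - τ) • P.dualRes u) +
      σ * inner ℝ (P.projzL (v - u)) (P.projzL (v - u) - P.projzL (u - u')) ≤ 0 := by
  have h1 := h.z_subgrad.monotone h'.z_subgrad
  have e0 : u.x = u'.x + (τ * σ) • P.dualRes u := h'.x_eq
  have e1 : -v.z - -u.z = -(v - u).z := by
    change _ = -(v.z - u.z); abel
  -- The multiplier update replaces the difference of the two `x` parts by τσ times the old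
  -- residual, which is where the factor 1 - τ comes from.
  have e2 : u.x + σ • P.dualRes v + σ • P.projA (v.z - u.z) -
      (u'.x + σ • P.dualRes u + σ • P.projA (u.z - u'.z)) =
      σ • (P.dualRes v - (1 - τ) • P.dualRes u) +
        σ • (P.projzL (v - u) - P.projzL (u - u')) := by
    change _ = _ + σ • (P.projA (v.z - u.z) - P.projA (u.z - u'.z))
    rw [e0]; module
  have h2 : inner ℝ (P.AT ((v - u).y 0)) (σ • (P.dualRes v - (1 - τ) • P.dualRes u)) = 0 := by
    have e : σ • (P.dualRes v - (1 - τ) • P.dualRes u) =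
        (u.x + σ • P.dualRes v) - (u'.x + σ • P.dualRes u) := by
      rw [e0]; module
    rw [AT_inner, e, map_sub, h.y₀_eq, h'.y₀_eq, sub_self, inner_zero_right]
  have e3 : inner ℝ (P.projzL (v - u)) (P.projzL (v - u) - P.projzL (u - u')) =
      inner ℝ (v - u).z (P.projzL (v - u) - P.projzL (u - u')) := by
    rw [← map_sub, projzL_apply, projzL_apply, projA_inner]
  have e4 : P.linkL (v - u) = P.AT ((v - u).y 0) + (v - u).z := rfl
  rw [e1, e2] at h1
  rw [e3, ← inner_smul_right (P.linkL (v - u)), e4, inner_add_left, h2]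
  simp only [inner_add_right, inner_neg_left, inner_smul_right] at h1 ⊢
  linarith

variable (P) (σ τ)

/-- The quadratic form measuring the distance to a KKT point. -/
noncomputable def energy (a : ℝ) (e : P.State) : ℝ :=
  (τ * σ)⁻¹ * ‖e.x‖ ^ 2 + σ * ‖P.linkL e‖ ^ 2 + σ * inner ℝ e.s (P.resolv σ e.s) +
    σ * ‖P.coupL e‖ ^ 2 + σ * ‖P.projzL e‖ ^ 2 + a * σ * ‖P.dualLin e‖ ^ 2

/-- The decrease of the energy in one step. -/
noncomputable def decr (u v : P.State) : ℝ :=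
  ‖P.dualRes v‖ ^ 2 + ‖P.linkL (v - u)‖ ^ 2 + inner ℝ (v - u).s (P.resolv σ (v - u).s) +
    ‖P.coupL (v - u)‖ ^ 2

variable {P σ τ}

theorem two_mul_inner_sub {E : Type*} [NormedAddCommGroup E] [InnerProductSpace ℝ E] (a b : E) :
    2 * inner ℝ a (a - b) = ‖a‖ ^ 2 - ‖b‖ ^ 2 + ‖a - b‖ ^ 2 := by
  rw [norm_sub_sq_real, inner_sub_right, real_inner_self_eq_norm_sq]
  ring

theorem IsOptimalStep.energy_le {u' : P.State} (hσ : 0 < σ) (hτ : 0 < τ) {a α : ℝ} (ha : 0 < a)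
    (hα1 : α ≤ 1) (haα : (1 - τ) ^ 2 ≤ a * (1 - α)) (haα' : a + α ≤ 2 - τ)
    (h' : P.IsOptimalStep σ τ u' u) (h : P.IsOptimalStep σ τ u v) (hp : p ∈ P.kktSet) :
    P.energy σ τ a (v - p) + σ * ‖P.projzL (v - u)‖ ^ 2 +
      σ * (α * P.decr σ u v + ‖P.projzL (v - u)‖ ^ 2) ≤
    P.energy σ τ a (u - p) + σ * ‖P.projzL (u - u')‖ ^ 2 := by
  have hI := h.first_block hp
  have hII := h.second_block hp
  have hIII := h'.consecutive h
  have hv := P.dualRes_eq_of_mem hp v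
  have hu := P.dualRes_eq_of_mem hp u
  set r := P.dualRes v with hr
  set r₀ := P.dualRes u with hr₀
  have evu : v - u = (v - p) - (u - p) := by abel
  set g := P.linkL (v - u) with hg
  have hg' : P.linkL (v - p) - P.linkL (u - p) = g := by rw [hg, ← map_sub, ← evu]
  have hcoup : 2 * inner ℝ (P.coupL (v - p)) (P.coupL (v - u)) =
      ‖P.coupL (v - p)‖ ^ 2 - ‖P.coupL (u - p)‖ ^ 2 + ‖P.coupL (v - u)‖ ^ 2 := by
    rw [evu, map_sub P.coupL (v - p)]; exact two_mul_inner_sub _ _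
  have hprz : 2 * inner ℝ (P.projzL (v - p)) (P.projzL (v - u)) =
      ‖P.projzL (v - p)‖ ^ 2 - ‖P.projzL (u - p)‖ ^ 2 + ‖P.projzL (v - u)‖ ^ 2 := by
    rw [evu, map_sub P.projzL (v - p)]; exact two_mul_inner_sub _ _
  have hres : 2 * inner ℝ (v - p).s (P.resolv σ (v - u).s) =
      inner ℝ (v - p).s (P.resolv σ (v - p).s) - inner ℝ (u - p).s (P.resolv σ (u - p).s) +
        inner ℝ (v - u).s (P.resolv σ (v - u).s) := by
    have e : (v - u).s = (v - p).s - (u - p).s := by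
      change v.s - u.s = (v.s - p.s) - (u.s - p.s); abel
    have e1 := P.resolv_inner hσ (u - p).s (v - p).s
    have e2 := real_inner_comm (P.resolv σ (u - p).s) (v - p).s
    rw [e, map_sub]
    simp only [inner_sub_left, inner_sub_right]
    linarith
  have hlink : 2 * inner ℝ (P.linkL (v - p)) g =
      ‖P.linkL (v - p)‖ ^ 2 - ‖P.linkL (u - p)‖ ^ 2 + ‖g‖ ^ 2 := by
    rw [← hg']; exact two_mul_inner_sub _ _
  have hx : (τ * σ)⁻¹ * ‖(v - p).x‖ ^ 2 =
      (τ * σ)⁻¹ * ‖(u - p).x‖ ^ 2 + 2 * inner ℝ r (u - p).x + τ * σ * ‖r‖ ^ 2 := by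
    have e : (v - p).x = (u - p).x + (τ * σ) • r := by
      change v.x - p.x = (u.x - p.x) + _
      rw [h.x_eq]; abel
    rw [e, norm_add_smul_sq, real_inner_comm r]
    field_simp
  have hprz2 := two_mul_inner_sub (P.projzL (v - u)) (P.projzL (u - u'))
  have hprz3 := sq_nonneg ‖P.projzL (v - u) - P.projzL (u - u')‖
  rw [hg', ← hv] at hI
  rw [← hv] at hII
  simp only [inner_add_right, inner_sub_left, inner_sub_right, inner_smul_right,
    real_inner_self_eq_norm_sq] at hI hII hIII hprz2
  -- The old-residual part is paid by the term aσ‖dualRes‖² of the old energy, and the rest by a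
  -- fraction 1 - α of the gain in ‖g‖².
  have hcs : 2 * ((1 - τ) * inner ℝ g r₀) ≤ a * ‖r₀‖ ^ 2 + (1 - α) * ‖g‖ ^ 2 := by
    have h1 : 0 ≤ ‖a • r₀ - (1 - τ) • g‖ ^ 2 := sq_nonneg _
    rw [norm_sub_sq_real, norm_smul, norm_smul, mul_pow, mul_pow, Real.norm_eq_abs,
      Real.norm_eq_abs, sq_abs, sq_abs, inner_smul_left, inner_smul_right,
      real_inner_comm g r₀] at h1
    simp only [conj_trivial] at h1
    have h2 := mul_le_mul_of_nonneg_right haα (sq_nonneg ‖g‖)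
    have h3 : 0 ≤ a * (a * ‖r₀‖ ^ 2 + (1 - α) * ‖g‖ ^ 2 - 2 * ((1 - τ) * inner ℝ g r₀)) := by
      linarith
    linarith [nonneg_of_mul_nonneg_right h3 ha]
  have hcs' := mul_le_mul_of_nonneg_left hcs hσ.le
  have haα'' := mul_le_mul_of_nonneg_right haα' (mul_nonneg hσ.le (sq_nonneg ‖r‖))
  have hSnn : 0 ≤ (1 - α) * (σ * (inner ℝ (v - u).s (P.resolv σ (v - u).s) +
      ‖P.coupL (v - u)‖ ^ 2)) := by
    have := (sq_nonneg _).trans (P.norm_resolv_sq_le hσ (v - u).s)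
    have : 0 ≤ 1 - α := by linarith
    positivity
  rw [energy, energy, decr, hx, ← hv, ← hu, ← hg, ← hr]
  have hgr := real_inner_comm g r
  have e1 := congrArg (σ * ·) hcoup
  have e2 := congrArg (σ * ·) hprz
  have e3 := congrArg (σ * ·) hres
  have e4 := congrArg (σ * ·) hlink
  have e5 := congrArg (σ * ·) hprz2
  have e6 := mul_nonneg hσ.le hprz3
  have e7 := congrArg (σ * ·) hgr
  linarith

end Problem
end BlockAngular

/-! ### Error estimates: residual, definiteness and one-step growth -/

namespace BlockAngular

theorem IsProperClosedConvex.norm_sub_prox_le {E : Type*} [NormedAddCommGroup E]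
    [InnerProductSpace ℝ E] [FiniteDimensional ℝ E] {f : E → EReal} (hf : IsProperClosedConvex f)
    {x s : E} (h : IsSubgrad f x (-s)) (x' : E) : ‖x' - prox f (x' - s)‖ ≤ 2 * ‖x' - x‖ := by
  rw [hf.isSubgrad_iff_prox_eq, ← sub_eq_add_neg] at h
  have h1 := hf.norm_prox_sub_prox_le (x - s) (x' - s)
  rw [h, sub_sub_sub_cancel_right, norm_sub_rev x x'] at h1
  have h2 := norm_add_le (x' - x) (x - prox f (x' - s))
  rw [sub_add_sub_cancel] at h2
  linarith

theorem exists_norm_map_le {E F : Type*} [NormedAddCommGroup E] [NormedSpace ℝ E]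
    [FiniteDimensional ℝ E] [NormedAddCommGroup F] [NormedSpace ℝ F] (L : E →ₗ[ℝ] F) :
    ∃ C : ℝ, 0 ≤ C ∧ ∀ x, ‖L x‖ ≤ C * ‖x‖ :=
  ⟨‖LinearMap.toContinuousLinearMap L‖, norm_nonneg _,
    fun x => (LinearMap.toContinuousLinearMap L).le_opNorm x⟩

theorem norm_withLp_prod_le {E F : Type*} [NormedAddCommGroup E] [NormedAddCommGroup F]
    (p : WithLp 2 (E × F)) : ‖p‖ ≤ ‖p.fst‖ + ‖p.snd‖ := by
  have h := WithLp.prod_norm_sq_eq_of_L2 p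
  nlinarith [norm_nonneg p, norm_nonneg p.fst, norm_nonneg p.snd]

/-- The bound on τ is equivalent, for τ > 0, to (1 - τ)² < 2 - τ. Any a strictly between the two
sides leaves room for a small α; the midpoint is taken. -/
theorem exists_steplength_constants {τ : ℝ} (hτ : 0 < τ) (hτ' : τ < (1 + √5) / 2) :
    ∃ a α : ℝ, 0 < a ∧ 0 < α ∧ α ≤ 1 ∧ (1 - τ) ^ 2 ≤ a * (1 - α) ∧ a + α ≤ 2 - τ := by
  have h5 : √5 ^ 2 = 5 := Real.sq_sqrt (by norm_num)
  have h5' : 1 < √5 := by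
    rw [Real.lt_sqrt (by norm_num)]; norm_num
  have h1 : (1 - τ) ^ 2 < 2 - τ := by
    nlinarith [mul_pos (show 0 < √5 - (2 * τ - 1) by linarith)
      (show 0 < √5 + (2 * τ - 1) by linarith)]
  set a := ((1 - τ) ^ 2 + (2 - τ)) / 2 with ha
  have ha0 : 0 < a := by nlinarith [sq_nonneg (1 - τ)]
  have ha1 : (1 - τ) ^ 2 < a := by linarith
  have h2 : (1 - τ) ^ 2 / a < 1 := (div_lt_one ha0).2 ha1
  have h3 : 0 ≤ (1 - τ) ^ 2 / a := by positivity
  have hm1 := min_le_left (1 - (1 - τ) ^ 2 / a) (2 - τ - a)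
  have hm2 := min_le_right (1 - (1 - τ) ^ 2 / a) (2 - τ - a)
  refine ⟨a, min (1 - (1 - τ) ^ 2 / a) (2 - τ - a), ha0, lt_min (by linarith) (by linarith),
    by linarith, ?_, by linarith⟩
  have h4 : a * ((1 - τ) ^ 2 / a) = (1 - τ) ^ 2 := by field_simp
  nlinarith

theorem sq_sum_five_le (a b c d e : ℝ) :
    (a + b + c + d + e) ^ 2 ≤ 5 * (a ^ 2 + b ^ 2 + c ^ 2 + d ^ 2 + e ^ 2) := by
  nlinarith [sq_nonneg (a - b), sq_nonneg (a - c), sq_nonneg (a - d), sq_nonneg (a - e),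
    sq_nonneg (b - c), sq_nonneg (b - d), sq_nonneg (b - e), sq_nonneg (c - d),
    sq_nonneg (c - e), sq_nonneg (d - e)]

namespace Problem

variable {N : ℕ} {X Y : Fin (N + 1) → Type*}
  [∀ i, NormedAddCommGroup (X i)] [∀ i, InnerProductSpace ℝ (X i)]
  [∀ i, FiniteDimensional ℝ (X i)]
  [∀ i, NormedAddCommGroup (Y i)] [∀ i, InnerProductSpace ℝ (Y i)]
  [∀ i, FiniteDimensional ℝ (Y i)]
  (P : Problem N X Y)

/-- Shortcut instance. -/
noncomputable instance instNormedSpaceState : NormedSpace ℝ P.State :=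
  WithLp.instProdNormedSpace 2 ℝ (PiLp 2 Y)
    (WithLp 2 (P.W × WithLp 2 (PiLp 2 X × WithLp 2 (PiLp 2 X × PiLp 2 X))))

theorem norm_mkState_le (y : PiLp 2 Y) (w : P.W) (s z x : PiLp 2 X) :
    ‖P.mkState y w s z x‖ ≤ ‖y‖ + (‖w‖ + (‖s‖ + (‖z‖ + ‖x‖))) :=
  (norm_withLp_prod_le _).trans (add_le_add_right ((norm_withLp_prod_le _).trans
    (add_le_add_right ((norm_withLp_prod_le _).trans
      (add_le_add_right (norm_withLp_prod_le _) _)) _)) _)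

theorem continuous_residual : Continuous P.residual := by
  have hx : Continuous fun u : P.State => u.x := P.xL.continuous_of_finiteDimensional
  have hs : Continuous fun u : P.State => u.s := P.sL.continuous_of_finiteDimensional
  have hz : Continuous fun u : P.State => u.z := P.zL.continuous_of_finiteDimensional
  have hy : Continuous fun u : P.State => u.y := P.yL.continuous_of_finiteDimensional
  have hw : Continuous fun u : P.State => (u.w : PiLp 2 X) := P.wL.continuous_of_finiteDimensional
  have hB := P.B.continuous_of_finiteDimensional
  have hBa := P.Badj.continuous_of_finiteDimensional
  have hQ := P.bQ.continuous_of_finiteDimensional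
  have hQr := P.bQ.rangeRestrict.continuous_of_finiteDimensional
  have hproj : proj P.bK = prox (ind P.bK) :=
    funext (proj_eq_prox_ind P.bK_nonempty P.bK_closed P.bK_convex)
  unfold residual mkState
  rw [hproj]
  have hθ := P.bθ_pcc.continuous_prox
  have hK := P.ind_bK_pcc.continuous_prox
  refine (WithLp.prod_continuous_toLp 2 _ _).comp (Continuous.prodMk (by fun_prop)
    ((WithLp.prod_continuous_toLp 2 _ _).comp (Continuous.prodMk (by fun_prop)
      ((WithLp.prod_continuous_toLp 2 _ _).comp (Continuous.prodMk (by fun_prop)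
        ((WithLp.prod_continuous_toLp 2 _ _).comp (Continuous.prodMk ?_ ?_)))))))
  · exact hx.sub (hθ.comp (hx.sub hs))
  · exact hx.sub (hK.comp (hx.sub hz))

theorem isClosed_kktSet : IsClosed P.kktSet := isClosed_eq P.continuous_residual continuous_const

theorem Badj_injective (hB : Function.Surjective P.B) {y : PiLp 2 Y} (h : P.Badj y = 0) :
    y = 0 := by
  obtain ⟨x, hx⟩ := hB y
  have := P.Badj_inner y x
  rw [h, hx, inner_zero_left] at this
  exact inner_self_eq_zero.1 this.symm

section Energy

variable {σ τ : ℝ}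

theorem continuous_state_maps (P : Problem N X Y) : (Continuous fun u : P.State => u.x) ∧
    (Continuous fun u : P.State => u.s) ∧ Continuous P.linkL ∧ Continuous P.coupL ∧
    Continuous P.projzL ∧ Continuous P.dualLin ∧
    Continuous fun u : P.State => P.resolv σ u.s :=
  ⟨P.xL.continuous_of_finiteDimensional, P.sL.continuous_of_finiteDimensional,
    P.linkL.continuous_of_finiteDimensional, P.coupL.continuous_of_finiteDimensional,
    P.projzL.continuous_of_finiteDimensional, P.dualLin.continuous_of_finiteDimensional,
    (P.resolv σ ∘ₗ P.sL).continuous_of_finiteDimensional⟩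

theorem continuous_energy (a : ℝ) : Continuous (P.energy σ τ a) := by
  obtain ⟨h1, h2, h3, h4, h5, h6, h7⟩ := P.continuous_state_maps (σ := σ)
  unfold energy
  fun_prop

theorem energy_smul (a t : ℝ) (e : P.State) :
    P.energy σ τ a (t • e) = t ^ 2 * P.energy σ τ a e := by
  have hx : (t • e).x = t • e.x := rfl
  have hs : (t • e).s = t • e.s := rfl
  simp only [energy, hx, hs, map_smul, norm_smul, inner_smul_left, inner_smul_right, mul_pow,
    Real.norm_eq_abs, sq_abs, conj_trivial]
  ring

theorem resolv_nonneg (hσ : 0 < σ) (s : PiLp 2 X) : 0 ≤ inner ℝ s (P.resolv σ s) :=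
  (sq_nonneg _).trans (P.norm_resolv_sq_le hσ s)

/-- If the energy vanishes, z = -A*y₀ lies in the range of A* and is killed by the projection onto
it, so z = 0 and A*y₀ = 0; likewise s - Qw = -D*y = 0. Injectivity of B* gives y = 0, while Qs = 0
and s = Qw give s = 0, and then w = 0 because w lies in the range of Q. -/
theorem energy_pos (hB : Function.Surjective P.B) (hσ : 0 < σ) (hτ : 0 < τ) {a : ℝ} (ha : 0 < a)
    (e : P.State) (he : e ≠ 0) : 0 < P.energy σ τ a e := by
  by_contra hle
  push Not at hle
  apply he
  have t1 : 0 ≤ (τ * σ)⁻¹ * ‖e.x‖ ^ 2 := by positivity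
  have t2 : 0 ≤ σ * ‖P.linkL e‖ ^ 2 := by positivity
  have t3 : 0 ≤ σ * inner ℝ e.s (P.resolv σ e.s) := mul_nonneg hσ.le (P.resolv_nonneg hσ _)
  have t4 : 0 ≤ σ * ‖P.coupL e‖ ^ 2 := by positivity
  have t5 : 0 ≤ σ * ‖P.projzL e‖ ^ 2 := by positivity
  have t6 : 0 ≤ a * σ * ‖P.dualLin e‖ ^ 2 := by positivity
  rw [energy] at hle
  have hz : ∀ {c : ℝ} {v : PiLp 2 X}, 0 < c → c * ‖v‖ ^ 2 ≤ 0 → v = 0 := by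
    intro c v hc hcv
    have : ‖v‖ ^ 2 ≤ 0 := nonpos_of_mul_nonpos_right hcv hc
    exact norm_eq_zero.1 (pow_eq_zero_iff two_ne_zero |>.1 (le_antisymm this (sq_nonneg _)))
  have x0 : e.x = 0 := hz (c := (τ * σ)⁻¹) (by positivity) (by linarith)
  have l0 : P.linkL e = 0 := hz hσ (by linarith)
  have c0 : P.coupL e = 0 := hz hσ (by linarith)
  have p0 : P.projzL e = 0 := hz hσ (by linarith)
  have d0 : P.dualLin e = 0 := hz (c := a * σ) (by positivity) (by linarith)
  have r0 : P.resolv σ e.s = 0 := by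
    refine hz hσ (le_trans (mul_le_mul_of_nonneg_left (P.norm_resolv_sq_le hσ e.s) hσ.le) ?_)
    linarith
  have Qs0 := P.bQ_eq_zero_of_resolv_eq_zero hσ r0
  have hl : P.AT (e.y 0) + e.z = 0 := l0
  have hz1 : e.z = P.AT (-(e.y 0)) := by rw [map_neg]; exact eq_neg_of_add_eq_zero_right hl
  have z0 : e.z = 0 := by
    rw [projzL_apply, projA, Submodule.starProjection_eq_self_iff.2 (hz1 ▸ LinearMap.mem_range_self _ _)] at p0
    exact p0
  have A0 : P.AT (e.y 0) = 0 := by rw [z0, add_zero] at hl; exact hl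
  have hd : P.DT (-e.y) = e.s - P.bQ e.w := by
    rw [dualLin_apply, Badj_eq, A0, z0] at d0
    rw [map_neg, neg_eq_iff_add_eq_zero, ← d0]
    abel
  have hD0 : P.DT (-e.y) = 0 := by
    rw [coupL_apply, ← hd, projD,
      Submodule.starProjection_eq_self_iff.2 (LinearMap.mem_range_self _ _)] at c0
    exact c0
  have y0 : e.y = 0 := by
    apply P.Badj_injective hB
    rw [Badj_eq, A0, add_zero]
    simpa using hD0
  have hsQ : e.s = P.bQ e.w := by rw [hD0] at hd; exact sub_eq_zero.1 hd.symm
  have s0 : e.s = 0 := by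
    rw [← inner_self_eq_zero (𝕜 := ℝ)]
    nth_rewrite 1 [hsQ]
    rw [bQ_inner, Qs0, inner_zero_right]
  have w0 : e.w = 0 := by
    obtain ⟨t, ht⟩ := e.w.2
    ext1
    rw [Submodule.coe_zero, ← inner_self_eq_zero (𝕜 := ℝ)]
    nth_rewrite 1 [← ht]
    rw [bQ_inner, ← hsQ, s0, inner_zero_right]
  have : e = P.mkState e.y e.w e.s e.z e.x := rfl
  rw [this, y0, w0, s0, z0, x0]
  rfl

end Energy

section StepBounds

variable {σ τ : ℝ}

theorem decr_nonneg (hσ : 0 < σ) (u v : P.State) : 0 ≤ P.decr σ u v := by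
  have := P.resolv_nonneg hσ (v - u).s
  unfold decr
  positivity

/-- The new iterate satisfies KKT-type conditions with `v.x` replaced by nearby points. The
displacements are linear combinations of five increments whose squares are bounded by the right
side, and the KKT map is Lipschitz in them. -/
theorem exists_residual_bound (hσ : 0 < σ) (τ : ℝ) : ∃ C : ℝ, 0 ≤ C ∧ ∀ u v : P.State,
    P.IsOptimalStep σ τ u v →
      ‖P.residual v‖ ^ 2 ≤ C * (P.decr σ u v + ‖P.projzL (v - u)‖ ^ 2) := by
  obtain ⟨CQ, hCQ0, hCQ⟩ := exists_norm_map_le P.bQ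
  -- The constraints with i ≠ 0 hold exactly at E and the linking constraint at E2, so B is split
  -- into the two corresponding parts.
  set bD : PiLp 2 X →ₗ[ℝ] PiLp 2 Y :=
    { toFun := fun x => WithLp.toLp 2 fun i => P.D i (x i)
      map_add' := fun x x' => by ext i; simp
      map_smul' := fun r x => by ext i; simp } with hbD
  have hBsplit : ∀ x, P.B x = bD x + (P.B - bD) x := fun x => by simp
  have hBD : ∀ x, (P.B - bD) x = WithLp.toLp 2 (Pi.single 0 (P.bA x)) := by
    intro x
    ext i
    rw [LinearMap.sub_apply, PiLp.sub_apply]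
    by_cases hi : i = 0
    · subst hi; simp [B_apply_zero, hbD, P.D_zero]
    · simp [P.B_apply_of_ne x hi, hbD, hi]
  obtain ⟨C1, hC10, hC1⟩ := exists_norm_map_le bD
  obtain ⟨C2, hC20, hC2⟩ := exists_norm_map_le (P.B - bD)
  set κ := |τ * σ - σ| + σ with hκ
  have hκ0 : 0 ≤ κ := by positivity
  have hκσ : σ ≤ κ := by have := abs_nonneg (τ * σ - σ); linarith
  set C0 := (C1 + C2) * κ + (CQ * (2 * κ) + (1 + (2 * (3 * κ) + 2 * (2 * κ)))) with hC0
  have hC00 : 0 ≤ C0 := by positivity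
  refine ⟨5 * C0 ^ 2, by positivity, fun u v h => ?_⟩
  set r := P.dualRes v with hr
  set g := P.linkL (v - u) with hg
  set d := P.coupL (v - u) with hd
  set p := P.projzL (v - u) with hp
  set q := P.resolv σ (v - u).s with hq
  have hgl : P.link v - P.link u = g := (map_sub P.linkL v u).symm
  set T := ‖r‖ + ‖g‖ + ‖q‖ + ‖d‖ + ‖p‖ with hT
  have nr := norm_nonneg r
  have ng := norm_nonneg g
  have nq := norm_nonneg q
  have nd := norm_nonneg d
  have np := norm_nonneg p
  have hT0 : 0 ≤ T := by positivity
  have hTr : ‖r‖ ≤ T := by linarith only [hT, nr, ng, nq, nd, np]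
  have hTg : ‖g‖ ≤ T := by linarith only [hT, nr, ng, nq, nd, np]
  have hTq : ‖q‖ ≤ T := by linarith only [hT, nr, ng, nq, nd, np]
  have hTd : ‖d‖ ≤ T := by linarith only [hT, nr, ng, nq, nd, np]
  have hTp : ‖p‖ ≤ T := by linarith only [hT, nr, ng, nq, nd, np]
  set E := u.x + σ • (r - g) with hE
  set E2 := u.x + σ • r with hE2
  have hx := h.x_eq
  have hy := h.y_eq
  have hw := h.w_eq
  have hs := h.s_subgrad
  have hz := h.z_subgrad
  have hy₀ := h.y₀_eq
  rw [← hr, hgl, ← hE] at hy hw hs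
  rw [← hr, ← hE2] at hz hy₀
  rw [← hr] at hx
  have nσ : ∀ x : PiLp 2 X, ‖σ • x‖ = σ * ‖x‖ := fun x => by
    rw [norm_smul, Real.norm_eq_abs, abs_of_pos hσ]
  have nr' : ‖(τ * σ - σ) • r‖ = |τ * σ - σ| * ‖r‖ := by rw [norm_smul, Real.norm_eq_abs]
  have hxE : ‖v.x - E‖ ≤ κ * T := by
    have e : v.x - E = (τ * σ - σ) • r + σ • g := by rw [hx, hE]; module
    rw [e]
    refine (norm_add_le _ _).trans ?_
    rw [nσ, nr', hκ, add_mul]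
    gcongr
  have hxE2 : ‖v.x - E2‖ ≤ κ * T := by
    have e : v.x - E2 = (τ * σ - σ) • r := by rw [hx, hE2]; module
    rw [e, nr']
    refine mul_le_mul ?_ hTr nr hκ0
    linarith only [hκ, hσ]
  have hσT : ∀ x : PiLp 2 X, ‖x‖ ≤ T → ‖σ • x‖ ≤ κ * T := fun x hxT => by
    rw [nσ]; gcongr
  have b1 : ‖P.B v.x - P.b‖ ≤ (C1 + C2) * κ * T := by
    have hb : P.b = bD E + (P.B - bD) E2 := by
      rw [hBD]
      ext i
      by_cases hi : i = 0
      · subst hi; simp [hbD, P.D_zero, hy₀]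
      · simpa [hbD, hi] using (hy i hi).symm
    have e : P.B v.x - P.b = bD (v.x - E) + (P.B - bD) (v.x - E2) := by
      rw [hb, hBsplit v.x, map_sub, map_sub]; abel
    rw [e]
    refine (norm_add_le _ _).trans ((add_le_add (hC1 _) (hC2 _)).trans ?_)
    linarith only [mul_le_mul_of_nonneg_left hxE hC10, mul_le_mul_of_nonneg_left hxE2 hC20]
  have b2 : ‖P.bQ.rangeRestrict (v.w - v.x)‖ ≤ CQ * (2 * κ) * T := by
    have e : ‖P.bQ.rangeRestrict (v.w - v.x)‖ = ‖P.bQ ((E - v.x) + σ • d)‖ := by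
      change ‖P.bQ ((v.w : PiLp 2 X) - v.x)‖ = _
      rw [map_sub, hw, ← map_sub]
      change ‖P.bQ (E + σ • d - v.x)‖ = _
      congr 2
      abel
    rw [e]
    refine (hCQ _).trans ?_
    rw [mul_assoc]
    refine mul_le_mul_of_nonneg_left ((norm_add_le _ _).trans ?_) hCQ0
    rw [norm_sub_rev]
    linarith only [hσT d hTd, hxE]
  have b4 : ‖v.x - prox P.bθ (v.x - v.s)‖ ≤ 2 * (3 * κ) * T := by
    refine (P.bθ_pcc.norm_sub_prox_le hs v.x).trans ?_
    have e : v.x - (E + σ • (P.resolv σ (v.s - u.s) + P.projD (v.s - u.s - P.bQ (v.w - u.w)))) =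
        (v.x - E) - σ • q - σ • d := by
      change v.x - (E + σ • (q + d)) = _
      module
    rw [e]
    have h1 := norm_sub_le (v.x - E - σ • q) (σ • d)
    have h2 := norm_sub_le (v.x - E) (σ • q)
    linarith only [hσT d hTd, hσT q hTq, h1, h2, hxE]
  have b5 : ‖v.x - proj P.bK (v.x - v.z)‖ ≤ 2 * (2 * κ) * T := by
    rw [proj_eq_prox_ind P.bK_nonempty P.bK_closed P.bK_convex]
    refine (P.ind_bK_pcc.norm_sub_prox_le hz v.x).trans ?_
    have e : v.x - (E2 + σ • P.projA (v.z - u.z)) = (v.x - E2) - σ • p := by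
      change v.x - (E2 + σ • p) = _
      abel
    rw [e]
    have h1 := norm_sub_le (v.x - E2) (σ • p)
    linarith only [hσT p hTp, h1, hxE2]
  have hres : ‖P.residual v‖ ≤ C0 * T := by
    refine (P.norm_mkState_le _ _ _ _ _).trans ?_
    have b3 : ‖-P.bQ v.w + P.Badj v.y + v.s + v.z - P.c‖ ≤ 1 * T := by
      rw [one_mul]; exact hTr
    rw [hC0]
    linarith only [b1, b2, b3, b4, b5]
  have hT2 : T ^ 2 ≤ 5 * (P.decr σ u v + ‖p‖ ^ 2) := by
    have h1 := P.norm_resolv_sq_le hσ (v - u).s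
    rw [decr, ← hr, ← hg, ← hd, hT]
    have h2 := sq_sum_five_le ‖r‖ ‖g‖ ‖q‖ ‖d‖ ‖p‖
    linarith only [h1, h2]
  calc ‖P.residual v‖ ^ 2 ≤ (C0 * T) ^ 2 := pow_le_pow_left₀ (norm_nonneg _) hres 2
    _ = C0 ^ 2 * T ^ 2 := mul_pow _ _ _
    _ ≤ C0 ^ 2 * (5 * (P.decr σ u v + ‖p‖ ^ 2)) := by gcongr
    _ = _ := by ring

set_option maxHeartbeats 800000 in
theorem exists_energy_step_bound (hσ : 0 < σ) (hτ : 0 < τ) {a : ℝ} (ha : 0 < a) :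
    ∃ C : ℝ, 0 < C ∧ ∀ u v p : P.State, P.IsOptimalStep σ τ u v → p ∈ P.kktSet →
      P.energy σ τ a (v - p) ≤ C * ‖u - p‖ ^ 2 := by
  -- ψ₁ bounds what the first block produces; 2ψ₁ + ψ₂ bounds the second block, which starts from
  -- the first one's output. Only the two inequalities against p are used, so no preceding step is
  -- required and the bound holds at k = 0.
  set ψ₁ : P.State → ℝ := fun e => σ⁻¹ * ‖e.x + σ • P.linkL e‖ ^ 2 +
    σ * inner ℝ e.s (P.resolv σ e.s) + σ * ‖P.coupL e‖ ^ 2 with hψ₁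
  set ψ₂ : P.State → ℝ := fun e => 2 * σ⁻¹ * ‖e.x‖ ^ 2 + σ * ‖P.projzL e‖ ^ 2 with hψ₂
  set ψ : P.State → ℝ := fun e => 2 * (τ * σ)⁻¹ * ‖e.x‖ ^ 2 +
    (4 * τ + 2 * a + 1) * (3 * ψ₁ e + ψ₂ e) with hψ
  have hcont : Continuous ψ := by
    obtain ⟨h1, h2, h3, h4, h5, h6, h7⟩ := P.continuous_state_maps (σ := σ)
    simp only [hψ, hψ₁, hψ₂]
    fun_prop
  have hhom : ∀ (t : ℝ) e, ψ (t • e) = t ^ 2 * ψ e := by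
    intro t e
    have hx : (t • e).x = t • e.x := rfl
    have hs : (t • e).s = t • e.s := rfl
    have hxl : t • e.x + σ • t • P.linkL e = t • (e.x + σ • P.linkL e) := by module
    simp only [hψ, hψ₁, hψ₂, hx, hs, map_smul, hxl, norm_smul, inner_smul_left, inner_smul_right,
      mul_pow, Real.norm_eq_abs, sq_abs, conj_trivial]
    ring
  obtain ⟨C, hC0, hC⟩ := exists_quadratic_upper_bound hcont hhom
  refine ⟨C, hC0, fun u v p h hp => le_trans ?_ (hC (u - p))⟩
  have hI := h.first_block hp
  have hII := h.second_block hp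
  have hv := P.dualRes_eq_of_mem hp v
  have hx : (v - p).x = (u - p).x + (τ * σ) • P.dualLin (v - p) := by
    change v.x - p.x = u.x - p.x + _
    rw [h.x_eq, hv]; abel
  have evu : v - u = (v - p) - (u - p) := by abel
  have evus : (v - u).s = (v - p).s - (u - p).s := by
    change v.s - u.s = (v.s - p.s) - (u.s - p.s); abel
  rw [evus, map_sub (P.resolv σ), evu, map_sub P.coupL (v - p) (u - p)] at hI
  rw [evu, map_sub P.projzL (v - p) (u - p)] at hII
  set e := u - p
  set e' := v - p
  set f := P.dualLin e' - P.linkL e' with hf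
  have hdl : P.dualLin e' = f + P.linkL e' := by rw [hf]; abel
  rw [hdl] at hII hx
  have e1 : e.x + σ • (P.dualLin e' - (P.linkL e' - P.linkL e)) =
      (e.x + σ • P.linkL e) + σ • f := by rw [hf]; module
  rw [e1] at hI
  set m := e.x + σ • P.linkL e
  have e2 : e.x + σ • (f + P.linkL e') = (e.x + σ • f) + σ • P.linkL e' := by module
  rw [e2] at hII
  have young : ∀ y m : PiLp 2 X, -inner ℝ y m ≤ σ / 2 * ‖y‖ ^ 2 + σ⁻¹ / 2 * ‖m‖ ^ 2 := by
    intro y m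
    have h1 : 0 ≤ σ⁻¹ * ‖σ • y + m‖ ^ 2 := by positivity
    rw [norm_add_sq_real, norm_smul, mul_pow, inner_smul_left, Real.norm_eq_abs, sq_abs] at h1
    simp only [conj_trivial] at h1
    have h2 : σ⁻¹ * (σ ^ 2 * ‖y‖ ^ 2 + 2 * (σ * inner ℝ y m) + ‖m‖ ^ 2) =
        σ * ‖y‖ ^ 2 + 2 * inner ℝ y m + σ⁻¹ * ‖m‖ ^ 2 := by
      field_simp
    linarith
  have young' : ∀ y m : PiLp 2 X, inner ℝ y m ≤ 1 / 2 * ‖y‖ ^ 2 + 1 / 2 * ‖m‖ ^ 2 := by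
    intro y m
    have h1 : 0 ≤ ‖y - m‖ ^ 2 := sq_nonneg _
    rw [norm_sub_sq_real] at h1
    linarith
  have hyR : inner ℝ e'.s (P.resolv σ e.s) ≤
      1 / 2 * inner ℝ e'.s (P.resolv σ e'.s) + 1 / 2 * inner ℝ e.s (P.resolv σ e.s) := by
    have h1 := P.resolv_nonneg hσ (e'.s - e.s)
    have h2 := P.resolv_inner hσ e.s e'.s
    have h3 := real_inner_comm (P.resolv σ e.s) e'.s
    simp only [map_sub, inner_sub_left, inner_sub_right] at h1
    linarith
  have hsq : ∀ y m : PiLp 2 X, ‖y + m‖ ^ 2 ≤ 2 * ‖y‖ ^ 2 + 2 * ‖m‖ ^ 2 := by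
    intro y m
    rw [norm_add_sq_real]
    linarith [young' y m]
  simp only [inner_add_right _ _ (σ • _), inner_smul_right, inner_sub_right,
    real_inner_self_eq_norm_sq] at hI hII
  have S1 : σ * ‖f‖ ^ 2 + σ * inner ℝ e'.s (P.resolv σ e'.s) + σ * ‖P.coupL e'‖ ^ 2 ≤ ψ₁ e := by
    have h1 := young f m
    have h2 := mul_le_mul_of_nonneg_left hyR hσ.le
    have h3 := mul_le_mul_of_nonneg_left (young' (P.coupL e') (P.coupL e)) hσ.le
    change _ ≤ σ⁻¹ * ‖m‖ ^ 2 + σ * inner ℝ e.s (P.resolv σ e.s) + σ * ‖P.coupL e‖ ^ 2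
    linarith
  have hRnn := mul_nonneg hσ.le (P.resolv_nonneg hσ e'.s)
  have hcnn : 0 ≤ σ * ‖P.coupL e'‖ ^ 2 := by positivity
  have hpnn : 0 ≤ σ * ‖P.projzL e'‖ ^ 2 := by positivity
  have hfnn : 0 ≤ σ * ‖f‖ ^ 2 := by positivity
  have S2 : σ * ‖P.linkL e'‖ ^ 2 + σ * ‖P.projzL e'‖ ^ 2 ≤ 2 * ψ₁ e + ψ₂ e := by
    have h1 := young (P.linkL e') (e.x + σ • f)
    rw [inner_add_right, inner_smul_right] at h1
    have h3 := mul_le_mul_of_nonneg_left (young' (P.projzL e') (P.projzL e)) hσ.le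
    have h4 : σ⁻¹ * ‖e.x + σ • f‖ ^ 2 ≤ 2 * σ⁻¹ * ‖e.x‖ ^ 2 + 2 * (σ * ‖f‖ ^ 2) := by
      have h5 := mul_le_mul_of_nonneg_left (hsq e.x (σ • f)) (inv_pos.2 hσ).le
      rw [norm_smul, mul_pow, Real.norm_eq_abs, sq_abs] at h5
      have h6 : σ⁻¹ * (2 * ‖e.x‖ ^ 2 + 2 * (σ ^ 2 * ‖f‖ ^ 2)) =
          2 * σ⁻¹ * ‖e.x‖ ^ 2 + 2 * (σ * ‖f‖ ^ 2) := by field_simp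
      linarith
    change _ ≤ 2 * ψ₁ e + (2 * σ⁻¹ * ‖e.x‖ ^ 2 + σ * ‖P.projzL e‖ ^ 2)
    linarith
  have hfl := hsq f (P.linkL e')
  have hxx : (τ * σ)⁻¹ * ‖e'.x‖ ^ 2 ≤
      2 * (τ * σ)⁻¹ * ‖e.x‖ ^ 2 + 2 * τ * σ * ‖f + P.linkL e'‖ ^ 2 := by
    have h5 := mul_le_mul_of_nonneg_left (hsq e.x ((τ * σ) • (f + P.linkL e')))
      (inv_pos.2 (mul_pos hτ hσ)).le
    rw [norm_smul, mul_pow, Real.norm_eq_abs, sq_abs] at h5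
    rw [hx]
    refine h5.trans (le_of_eq ?_)
    field_simp
  have h7 : (2 * τ + a) * σ * ‖f + P.linkL e'‖ ^ 2 ≤
      (4 * τ + 2 * a) * (σ * ‖f‖ ^ 2 + σ * ‖P.linkL e'‖ ^ 2) := by
    have := mul_le_mul_of_nonneg_left hfl (show 0 ≤ (2 * τ + a) * σ by positivity)
    linarith
  have h8 : (4 * τ + 2 * a) * (σ * ‖f‖ ^ 2 + σ * ‖P.linkL e'‖ ^ 2) ≤
      (4 * τ + 2 * a) * (3 * ψ₁ e + ψ₂ e) :=
    mul_le_mul_of_nonneg_left (by linarith) (by positivity)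
  change _ ≤ 2 * (τ * σ)⁻¹ * ‖e.x‖ ^ 2 + (4 * τ + 2 * a + 1) * (3 * ψ₁ e + ψ₂ e)
  rw [energy, hdl]
  linarith

end StepBounds

end Problem
end BlockAngular

/-! ### Convergence and linear rate of sGS-ADMM -/

theorem mainTheorem2 {N : ℕ} {X Y : Fin (N + 1) → Type*}
    [∀ i, NormedAddCommGroup (X i)] [∀ i, InnerProductSpace ℝ (X i)]
    [∀ i, FiniteDimensional ℝ (X i)]
    [∀ i, NormedAddCommGroup (Y i)] [∀ i, InnerProductSpace ℝ (Y i)]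
    [∀ i, FiniteDimensional ℝ (Y i)]
    (P : BlockAngular.Problem N X Y) (hB : Function.Surjective P.B)
    (σ τ : ℝ) (hσ : 0 < σ) (hτ : 0 < τ) (hτ' : τ < (1 + Real.sqrt 5) / 2)
    (u : ℕ → P.State) (hu : P.IsSGSADMM σ τ u) :
    ((P.PrimalSlater ∧ P.DualSlater) ∨ P.kktSet.Nonempty →
      ∃ ubar : P.State, Filter.Tendsto u Filter.atTop (nhds ubar) ∧
        P.IsDualOptimal ubar.y ubar.w ubar.s ubar.z ∧ P.IsPrimalOptimal ubar.x) ∧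
    (∀ ubar ∈ P.kktSet, Filter.Tendsto u Filter.atTop (nhds ubar) →
      P.ResidualSubregularAt ubar → P.LinearlyConvergesTo u ubar) := by
  obtain ⟨a, α, ha, hα0, hα1, hα2, hα3⟩ := BlockAngular.exists_steplength_constants hτ hτ'
  have hstep : ∀ k, P.IsOptimalStep σ τ (u k) (u (k + 1)) := fun k => (hu k).isOptimalStep hσ
  have hc := P.continuous_energy (σ := σ) (τ := τ) a
  obtain ⟨c₁, hc₁, hlow⟩ := BlockAngular.exists_quadratic_lower_bound hc (P.energy_smul a)
    (P.energy_pos hB hσ hτ ha)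
  obtain ⟨c₂, -, hup⟩ := BlockAngular.exists_quadratic_upper_bound hc (P.energy_smul a)
  obtain ⟨C, hC0, hC⟩ := P.exists_residual_bound hσ τ
  have hCσ : 0 < C + σ := by linarith
  have hfejer : BlockAngular.IsFejer u P.kktSet (fun v => ‖P.residual v‖) (P.energy σ τ a)
      -- At k = 0 truncated subtraction makes this term 0; the decrease is claimed only from k = 1,
      -- where a preceding step exists.
      (fun k => σ * ‖P.projzL (u k - u (k - 1))‖ ^ 2) c₁ c₂ (σ * α / (C + σ)) := by
    refine ⟨hc₁, by positivity, hlow, hup, fun k => by positivity, fun k hk p hp => ?_⟩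
    obtain ⟨j, rfl⟩ := Nat.exists_eq_add_of_le' hk
    have h1 := (hstep j).energy_le hσ hτ ha hα1 hα2 hα3 (hstep (j + 1)) hp
    have h2 := hC _ _ (hstep (j + 1))
    have h3 := P.decr_nonneg hσ (u (j + 1)) (u (j + 1 + 1))
    simp only [Nat.add_sub_cancel]
    set q := ‖P.projzL (u (j + 1 + 1) - u (j + 1))‖ ^ 2 with hq
    have hq0 : 0 ≤ q := by positivity
    have h4 : σ * α / (C + σ) * (‖P.residual (u (j + 1 + 1))‖ ^ 2 + σ * q) ≤
        σ * (α * P.decr σ (u (j + 1)) (u (j + 1 + 1)) + q) := by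
      rw [div_mul_eq_mul_div, div_le_iff₀ hCσ]
      have h5 : ‖P.residual (u (j + 1 + 1))‖ ^ 2 + σ * q ≤
          (C + σ) * (P.decr σ (u (j + 1)) (u (j + 1 + 1)) + q) := by
        nlinarith [mul_nonneg hσ.le h3]
      have h6 := mul_le_mul_of_nonneg_left h5 (mul_pos hσ hα0).le
      have h7 : 0 ≤ σ * (C + σ) * ((1 - α) * q) := by
        have : 0 ≤ 1 - α := by linarith
        positivity
      linarith
    linarith
  have hzero : ∀ v, ‖P.residual v‖ = 0 → v ∈ P.kktSet := fun v hv => norm_eq_zero.1 hv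
  constructor
  · intro h
    have hne : P.kktSet.Nonempty := h.elim (fun h => P.kktSet_nonempty_of_slater h.1 h.2) id
    obtain ⟨p, hp, hlim⟩ := hfejer.exists_tendsto P.continuous_residual.norm hzero hne
    exact ⟨p, hlim, P.isDualOptimal_of_mem_kktSet hp, P.isPrimalOptimal_of_mem_kktSet hp⟩
  · rintro p hp hlim ⟨η, -, r, hr, hsub⟩
    obtain ⟨D, hD0, hD⟩ := P.exists_energy_step_bound hσ hτ ha
    obtain ⟨Cz, hCz0, hCz⟩ := BlockAngular.exists_norm_map_le P.projzL
    have hL : ∀ k, ‖u (k + 1) - p‖ ≤ √(D / c₁) * ‖u k - p‖ := by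
      intro k
      have h1 := (hlow _).trans (hD _ _ p (hstep k) hp)
      refine le_of_sq_le_sq ?_ (by positivity)
      rw [mul_pow, Real.sq_sqrt (by positivity), div_mul_eq_mul_div, le_div_iff₀ hc₁]
      linarith
    refine hfejer.exists_linear_rate P.isClosed_kktSet hp hlim hr hL
      -- An increment is at most the sum of the new and the old error, the new one being √(D / c₁)
      -- times the old.
      (C := σ * (Cz * (√(D / c₁) + 1)) ^ 2) (fun k => ?_) hsub
    simp only [Nat.add_sub_cancel]
    rw [mul_assoc, ← mul_pow]
    refine mul_le_mul_of_nonneg_left (pow_le_pow_left₀ (norm_nonneg _) ?_ 2) hσ.le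
    refine (hCz _).trans ?_
    rw [mul_assoc]
    refine mul_le_mul_of_nonneg_left ?_ hCz0
    have h1 := norm_sub_le (u (k + 1) - p) (u k - p)
    rw [sub_sub_sub_cancel_right] at h1
    linarith [hL k]
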